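/- Let $\mathcal A=\mathbb Z[X]/(X^2)$, graded by $\deg 1=-1$, $\deg X=1$, and let $\mathcal F$ be the $(1+1)$-dimensional TQFT given by the Frobenius ring $\mathcal A$ with its multiplication, its unit, the comultiplication $\Delta(1)=1\otimes X+X\otimes 1$, $\Delta(X)=X\otimes X$, and the trace $\operatorname{tr}(1)=0$, $\operatorname{tr}(X)=1$. Write $M\{i\}$ for the graded group $M$ with the grading shifted up by $i$, and $W(\cdot)$ for reflection in the horizontal axis. For a set $s$ of $2m$ points of a line let $B(s)$ be the set of crossingless matchings of $s$, and let $$H(s)=\bigoplus_{a,b\in B(s)}\mathcal F(W(b)a)\{m\}$$ be the arc ring, whose multiplication is given by the maps $\mathcal F(W(c)b)\otimes\mathcal F(W(b)a)\to\mathcal F(W(c)a)$ induced by the cobordisms contracting $b$ with $W(b)$ (other products are zero). A flat tangle $T$ with bottom end points $s$, $|s|=2m$, and top end points $t$ defines the graded $(H(t),H(s))$-bimodule $\mathcal F(T)=\bigoplus_{b\in B(t),\,a\in B(s)}\mathcal F(W(b)Ta)\{m\}$, the actions again being given by contraction. Let $1\le k\le n-1$. A weight is a sequence $\lambda=(\lambda_1,\dots,\lambda_n)$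 with $\lambda_p\in\{0,1,2\}$ and $\sum_p\lambda_p=2k$. Let $H_\lambda=H(s(\lambda))$, where $s(\lambda)=\{p:\lambda_p=1\}$, let $\mathcal C(\lambda)$ be the category of finitely generated graded left $H_\lambda$-modules and grading-preserving homomorphisms, and let $\mathcal C=\bigoplus_\lambda\mathcal C(\lambda)$. For $1\le i\le n-1$ let $\epsilon_i=(0,\dots,0,1,-1,0,\dots,0)$, with the entries $1,-1$ in the positions $i,i+1$. The functor $\mathcal E_i:\mathcal C\to\mathcal C$ takes $\mathcal C(\lambda)$ to $\mathcal C(\lambda+\epsilon_i)$, being zero on $\mathcal C(\lambda)$ if $\lambda+\epsilon_i$ is not a weight; otherwise it is the tensor product over $H_\lambda$ with $\mathcal F(T)$, where $T$ is vertical away from the positions $i,i+1$ and near them is * the strand from the bottom position $i+1$ to the top position $i$ if $(\lambda_i,\lambda_{i+1})=(0,1)$, * the strand from the bottom position $i$ to the top position $i+1$ if $(\lambda_i,\lambda_{i+1})=(1,2)$, * a cup joining the top positions $i,i+1$ if $(\lambda_i,\lambda_{i+1})=(0,2)$, * a cap joining the bottom positions $i,i+1$ if $(\lambda_i,\lambda_{i+1})=(1,1)$.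 The functor $\mathcal F_i:\mathcal C\to\mathcal C$ is defined in the same way with the positions $i$ and $i+1$ exchanged: it takes $\mathcal C(\lambda)$ to $\mathcal C(\lambda-\epsilon_i)$, and the four cases are $(\lambda_i,\lambda_{i+1})=(1,0)$ (strand from $i$ to $i+1$), $(2,1)$ (strand from $i+1$ to $i$), $(2,0)$ (cup), $(1,1)$ (cap). If $(\lambda_i,\lambda_{i+1})=(0,2)$, then $s(\lambda)=s(\lambda+2\epsilon_i)$, so $H_\lambda$ and $H_{\lambda+2\epsilon_i}$ are canonically isomorphic, and $\mathcal E_i^{(2)}:\mathcal C(\lambda)\to\mathcal C(\lambda+2\epsilon_i)$ and $\mathcal F_i^{(2)}:\mathcal C(\lambda+2\epsilon_i)\to\mathcal C(\lambda)$ denote the mutually inverse equivalences induced by this isomorphism. On all other summands of $\mathcal C$ the functors $\mathcal E_i^{(2)}$ and $\mathcal F_i^{(2)}$ are zero. Then for all $i\in\{1,\dots,n-1\}$ there are isomorphisms of functors $\mathcal C\to\mathcal C$ $$\mathcal E_i^2\cong\mathcal E_i^{(2)}\{1\}\oplus\mathcal E_i^{(2)}\{-1\},\qquad \mathcal F_i^2\cong\mathcal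 F_i^{(2)}\{1\}\oplus\mathcal F_i^{(2)}\{-1\},$$ and for all $i,j\in\{1,\dots,n-1\}$ with $j=i\pm1$ there are isomorphisms of functors $$\mathcal E_i\mathcal E_j\mathcal E_i\cong\mathcal E_i^{(2)}\mathcal E_j\oplus\mathcal E_j\mathcal E_i^{(2)},\qquad \mathcal F_i\mathcal F_j\mathcal F_i\cong\mathcal F_i^{(2)}\mathcal F_j\oplus\mathcal F_j\mathcal F_i^{(2)}.$$ -/

import Mathlib

noncomputable section

namespace ArcAlg

open Equiv CategoryTheory
open scoped TensorProduct

/-! ### Closed 1-manifolds and saddle moves -/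

section Combinatorics

variable {V : Type}

/-- The circles of the closed 1-manifold obtained by gluing the (reflected) matching `b` to the
matching `a`: two points lie on the same circle iff they are joined by a chain of arcs. -/
def circ (b a : Perm V) : Setoid V :=
  Relation.EqvGen.setoid fun p q => q = b p ∨ q = a p

/-- The second family of arcs of the partially contracted manifold. -/
def glue [DecidableEq V] (b : Perm V) (K : Finset V) : V ⊕ V → V ⊕ V
  | Sum.inl p => if p ∈ K then Sum.inr p else Sum.inl (b p)
  | Sum.inr p => if p ∈ K then Sum.inl p else Sum.inr (b p)

/-- Components of the 1-manifold obtained from `W(c) b W(b) a` by performing the saddle moves at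
the arcs of `b` with end points in `K`.  The left copy of `V` is the line on which `W(c)` and `b`
are glued, the right copy is the line on which `W(b)` and `a` are glued; the saddle at an arc
`(p, b p)` replaces the two copies of this arc by two vertical segments. -/
def state [DecidableEq V] (c b a : Perm V) (K : Finset V) : Setoid (V ⊕ V) :=
  Relation.EqvGen.setoid fun x y => y = Sum.map c a x ∨ y = glue b K x

open Classical in
/-- Perform the saddle moves at the arcs `(p, b p)`, `p` in the list, one after another;
return those `p` at which the saddle splits a circle (rather than merging two circles). -/
def splits [DecidableEq V] (c b a : Perm V) : Finset V → List V → List V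
  | _, [] => []
  | K, p :: L =>
    (if state c b a K (Sum.inl p) (Sum.inr p) then [p] else []) ++
      splits c b a (insert p (insert (b p) K)) L

/-- The arcs of a matching, given by their left end points in increasing order. -/
def arcs [Fintype V] [LinearOrder V] (b : Perm V) : List V :=
  (Finset.univ.filter fun p => p < b p).sort (· ≤ ·)

/-- The splitting arcs of the contraction of `b` with `W(b)`. -/
def splitArcs [Fintype V] [LinearOrder V] (c b a : Perm V) : List V := splits c b a ∅ (arcs b)

end Combinatorics

section Lemmas

variable {V : Type}

theorem circ_le {b a : Perm V} {t : Setoid V} (hb : ∀ p, t p (b p)) (ha : ∀ p, t p (a p)) :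
    circ b a ≤ t := by
  apply Setoid.eqvGen_le
  rintro x y (rfl | rfl)
  exacts [hb x, ha x]

theorem circ_left (b a : Perm V) (p : V) : circ b a p (b p) :=
  Relation.EqvGen.rel _ _ (Or.inl rfl)

theorem circ_right (b a : Perm V) (p : V) : circ b a p (a p) :=
  Relation.EqvGen.rel _ _ (Or.inr rfl)

theorem sameCycle_mul_swap {P : Type} [Finite P] [DecidableEq P] (σ σ' : Perm P) (Q : P → Prop)
    (u v : P) (huv : u ≠ v) (hu : Q u) (hv : Q v) (hQ : ∀ x, Q x → Q (σ x))
    (h : ∀ x, Q x → σ' x = σ (swap u v x)) : σ.SameCycle u v ↔ ¬ σ'.SameCycle u v := by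
  have hQk : ∀ k x, Q x → Q ((σ ^ k) x) := by
    intro k
    induction k with
    | zero => intro x hx; simpa using hx
    | succ k ih => intro x hx; rw [pow_succ', Perm.mul_apply]; exact hQ _ (ih x hx)
  constructor
  · intro hs hs'
    obtain ⟨k₀, -, hk₀⟩ := hs.exists_pow_eq'
    classical
    have hex : ∃ k, (σ ^ k) u = v := ⟨k₀, hk₀⟩
    set k := Nat.find hex with hkdef
    have hk : (σ ^ k) u = v := Nat.find_spec hex
    have hmin : ∀ j < k, (σ ^ j) u ≠ v := fun j hj => Nat.find_min hex hj
    have hk0 : k ≠ 0 := by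
      intro h0; rw [h0] at hk; exact huv (by simpa using hk)
    have hnu : ∀ j, 1 ≤ j → j ≤ k → (σ ^ j) u ≠ u := by
      intro j h1 h2 hj
      rcases Nat.lt_or_ge j k with h3 | h3
      · apply hmin (k - j) (by omega)
        have : (σ ^ (k - j)) ((σ ^ j) u) = v := by
          rw [← Perm.mul_apply, ← pow_add, Nat.sub_add_cancel h2, hk]
        rwa [hj] at this
      · have : j = k := le_antisymm h2 h3
        subst this
        exact huv (hj.symm.trans hk)
    have hZ : ∀ i, ∃ j, 1 ≤ j ∧ j ≤ k ∧ (σ' ^ i) v = (σ ^ j) u := by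
      intro i
      induction i with
      | zero => exact ⟨k, by omega, le_rfl, by simp [hk]⟩
      | succ i ih =>
        obtain ⟨j, h1, h2, hj⟩ := ih
        rw [pow_succ', Perm.mul_apply, hj, h _ (hQk _ _ hu)]
        rcases Nat.lt_or_ge j k with h3 | h3
        · refine ⟨j + 1, by omega, h3, ?_⟩
          rw [swap_apply_of_ne_of_ne (hnu j h1 h2) (hmin j h3), pow_succ', Perm.mul_apply]
        · have : j = k := le_antisymm h2 h3
          subst this
          refine ⟨1, le_rfl, by omega, ?_⟩
          rw [hk, swap_apply_right, pow_one]
    obtain ⟨i, -, hi⟩ := hs'.symm.exists_pow_eq'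
    obtain ⟨j, h1, h2, hj⟩ := hZ i
    exact hnu j h1 h2 (hj.symm.trans hi)
  · intro hs'
    by_contra hs
    apply hs'
    classical
    have hex : ∃ k, 1 ≤ k ∧ (σ ^ k) v = v :=
      ⟨orderOf σ, orderOf_pos σ, by simp [pow_orderOf_eq_one]⟩
    set k := Nat.find hex with hkdef
    have hk : 1 ≤ k ∧ (σ ^ k) v = v := Nat.find_spec hex
    have hmin : ∀ j < k, 1 ≤ j → (σ ^ j) v ≠ v := fun j hj h1 h2 => Nat.find_min hex hj ⟨h1, h2⟩
    have hZ : ∀ j, 1 ≤ j → j ≤ k → (σ' ^ j) u = (σ ^ j) v := by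
      intro j h1
      induction j, h1 using Nat.le_induction with
      | base => intro _; simp [h _ hu]
      | succ j h1 ih =>
        intro h2
        rw [pow_succ', Perm.mul_apply, ih (by omega), h _ (hQk _ _ hv),
          swap_apply_of_ne_of_ne _ (hmin j (by omega) h1), pow_succ', Perm.mul_apply]
        intro h3
        apply hs
        have : σ.SameCycle v u := ⟨j, by simpa using h3⟩
        exact this.symm
    refine ⟨k, ?_⟩
    rw [zpow_natCast, hZ k hk.1 le_rfl, hk.2]

/-- Two involutions: points in the same component are in the same orbit of the product, up to
applying the second involution. -/
theorem sameCycle_of_gen {P : Type} (f g : Perm P) (hf : ∀ x, f (f x) = x) (hg : ∀ x, g (g x) = x)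
    (x y : P) (h : Relation.EqvGen (fun x y => y = f x ∨ y = g x) x y) :
    (f * g).SameCycle x y ∨ (f * g).SameCycle x (g y) := by
  have key : ∀ y, ((f * g).SameCycle x y ∨ (f * g).SameCycle x (g y)) →
      (((f * g).SameCycle x (f y) ∨ (f * g).SameCycle x (g (f y))) ∧
      ((f * g).SameCycle x (g y) ∨ (f * g).SameCycle x (g (g y)))) := by
    intro y hy
    refine ⟨?_, ?_⟩
    · rcases hy with hy | hy
      · right
        have : (f * g) (g (f y)) = y := by simp [hf, hg]
        rw [← this] at hy
        exact Perm.sameCycle_apply_right.1 hy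
      · left
        have : (f * g) (g y) = f y := by simp [hg]
        rw [← this]
        exact Perm.sameCycle_apply_right.2 hy
    · rw [hg]; exact hy.symm
  let T : P → Prop := fun y => (f * g).SameCycle x y ∨ (f * g).SameCycle x (g y)
  have hT : ∀ y, T y ↔ T (f y) := fun y =>
    ⟨fun hy => (key y hy).1, fun hy => by have := (key _ hy).1; rwa [hf] at this⟩
  have hT' : ∀ y, T y ↔ T (g y) := fun y =>
    ⟨fun hy => (key y hy).2, fun hy => by have := (key _ hy).2; rwa [hg] at this⟩
  have : ∀ x y, Relation.EqvGen (fun x y => y = f x ∨ y = g x) x y → (T x ↔ T y) := by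
    intro x y h
    induction h with
    | rel x y h => rcases h with rfl | rfl; exacts [hT x, hT' x]
    | refl x => rfl
    | symm x y _ ih => exact ih.symm
    | trans x y z _ _ ih1 ih2 => exact ih1.trans ih2
  exact (this x y h).1 (Or.inl (Perm.SameCycle.refl _ _))

theorem gen_of_sameCycle {P : Type} [Finite P] (f g : Perm P) (x y : P)
    (h : (f * g).SameCycle x y) : Relation.EqvGen (fun x y => y = f x ∨ y = g x) x y := by
  obtain ⟨i, -, rfl⟩ := h.exists_pow_eq'
  induction i with
  | zero => exact Relation.EqvGen.refl _
  | succ i ih =>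
    have := ih ⟨i, by simp⟩
    rw [pow_succ', Perm.mul_apply, Perm.mul_apply]
    exact (this.trans _ _ _ (Relation.EqvGen.rel _ _ (Or.inr rfl))).trans _ _ _
      (Relation.EqvGen.rel _ _ (Or.inl rfl))

/-- `a` is a perfect matching of the set `S` each of whose arcs joins points of different
sign. -/
structure Bip (S : Finset V) (ε : V → Bool) (a : Perm V) : Prop where
  inv : ∀ p, a (a p) = p
  mem : ∀ p, p ∈ S → a p ∈ S
  flip : ∀ p, p ∈ S → ε (a p) = !ε p
  fix : ∀ p, p ∉ S → a p = p

variable [DecidableEq V]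

theorem glue_invol (b : Perm V) (hb : ∀ p, b (b p) = p) (K : Finset V)
    (hK : ∀ p, p ∈ K ↔ b p ∈ K) (x : V ⊕ V) : glue b K (glue b K x) = x := by
  rcases x with p | p <;> by_cases h : p ∈ K
  · simp [glue, h]
  · simp [glue, h, (hK p).not.1 h, hb]
  · simp [glue, h]
  · simp [glue, h, (hK p).not.1 h, hb]

/-- A saddle move at an arc merges two circles or splits a circle into two. -/
theorem state_dichotomy [Finite V] {S : Finset V} {ε : V → Bool} {c b a : Perm V} (hc : Bip S ε c)
    (hb : Bip S ε b) (ha : Bip S ε a) (K : Finset V) (hK : ∀ p, p ∈ K ↔ b p ∈ K) (p : V)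
    (hp : p ∈ S) (hpK : p ∉ K) :
    state c b a K (Sum.inl p) (Sum.inr p) ↔
      ¬ state c b a (insert p (insert (b p) K)) (Sum.inr p) (Sum.inr (b p)) := by
  set K' := insert p (insert (b p) K) with hK'def
  have hK' : ∀ q, q ∈ K' ↔ b q ∈ K' := by
    intro q
    have e1 : b q = p ↔ q = b p := ⟨fun h => by rw [← h, hb.inv], fun h => by rw [h, hb.inv]⟩
    simp only [hK'def, Finset.mem_insert, ← hK, b.injective.eq_iff, e1]
    tauto
  have hbp : b p ≠ p := fun h => by
    have := hb.flip p hp; rw [h] at this; cases h' : ε p <;> simp [h'] at this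
  have hbpK : b p ∉ K := (hK p).not.1 hpK
  let f : Perm (V ⊕ V) := Perm.sumCongr c a
  have hfe : ∀ x, f x = Sum.map c a x := fun x => rfl
  have hf : ∀ x, f (f x) = x := by rintro (x | x) <;> simp [f, hc.inv, ha.inv]
  let g : Perm (V ⊕ V) := Function.Involutive.toPerm (glue b K) (glue_invol b hb.inv K hK)
  let g' : Perm (V ⊕ V) := Function.Involutive.toPerm (glue b K') (glue_invol b hb.inv K' hK')
  have hge : ∀ x, g x = glue b K x := fun x => rfl
  have hge' : ∀ x, g' x = glue b K' x := fun x => rfl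
  have hg : ∀ x, g (g x) = x := glue_invol b hb.inv K hK
  have hg' : ∀ x, g' (g' x) = x := glue_invol b hb.inv K' hK'
  have hst : ∀ x y, state c b a K x y ↔ Relation.EqvGen (fun x y => y = f x ∨ y = g x) x y :=
    fun x y => Iff.rfl
  have hst' : ∀ x y, state c b a K' x y ↔
      Relation.EqvGen (fun x y => y = f x ∨ y = g' x) x y := fun x y => Iff.rfl
  let Q : V ⊕ V → Prop := Sum.elim (fun x => x ∈ S ∧ ε x = ε p) (fun x => x ∈ S ∧ ε x = !ε p)
  have hgQ : ∀ (L : Finset V) x, Q x → ¬ Q (glue b L x) ∧ Q (f (glue b L x)) := by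
    rintro L (x | x) ⟨h1, h2⟩ <;> by_cases hx : x ∈ L
    · simp [Q, glue, hx, f, h1, h2, ha.mem, ha.flip]
    · simp [Q, glue, hx, f, h1, h2, hb.mem, hb.flip, hc.mem, hc.flip]
    · simp [Q, glue, hx, f, h1, h2, hc.mem, hc.flip]
    · simp [Q, glue, hx, f, h1, h2, hb.mem, hb.flip, ha.mem, ha.flip]
  have hQu : Q (Sum.inl p) := ⟨hp, rfl⟩
  have hQv : Q (Sum.inr (b p)) := ⟨hb.mem p hp, hb.flip p hp⟩
  have hfin : ∀ (L : Finset V) (k : Perm (V ⊕ V)) (hk : ∀ x, k x = glue b L x)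
      (hki : ∀ x, k (k x) = x),
      Relation.EqvGen (fun x y => y = f x ∨ y = k x) (Sum.inl p) (Sum.inr (b p)) ↔
        (f * k).SameCycle (Sum.inl p) (Sum.inr (b p)) := by
    intro L k hk hki
    refine ⟨fun h => ?_, gen_of_sameCycle f k _ _⟩
    rcases sameCycle_of_gen f k hf hki _ _ h with h | h
    · exact h
    · exfalso
      obtain ⟨i, -, hi⟩ := h.exists_pow_eq'
      have : ∀ i : ℕ, Q (((f * k) ^ i) (Sum.inl p)) := by
        intro i
        induction i with
        | zero => exact hQu
        | succ i ih =>
          rw [pow_succ', Perm.mul_apply, Perm.mul_apply, hk]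
          exact (hgQ L _ ih).2
      have h1 := this i
      rw [hi, hk] at h1
      exact (hgQ L _ hQv).1 h1
  have hsw := sameCycle_mul_swap (f * g) (f * g') Q (Sum.inl p) (Sum.inr (b p)) (by simp) hQu hQv
    (fun x hx => (hgQ K x hx).2) (by
      rintro x hx
      rw [Perm.mul_apply, Perm.mul_apply]
      congr 1
      rw [hge, hge']
      rcases x with x | x
      · by_cases hxp : x = p
        · subst hxp
          simp [glue, K', hbpK, hb.inv]
        · have hxb : x ≠ b p := by
            rintro rfl
            have := hx.2
            rw [hb.flip p hp] at this
            cases h' : ε p <;> simp [h'] at this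
          rw [swap_apply_of_ne_of_ne (by simpa using hxp) (by simp)]
          simp [glue, K', hxp, hxb]
      · by_cases hxp : x = b p
        · subst hxp
          simp [glue, K', hpK]
        · have hxb : x ≠ p := by
            rintro rfl
            have := hx.2
            cases h' : ε x <;> simp [h'] at this
          rw [swap_apply_of_ne_of_ne (by simp) (by simpa using hxp)]
          simp [glue, K', hxp, hxb])
  rw [← hfin K g hge hg, ← hfin K' g' hge' hg', ← hst, ← hst'] at hsw
  have e1 : state c b a K (Sum.inr p) (Sum.inr (b p)) :=
    Relation.EqvGen.rel _ _ (Or.inr (by simp [glue, hpK]))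
  have e2 : state c b a K' (Sum.inl p) (Sum.inr p) :=
    Relation.EqvGen.rel _ _ (Or.inr (by simp [glue, K']))
  constructor
  · intro h h'
    exact hsw.1 ((state c b a K).trans h e1) ((state c b a K').trans e2 h')
  · intro h
    refine (state c b a K).trans (hsw.2 fun h' => h ?_) ((state c b a K).symm e1)
    exact (state c b a K').trans ((state c b a K').symm e2) h'

/-- After the saddle move at `p`, any equivalence relation containing the new components and
identifying `p` with `b p` contains the old components. -/
theorem state_le_of_state {c b a : Perm V} (hbb : ∀ p, b (b p) = p) {K : Finset V} {p : V}
    {t : Setoid (V ⊕ V)}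
    (h : state c b a (insert p (insert (b p) K)) ≤ t) (ht : t (Sum.inr p) (Sum.inr (b p))) :
    state c b a K ≤ t := by
  set K' := insert p (insert (b p) K) with hK'def
  have e1 : t (Sum.inl p) (Sum.inr p) :=
    h (Relation.EqvGen.rel _ _ (Or.inr (by simp [glue, K'])))
  have e2 : t (Sum.inl (b p)) (Sum.inr (b p)) :=
    h (Relation.EqvGen.rel _ _ (Or.inr (by simp [glue, K'])))
  have e3 : t (Sum.inl p) (Sum.inl (b p)) := t.trans e1 (t.trans ht (t.symm e2))
  apply Setoid.eqvGen_le
  rintro x y (rfl | rfl)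
  · exact h (Relation.EqvGen.rel _ _ (Or.inl rfl))
  · have hx : t x (glue b K' x) := h (Relation.EqvGen.rel _ _ (Or.inr rfl))
    rcases x with x | x
    · by_cases h1 : x = p
      · subst h1
        by_cases h2 : x ∈ K
        · simpa [glue, h2] using e1
        · simpa [glue, h2] using e3
      · by_cases h2 : x = b p
        · subst h2
          by_cases h2 : b p ∈ K
          · simpa [glue, h2] using e2
          · simpa [glue, h2, hbb] using t.symm e3
        · simpa [glue, K', h1, h2] using hx
    · by_cases h1 : x = p
      · subst h1
        by_cases h2 : x ∈ K
        · simpa [glue, h2] using t.symm e1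
        · simpa [glue, h2] using ht
      · by_cases h2 : x = b p
        · subst h2
          by_cases h2 : b p ∈ K
          · simpa [glue, h2] using t.symm e2
          · simpa [glue, h2, hbb] using t.symm ht
        · simpa [glue, K', h1, h2] using hx

/-- Dually, an equivalence relation containing the old components and identifying the two copies
of `p` contains the new components. -/
theorem state_le_of_state' {c b a : Perm V} {K : Finset V} {p : V}
    {t : Setoid (V ⊕ V)} (hpK : p ∉ K) (hbK : b p ∉ K)
    (h : state c b a K ≤ t) (ht : t (Sum.inl p) (Sum.inr p)) :
    state c b a (insert p (insert (b p) K)) ≤ t := by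
  have e1 : t (Sum.inl p) (Sum.inl (b p)) :=
    h (Relation.EqvGen.rel _ _ (Or.inr (by simp [glue, hpK])))
  have e2 : t (Sum.inr p) (Sum.inr (b p)) :=
    h (Relation.EqvGen.rel _ _ (Or.inr (by simp [glue, hpK])))
  have e3 : t (Sum.inl (b p)) (Sum.inr (b p)) := t.trans (t.symm e1) (t.trans ht e2)
  apply Setoid.eqvGen_le
  rintro x y (rfl | rfl)
  · exact h (Relation.EqvGen.rel _ _ (Or.inl rfl))
  · have hx : t x (glue b K x) := h (Relation.EqvGen.rel _ _ (Or.inr rfl))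
    rcases x with x | x
    · by_cases h1 : x = p
      · subst h1; simpa [glue] using ht
      · by_cases h2 : x = b p
        · subst h2; simpa [glue] using e3
        · simpa [glue, h1, h2] using hx
    · by_cases h1 : x = p
      · subst h1; simpa [glue] using t.symm ht
      · by_cases h2 : x = b p
        · subst h2; simpa [glue] using t.symm e3
        · simpa [glue, h1, h2] using hx

end Lemmas

section Counting

open Classical in
/-- The sum of a weight function over the classes of an equivalence relation. -/
def wt {P : Type} [Fintype P] (r : Setoid P) (w : P → ℤ) : ℤ := ∑ C : Quotient r, w C.out

/-- Identify two further points. -/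
def addEdge {P : Type} (r : Setoid P) (u v : P) : Setoid P where
  r x y := r x y ∨ (r x u ∧ r v y) ∨ (r x v ∧ r u y)
  iseqv := by
    refine ⟨fun x => Or.inl (r.refl x), ?_, ?_⟩
    · rintro x y (h | ⟨h1, h2⟩ | ⟨h1, h2⟩)
      · exact Or.inl (r.symm h)
      · exact Or.inr (Or.inr ⟨r.symm h2, r.symm h1⟩)
      · exact Or.inr (Or.inl ⟨r.symm h2, r.symm h1⟩)
    · rintro x y z (h | ⟨h1, h2⟩ | ⟨h1, h2⟩) (h' | ⟨h1', h2'⟩ | ⟨h1', h2'⟩)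
      · exact Or.inl (r.trans h h')
      · exact Or.inr (Or.inl ⟨r.trans h h1', h2'⟩)
      · exact Or.inr (Or.inr ⟨r.trans h h1', h2'⟩)
      · exact Or.inr (Or.inl ⟨h1, r.trans h2 h'⟩)
      · exact Or.inr (Or.inl ⟨h1, h2'⟩)
      · exact Or.inl (r.trans h1 h2')
      · exact Or.inr (Or.inr ⟨h1, r.trans h2 h'⟩)
      · exact Or.inl (r.trans h1 h2')
      · exact Or.inr (Or.inr ⟨h1, h2'⟩)

theorem le_addEdge {P : Type} (r : Setoid P) (u v : P) : r ≤ addEdge r u v :=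
  fun _ _ h => Or.inl h

theorem addEdge_rel {P : Type} (r : Setoid P) (u v : P) : addEdge r u v u v :=
  Or.inr (Or.inl ⟨r.refl u, r.refl v⟩)

theorem out_rel {P : Type} (r : Setoid P) (x : P) : r (Quotient.mk r x).out x :=
  Quotient.mk_out (s := r) x

theorem wt_add {P : Type} [Fintype P] (r : Setoid P) (w w' : P → ℤ) :
    wt r (w + w') = wt r w + wt r w' := by
  simp [wt, Finset.sum_add_distrib]

theorem wt_merge {P : Type} [Fintype P] {r r' : Setoid P} {u v : P} (hle : r ≤ r') (huv : r' u v)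
    (hn : ¬ r u v) (h : r' ≤ addEdge r u v) (w : P → ℤ) (hw : ∀ x y, r' x y → w x = w y) :
    wt r' w = wt r w - w u := by
  classical
  have hval : ∀ x, w (Quotient.mk r x).out = w x := fun x => hw _ _ (hle (out_rel r x))
  have hval' : ∀ x, w (Quotient.mk r' x).out = w x := fun x => hw _ _ (out_rel r' x)
  have e : wt r w = w (Quotient.mk r v).out +
      ∑ C ∈ Finset.univ.erase (Quotient.mk r v), w C.out :=
    (Finset.add_sum_erase _ _ (Finset.mem_univ _)).symm
  have hv : w v = w u := (hw _ _ huv).symm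
  rw [e, hval, hv, add_sub_cancel_left]
  symm
  refine Finset.sum_bij (fun C _ => Quotient.map' id (fun _ _ h => hle h) C)
    (fun _ _ => Finset.mem_univ _) ?_ ?_ ?_
  · intro C hC D hD hCD
    induction C using Quotient.inductionOn with | _ x
    induction D using Quotient.inductionOn with | _ y
    have hxy : r' x y := Quotient.exact hCD
    have hx : ¬ r x v := fun h' => (Finset.mem_erase.1 hC).1 (Quotient.sound h')
    have hy : ¬ r y v := fun h' => (Finset.mem_erase.1 hD).1 (Quotient.sound h')
    rcases h hxy with h1 | ⟨_, h2⟩ | ⟨h1, _⟩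
    · exact Quotient.sound h1
    · exact absurd (r.symm h2) hy
    · exact absurd h1 hx
  · intro C _
    induction C using Quotient.inductionOn with | _ x
    by_cases hx : r x v
    · refine ⟨Quotient.mk r u, ?_, ?_⟩
      · exact Finset.mem_erase.2 ⟨fun h' => hn (Quotient.exact h'), Finset.mem_univ _⟩
      · exact Quotient.sound (r'.trans huv (r'.symm (hle hx)))
    · exact ⟨Quotient.mk r x, Finset.mem_erase.2 ⟨fun h' => hx (Quotient.exact h'),
        Finset.mem_univ _⟩, rfl⟩
  · intro C _
    induction C using Quotient.inductionOn with | _ x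
    rw [hval]
    exact (hval' x).symm

theorem wt_comap {P P' : Type} [Fintype P] [Fintype P'] (ι : P → P') {r : Setoid P}
    {r' : Setoid P'} (h : ∀ x y, r x y ↔ r' (ι x) (ι y)) (w : P' → ℤ)
    (hw : ∀ x y, r' x y → w x = w y) (hs : ∀ z, w z ≠ 0 → ∃ x, r' (ι x) z) :
    wt r (fun x => w (ι x)) = wt r' w := by
  classical
  refine Finset.sum_of_injOn (fun C => Quotient.map' ι (fun x y hxy => (h x y).1 hxy) C) ?_ ?_ ?_ ?_
  · intro C _ D _ hCD
    induction C using Quotient.inductionOn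
    induction D using Quotient.inductionOn
    exact Quotient.sound ((h _ _).2 (Quotient.exact hCD))
  · intro C _; simp
  · intro C _ hC
    induction C using Quotient.inductionOn with | _ z
    by_contra h0
    obtain ⟨x, hx⟩ := hs _ h0
    exact hC ⟨Quotient.mk r x, by simp, Quotient.sound (r'.trans hx (out_rel r' z))⟩
  · intro C _
    induction C using Quotient.inductionOn with | _ x
    have h1 : w (Quotient.mk r' (ι x)).out = w (ι x) := hw _ _ (out_rel r' _)
    have h2 : w (ι (Quotient.mk r x).out) = w (ι x) := hw _ _ ((h _ _).1 (out_rel r x))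
    exact h2.trans h1.symm

theorem circ_invariant {V : Type} {b a : Perm V} {w : V → ℤ} (hb : ∀ p, w (b p) = w p)
    (ha : ∀ p, w (a p) = w p) (x y : V) (h : circ b a x y) : w x = w y := by
  have : circ b a ≤ Setoid.ker w := circ_le (fun p => (hb p).symm) (fun p => (ha p).symm)
  exact this h

variable {V : Type} [DecidableEq V]

theorem state_invariant {c b a : Perm V} {K : Finset V} {w : V ⊕ V → ℤ}
    (h : ∀ x, w (Sum.map c a x) = w x) (h' : ∀ x, w (glue b K x) = w x) (x y : V ⊕ V)
    (hxy : state c b a K x y) : w x = w y := by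
  have : state c b a K ≤ Setoid.ker w := by
    apply Setoid.eqvGen_le
    rintro x y (rfl | rfl)
    exacts [(h x).symm, (h' x).symm]
  exact this hxy

theorem state_empty_inl (c b a : Perm V) (x y : V) :
    circ c b x y ↔ state c b a ∅ (Sum.inl x) (Sum.inl y) := by
  constructor
  · have : circ c b ≤ Setoid.comap Sum.inl (state c b a ∅) := by
      apply circ_le
      · intro p; exact Relation.EqvGen.rel _ _ (Or.inl rfl)
      · intro p; exact Relation.EqvGen.rel _ _ (Or.inr (by simp [glue]))
    exact fun h => this h
  · let t : V ⊕ V → Quotient (circ c b) ⊕ Unit := Sum.map (Quotient.mk _) (fun _ => ())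
    have : state c b a ∅ ≤ Setoid.ker t := by
      apply Setoid.eqvGen_le
      rintro x y (rfl | rfl) <;> rcases x with x | x
      · exact congrArg Sum.inl (Quotient.sound (circ_left c b x))
      · rfl
      · exact congrArg Sum.inl (Quotient.sound (circ_right c b x))
      · rfl
    intro h
    exact Quotient.exact (Sum.inl_injective (this h))

theorem state_empty_inr (c b a : Perm V) (x y : V) :
    circ b a x y ↔ state c b a ∅ (Sum.inr x) (Sum.inr y) := by
  constructor
  · have : circ b a ≤ Setoid.comap Sum.inr (state c b a ∅) := by
      apply circ_le
      · intro p; exact Relation.EqvGen.rel _ _ (Or.inr (by simp [glue]))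
      · intro p; exact Relation.EqvGen.rel _ _ (Or.inl rfl)
    exact fun h => this h
  · let t : V ⊕ V → Unit ⊕ Quotient (circ b a) := Sum.map (fun _ => ()) (Quotient.mk _)
    have : state c b a ∅ ≤ Setoid.ker t := by
      apply Setoid.eqvGen_le
      rintro x y (rfl | rfl) <;> rcases x with x | x
      · rfl
      · exact congrArg Sum.inr (Quotient.sound (circ_right b a x))
      · rfl
      · exact congrArg Sum.inr (Quotient.sound (circ_left b a x))
    intro h
    exact Quotient.exact (Sum.inr_injective (this h))

theorem state_final_le {S : Finset V} {ε : V → Bool} {c b a : Perm V}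
    (hb : Bip S ε b) :
    state c b a S ≤ Setoid.comap (Sum.elim id id) (circ c a) := by
  apply Setoid.eqvGen_le
  rintro x y (rfl | rfl) <;> rcases x with x | x
  · exact circ_left c a x
  · exact circ_right c a x
  · by_cases hx : x ∈ S
    · simp [glue, hx, Setoid.comap_rel]
    · simp [glue, hx, hb.fix x hx]
  · by_cases hx : x ∈ S
    · simp [glue, hx, Setoid.comap_rel]
    · simp [glue, hx, hb.fix x hx]

theorem state_final_inr {S : Finset V} {ε : V → Bool} {c b a : Perm V} (hc : Bip S ε c)
    (hb : Bip S ε b) (x y : V) :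
    circ c a x y ↔ state c b a S (Sum.inr x) (Sum.inr y) := by
  constructor
  · have : circ c a ≤ Setoid.comap Sum.inr (state c b a S) := by
      apply circ_le
      · intro p
        by_cases hp : p ∈ S
        · have h1 : state c b a S (Sum.inr p) (Sum.inl p) :=
            Relation.EqvGen.rel _ _ (Or.inr (by simp [glue, hp]))
          have h2 : state c b a S (Sum.inl p) (Sum.inl (c p)) :=
            Relation.EqvGen.rel _ _ (Or.inl rfl)
          have h3 : state c b a S (Sum.inl (c p)) (Sum.inr (c p)) :=
            Relation.EqvGen.rel _ _ (Or.inr (by simp [glue, hc.mem p hp]))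
          exact (state c b a S).trans h1 ((state c b a S).trans h2 h3)
        · rw [hc.fix p hp]
      · intro p; exact Relation.EqvGen.rel _ _ (Or.inl rfl)
    exact fun h => this h
  · exact fun h => state_final_le hb h

/-- The set of contracted points after the saddle moves at the arcs in the list. -/
def finalSet (b : Perm V) : Finset V → List V → Finset V
  | K, [] => K
  | K, p :: L => finalSet b (insert p (insert (b p) K)) L

theorem mem_finalSet (b : Perm V) (K : Finset V) (L : List V) (x : V) :
    x ∈ finalSet b K L ↔ x ∈ K ∨ ∃ p ∈ L, x = p ∨ x = b p := by
  induction L generalizing K with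
  | nil => simp [finalSet]
  | cons p L ih => simp [finalSet, ih, or_assoc, or_left_comm, or_comm]

theorem splits_subset (c b a : Perm V) (K : Finset V) (L : List V) :
    ∀ p ∈ splits c b a K L, p ∈ L := by
  induction L generalizing K with
  | nil => simp [splits]
  | cons q L ih =>
    intro p hp
    rw [splits, List.mem_append] at hp
    rcases hp with hp | hp
    · split_ifs at hp <;> simp_all
    · exact List.mem_cons_of_mem _ (ih _ p hp)

theorem insert_stable {b : Perm V} (hbb : ∀ p, b (b p) = p) {K : Finset V} (hK : ∀ p, p ∈ K ↔ b p ∈ K) (p : V)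
    (q : V) : q ∈ insert p (insert (b p) K) ↔ b q ∈ insert p (insert (b p) K) := by
  have e1 : b q = p ↔ q = b p := ⟨fun h => by rw [← h, hbb], fun h => by rw [h, hbb]⟩
  simp only [Finset.mem_insert, ← hK, b.injective.eq_iff, e1]
  tauto

end Counting

section Contraction

variable {V : Type} [Fintype V] [LinearOrder V] {S : Finset V} {ε : V → Bool} {c b a : Perm V}

theorem mem_arcs {p : V} : p ∈ arcs b ↔ p < b p := by simp [arcs]

open Classical in
theorem wt_splits_aux (hc : Bip S ε c) (hb : Bip S ε b) (ha : Bip S ε a) (w : V → ℤ)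
    (hwc : ∀ p, w (c p) = w p) (hwb : ∀ p, w (b p) = w p) (hwa : ∀ p, w (a p) = w p)
    (L : List V) (hL : L.Nodup) (K : Finset V) (hK : ∀ p, p ∈ K ↔ b p ∈ K)
    (hLK : ∀ p ∈ L, p ∉ K ∧ p < b p) (hLS : ∀ p ∈ L, p ∈ S) :
    wt (state c b a (finalSet b K L)) (Sum.elim w w) + (L.map w).sum =
      wt (state c b a K) (Sum.elim w w) + 2 * ((splits c b a K L).map w).sum := by
  have hinv : ∀ K x y, state c b a K x y → Sum.elim w w x = Sum.elim w w y := by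
    intro K x y h
    refine state_invariant ?_ ?_ x y h
    · rintro (x | x) <;> simp [hwc, hwa]
    · rintro (x | x) <;> by_cases hx : x ∈ K <;> simp [glue, hx, hwb]
  induction L generalizing K with
  | nil => simp [splits, finalSet]
  | cons p L ih =>
    set K' := insert p (insert (b p) K) with hK'def
    have hp := hLK p (by simp)
    have hpS := hLS p (by simp)
    have hbK : b p ∉ K := (hK p).not.1 hp.1
    have hstep : wt (state c b a K') (Sum.elim w w) + w p = wt (state c b a K) (Sum.elim w w) +
        2 * (((if state c b a K (Sum.inl p) (Sum.inr p) then [p] else []) : List V).map w).sum := by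
      have hd := state_dichotomy hc hb ha K hK p hpS hp.1
      by_cases h : state c b a K (Sum.inl p) (Sum.inr p)
      · have hle : state c b a K' ≤ state c b a K :=
          state_le_of_state' hp.1 hbK le_rfl h
        have hle2 : state c b a K ≤ addEdge (state c b a K') (Sum.inr p) (Sum.inr (b p)) :=
          state_le_of_state hb.inv (le_addEdge _ _ _) (addEdge_rel _ _ _)
        have := wt_merge hle (Relation.EqvGen.rel _ _ (Or.inr (by simp [glue, hp.1])))
          (hd.1 h) hle2 _ (hinv K)
        simp only [h, if_true, List.map_cons, List.map_nil, List.sum_cons, List.sum_nil] at this ⊢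
        simp only [Sum.elim_inr] at this
        linarith
      · have h' : state c b a K' (Sum.inr p) (Sum.inr (b p)) := by
          by_contra h'; exact h (hd.2 h')
        have hle : state c b a K ≤ state c b a K' := state_le_of_state hb.inv le_rfl h'
        have hle2 : state c b a K' ≤ addEdge (state c b a K) (Sum.inl p) (Sum.inr p) :=
          state_le_of_state' hp.1 hbK (le_addEdge _ _ _) (addEdge_rel _ _ _)
        have := wt_merge hle (Relation.EqvGen.rel _ _ (Or.inr (by simp [glue, K'])))
          h hle2 _ (hinv K')
        simp only [h, if_false, List.map_nil, List.sum_nil] at this ⊢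
        simp only [Sum.elim_inl] at this
        linarith
    have := ih (List.nodup_cons.1 hL).2 K' (insert_stable hb.inv hK p) (by
      intro q hq
      have hq' := hLK q (List.mem_cons_of_mem _ hq)
      refine ⟨?_, hq'.2⟩
      simp only [hK'def, Finset.mem_insert, not_or]
      refine ⟨?_, ?_, hq'.1⟩
      · rintro rfl; exact (List.nodup_cons.1 hL).1 hq
      · rintro rfl
        have h2 := hq'.2
        rw [hb.inv] at h2
        exact absurd hp.2 h2.asymm) (fun q hq => hLS q (List.mem_cons_of_mem _ hq))
    rw [finalSet, splits, List.map_append, List.sum_append, List.map_cons, List.sum_cons]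
    linarith

theorem finalSet_arcs (hb : Bip S ε b) : finalSet b ∅ (arcs b) = S := by
  have hne : ∀ p ∈ S, b p ≠ p := fun p hp h => by
    have := hb.flip p hp; rw [h] at this; cases h' : ε p <;> simp [h'] at this
  ext x
  rw [mem_finalSet]
  simp only [Finset.notMem_empty, false_or, mem_arcs]
  constructor
  · rintro ⟨p, hp, h⟩
    have hpS : p ∈ S := by
      by_contra h'; rw [hb.fix p h'] at hp; exact lt_irrefl _ hp
    rcases h with rfl | rfl
    exacts [hpS, hb.mem p hpS]
  · intro hx
    rcases lt_or_gt_of_ne (hne x hx) with h | h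
    · exact ⟨b x, by rwa [hb.inv], Or.inr (hb.inv x).symm⟩
    · exact ⟨x, h, Or.inl rfl⟩

theorem arcs_subset (hb : Bip S ε b) : ∀ p ∈ arcs b, p ∈ S := by
  intro p hp
  rw [mem_arcs] at hp
  by_contra h'; rw [hb.fix p h'] at hp; exact lt_irrefl _ hp

theorem splitArcs_subset (hb : Bip S ε b) : ∀ p ∈ splitArcs c b a, p ∈ S :=
  fun p hp => arcs_subset hb p (splits_subset _ _ _ _ _ p hp)

/-- Counting circles before and after the contraction. -/
theorem wt_splits (hc : Bip S ε c) (hb : Bip S ε b) (ha : Bip S ε a) (w : V → ℤ)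
    (hwc : ∀ p, w (c p) = w p) (hwb : ∀ p, w (b p) = w p) (hwa : ∀ p, w (a p) = w p)
    (hw0 : ∀ p, p ∉ S → w p = 0) :
    wt (circ c a) w + ((arcs b).map w).sum =
      wt (circ c b) w + wt (circ b a) w + 2 * ((splitArcs c b a).map w).sum := by
  have h := wt_splits_aux hc hb ha w hwc hwb hwa (arcs b) (Finset.sort_nodup ..) ∅ (by simp)
    (fun p hp => ⟨by simp, mem_arcs.1 hp⟩) (arcs_subset hb)
  rw [finalSet_arcs hb] at h
  have h1 : wt (circ c a) w = wt (state c b a S) (Sum.elim w w) := by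
    refine wt_comap Sum.inr (state_final_inr hc hb) (Sum.elim w w) ?_ ?_
    · apply state_invariant
      · rintro (x | x) <;> simp [hwc, hwa]
      · rintro (x | x) <;> by_cases hx : x ∈ S <;> simp [glue, hx, hwb]
    · rintro (z | z) hz
      · have hzS : z ∈ S := by by_contra h'; exact hz (hw0 z h')
        exact ⟨z, Relation.EqvGen.rel _ _ (Or.inr (by simp [glue, hzS]))⟩
      · exact ⟨z, (state c b a S).refl _⟩
  have h2 : wt (circ c b) w = wt (state c b a ∅) (Sum.elim w (0 : V → ℤ)) := by
    refine wt_comap Sum.inl (state_empty_inl c b a) (Sum.elim w (0 : V → ℤ)) ?_ ?_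
    · apply state_invariant
      · rintro (x | x) <;> simp [hwc]
      · rintro (x | x) <;> simp [glue, hwb]
    · rintro (z | z) hz
      · exact ⟨z, (state c b a ∅).refl _⟩
      · simp at hz
  have h3 : wt (circ b a) w = wt (state c b a ∅) (Sum.elim (0 : V → ℤ) w) := by
    refine wt_comap Sum.inr (state_empty_inr c b a) (Sum.elim (0 : V → ℤ) w) ?_ ?_
    · apply state_invariant
      · rintro (x | x) <;> simp [hwa]
      · rintro (x | x) <;> simp [glue, hwb]
    · rintro (z | z) hz
      · simp at hz
      · exact ⟨z, (state c b a ∅).refl _⟩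
  have h4 : (Sum.elim w w : V ⊕ V → ℤ) = Sum.elim w (0 : V → ℤ) + Sum.elim (0 : V → ℤ) w := by
    ext (x | x) <;> simp
  rw [h1, h, h2, h3, splitArcs]
  rw [h4]
  rw [wt_add]

theorem state_le_of_splits (hc : Bip S ε c) (hb : Bip S ε b) (ha : Bip S ε a)
    (t : Setoid (V ⊕ V))
    (L : List V) (hL : L.Nodup) (K : Finset V) (hK : ∀ p, p ∈ K ↔ b p ∈ K)
    (hLK : ∀ p ∈ L, p ∉ K ∧ p < b p) (hLS : ∀ p ∈ L, p ∈ S)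
    (hfin : state c b a (finalSet b K L) ≤ t)
    (hs : ∀ p ∈ splits c b a K L, t (Sum.inr p) (Sum.inr (b p))) :
    state c b a K ≤ t := by
  induction L generalizing K with
  | nil => exact hfin
  | cons p L ih =>
    have hp := hLK p (by simp)
    have hpS := hLS p (by simp)
    have hd := state_dichotomy hc hb ha K hK p hpS hp.1
    have := ih (List.nodup_cons.1 hL).2 _ (insert_stable hb.inv hK p) (by
      intro q hq
      have hq' := hLK q (List.mem_cons_of_mem _ hq)
      refine ⟨?_, hq'.2⟩
      simp only [Finset.mem_insert, not_or]
      refine ⟨?_, ?_, hq'.1⟩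
      · rintro rfl; exact (List.nodup_cons.1 hL).1 hq
      · rintro rfl
        have h2 := hq'.2
        rw [hb.inv] at h2
        exact absurd hp.2 h2.asymm) (fun q hq => hLS q (List.mem_cons_of_mem _ hq)) hfin
        (fun q hq => hs q (by rw [splits]; exact List.mem_append_right _ hq))
    refine state_le_of_state hb.inv this ?_
    by_cases h : state c b a K (Sum.inl p) (Sum.inr p)
    · exact hs p (by rw [splits, if_pos h]; simp)
    · apply this
      by_contra h'
      exact h (hd.2 h')

/-- The circles of the contracted manifold together with the splitting arcs connect everything
that was connected before the contraction. -/
theorem circ_le_of_splits (hc : Bip S ε c) (hb : Bip S ε b) (ha : Bip S ε a) {t : Setoid V}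
    (h : circ c a ≤ t) (hs : ∀ p ∈ splitArcs c b a, t p (b p)) :
    circ c b ≤ t ∧ circ b a ≤ t := by
  have key := state_le_of_splits hc hb ha (Setoid.comap (Sum.elim id id) t) (arcs b)
    (Finset.sort_nodup ..) ∅ (by simp) (fun p hp => ⟨by simp, mem_arcs.1 hp⟩) (arcs_subset hb)
    (by rw [finalSet_arcs hb]; exact fun x y hxy => h (state_final_le hb hxy)) hs
  exact ⟨fun x y hxy => key ((state_empty_inl c b a x y).1 hxy),
    fun x y hxy => key ((state_empty_inr c b a x y).1 hxy)⟩

end Contraction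

section Products

/-- In a square-zero situation, a product of factors `x_p + x_q` over the edges of a graph depends
only on the connected components of the graph and on the number of edges in each of them. -/
theorem prod_edges_eq {V R : Type} [Fintype V] [CommRing R] (x : V → R) (hx : ∀ p, x p ^ 2 = 0)
    (r : Setoid V) (hr : ∀ p q, r p q → x p = x q) (G G' : List (V × V))
    (h : ∀ t : Setoid V, r ≤ t → (∀ e ∈ G, t e.1 e.2) → ∀ e ∈ G', t e.1 e.2)
    (h' : ∀ t : Setoid V, r ≤ t → (∀ e ∈ G', t e.1 e.2) → ∀ e ∈ G, t e.1 e.2)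
    (hw : ∀ w : V → ℤ, (∀ p q, r p q → w p = w q) → (∀ e ∈ G, w e.1 = w e.2) →
      (∀ e ∈ G', w e.1 = w e.2) →
      (G.map fun e => w e.1).sum = (G'.map fun e => w e.1).sum) :
    (G.map fun e => x e.1 + x e.2).prod = (G'.map fun e => x e.1 + x e.2).prod := by
  classical
  let Q := Quotient r
  let mk : V → Q := Quotient.mk r
  let f : List (V × V) → MvPolynomial Q ℤ := fun G =>
    (G.map fun e => MvPolynomial.X (mk e.1) + MvPolynomial.X (mk e.2)).prod
  let D := f G - f G'
  let T : Polynomial ℤ := Polynomial.X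
  have hT : T ≠ -T := by
    intro hT
    have : Polynomial.eval 1 T = Polynomial.eval 1 (-T) := by rw [← hT]
    simp [T] at this
  let g : MvPolynomial Q (Polynomial ℤ) := MvPolynomial.map Polynomial.C D
  have hev : ∀ (χ : Q → Polynomial ℤ) (G : List (V × V)),
      MvPolynomial.eval χ (MvPolynomial.map Polynomial.C (f G)) =
        (G.map fun e => χ (mk e.1) + χ (mk e.2)).prod := by
    intro χ G
    simp only [f]
    induction G with
    | nil => simp
    | cons e G ih => simp [ih]
  have hzero : ∀ (χ : Q → Polynomial ℤ), (∀ i, χ i ∈ ({T, -T} : Finset (Polynomial ℤ))) →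
      ∀ G : List (V × V), (∃ e ∈ G, χ (mk e.1) ≠ χ (mk e.2)) →
      (G.map fun e => χ (mk e.1) + χ (mk e.2)).prod = 0 := by
    rintro χ hχ G ⟨e, he, hne⟩
    apply List.prod_eq_zero
    refine List.mem_map.2 ⟨e, he, ?_⟩
    have h1 := hχ (mk e.1)
    have h2 := hχ (mk e.2)
    simp only [Finset.mem_insert, Finset.mem_singleton] at h1 h2
    rcases h1 with h1 | h1 <;> rcases h2 with h2 | h2 <;> rw [h1, h2] at hne ⊢ <;> simp at hne ⊢
  have hcount : ∀ (χ : Q → Polynomial ℤ), (∀ i, χ i ∈ ({T, -T} : Finset (Polynomial ℤ))) →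
      ∀ G : List (V × V), (∀ e ∈ G, χ (mk e.1) = χ (mk e.2)) → ∃ m l : ℕ,
        (G.map fun e => if χ (mk e.1) = T then (1 : ℤ) else 0).sum = m ∧
        (G.map fun e => if χ (mk e.1) = T then (0 : ℤ) else 1).sum = l ∧
        (G.map fun e => χ (mk e.1) + χ (mk e.2)).prod = (T + T) ^ m * (-T + -T) ^ l := by
    intro χ hχ G hG
    induction G with
    | nil => exact ⟨0, 0, by simp⟩
    | cons e G ih =>
      obtain ⟨m, l, h1, h2, h3⟩ := ih (fun e he => hG e (List.mem_cons_of_mem _ he))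
      have h4 := hχ (mk e.1)
      have h5 := hG e (by simp)
      simp only [Finset.mem_insert, Finset.mem_singleton] at h4
      simp only [List.map_cons, List.sum_cons, List.prod_cons, h1, h2, h3, ← h5]
      rcases h4 with h4 | h4
      · refine ⟨m + 1, l, by simp [h4]; ring, by simp [h4], ?_⟩
        rw [h4]; ring
      · refine ⟨m, l + 1, by simp [h4, hT.symm], by simp [h4, hT.symm]; ring, ?_⟩
        rw [h4]; ring
  have hvan : ∀ χ : Q → Polynomial ℤ, (∀ i, χ i ∈ ({T, -T} : Finset (Polynomial ℤ))) →
      MvPolynomial.eval χ g = 0 := by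
    intro χ hχ
    simp only [g, D, map_sub, hev]
    rw [sub_eq_zero]
    let t : Setoid V := Setoid.ker fun p => χ (mk p)
    have hrt : r ≤ t := fun p q hpq => congrArg χ (Quotient.sound hpq)
    by_cases hG : ∀ e ∈ G, χ (mk e.1) = χ (mk e.2)
    · have hG' : ∀ e ∈ G', χ (mk e.1) = χ (mk e.2) := h t hrt hG
      obtain ⟨m, l, h1, h2, h3⟩ := hcount χ hχ G hG
      obtain ⟨m', l', h1', h2', h3'⟩ := hcount χ hχ G' hG'
      have e1 := hw (fun p => if χ (mk p) = T then (1 : ℤ) else 0)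
        (fun p q hpq => by
          have : mk p = mk q := Quotient.sound hpq
          simp [this])
        (fun e he => by simp [hG e he]) (fun e he => by simp [hG' e he])
      have e2 := hw (fun p => if χ (mk p) = T then (0 : ℤ) else 1)
        (fun p q hpq => by
          have : mk p = mk q := Quotient.sound hpq
          simp [this])
        (fun e he => by simp [hG e he]) (fun e he => by simp [hG' e he])
      have e3 : m = m' := by exact_mod_cast h1.symm.trans (e1.trans h1')
      have e4 : l = l' := by exact_mod_cast h2.symm.trans (e2.trans h2')
      rw [h3, h3', e3, e4]
    · have hG' : ¬ ∀ e ∈ G', χ (mk e.1) = χ (mk e.2) := fun hG' => hG (h' t hrt hG')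
      push Not at hG hG'
      rw [hzero χ hχ G hG, hzero χ hχ G' hG']
  obtain ⟨k, -, hk⟩ := MvPolynomial.combinatorial_nullstellensatz_exists_linearCombination
    (fun _ : Q => ({T, -T} : Finset (Polynomial ℤ))) (fun _ => ⟨T, by simp⟩) g hvan
  let ev : Polynomial ℤ →+* ℤ := Polynomial.evalRingHom 0
  have hD : MvPolynomial.map ev g = D := by
    simp only [g, MvPolynomial.map_map]
    have : ev.comp Polynomial.C = RingHom.id ℤ := RingHom.ext_int _ _
    rw [this, MvPolynomial.map_id]
  let Φ : MvPolynomial Q ℤ →+* R := (MvPolynomial.aeval fun C : Q => x C.out).toRingHom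
  have hΦX : ∀ p, Φ (MvPolynomial.X (mk p)) = x p := by
    intro p
    simp only [Φ, AlgHom.toRingHom_eq_coe, RingHom.coe_coe, MvPolynomial.aeval_X]
    exact hr _ _ (out_rel r p)
  have hΦD : Φ D = 0 := by
    rw [← hD, hk, Finsupp.linearCombination_apply, Finsupp.sum, map_sum, map_sum]
    apply Finset.sum_eq_zero
    intro i _
    rw [Finset.prod_pair hT, smul_eq_mul, map_mul, map_mul]
    have : MvPolynomial.map ev ((MvPolynomial.X i - MvPolynomial.C T) *
        (MvPolynomial.X i - MvPolynomial.C (-T))) = MvPolynomial.X i ^ 2 := by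
      simp [ev, T]; ring
    rw [this, map_pow]
    have : Φ (MvPolynomial.X i) ^ 2 = 0 := by
      simp [Φ, hx]
    rw [this, mul_zero]
  have hΦf : ∀ G, Φ (f G) = (G.map fun e => x e.1 + x e.2).prod := by
    intro G
    simp only [f]
    induction G with
    | nil => simp
    | cons e G ih => simp only [List.map_cons, List.prod_cons, map_mul, map_add, hΦX, ih]
  rw [← hΦf, ← hΦf, ← sub_eq_zero, ← map_sub]
  exact hΦD

end Products

/-! ### Crossingless matchings -/

/-- Crossingless matchings of a set `S` of points on a line, as involutions of the ambient set
`{0, …, n - 1}` whose non-fixed points are exactly the points of `S`. -/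
structure CM {n : ℕ} (S : Finset (Fin n)) where
  perm : Perm (Fin n)
  invol : ∀ p, perm (perm p) = p
  supp : ∀ p, p ∈ S ↔ perm p ≠ p
  noncrossing : ∀ p q, p < q → q < perm p → perm p < perm q → False

section Matchings

variable {n : ℕ} {S : Finset (Fin n)}

theorem CM.perm_injective : Function.Injective (CM.perm (S := S)) := by
  rintro ⟨a, _, _, _⟩ ⟨b, _, _, _⟩ h
  cases h
  rfl

instance : Fintype (CM S) :=
  haveI : Finite (CM S) := Finite.of_injective _ CM.perm_injective
  Fintype.ofFinite _

instance : DecidableEq (CM S) := fun a b =>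
  decidable_of_iff (a.perm = b.perm) CM.perm_injective.eq_iff

/-- The parity of the position of a point in `S`. -/
def sgn (S : Finset (Fin n)) (p : Fin n) : Bool := decide (Even (S.filter (· < p)).card)

theorem CM.mem (a : CM S) {p : Fin n} (hp : p ∈ S) : a.perm p ∈ S := by
  rw [a.supp, a.invol]
  exact ((a.supp p).1 hp).symm

theorem CM.sgn_flip_of_lt (a : CM S) {p : Fin n} (hp : p < a.perm p) :
    sgn S (a.perm p) = !sgn S p := by
  have hpS : p ∈ S := (a.supp p).2 hp.ne'
  set B := S.filter (fun q => p < q ∧ q < a.perm p) with hB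
  have hBeven : Even B.card := by
    have h0 : ∑ _q ∈ B, (1 : ZMod 2) = 0 := by
      refine Finset.sum_involution (fun q _ => a.perm q) (fun _ _ => by decide) ?_ ?_ ?_
      · intro q hq _
        exact (a.supp q).1 (Finset.mem_filter.1 hq).1
      · intro q hq
        obtain ⟨h1, h2, h3⟩ := Finset.mem_filter.1 hq
        refine Finset.mem_filter.2 ⟨a.mem h1, ?_, ?_⟩
        · by_contra h
          rcases lt_or_eq_of_le (not_lt.1 h) with h | h
          · exact a.noncrossing (a.perm q) p h (by rwa [a.invol]) (by rwa [a.invol])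
          · rw [← h, a.invol] at h3
            exact lt_irrefl _ h3
        · by_contra h
          rcases lt_or_eq_of_le (not_lt.1 h) with h | h
          · exact a.noncrossing p q h2 h3 h
          · exact h2.ne (a.perm.injective h)
      · intro q _; exact a.invol q
    rw [Finset.sum_const, nsmul_eq_mul, mul_one] at h0
    exact (ZMod.natCast_eq_zero_iff_even).1 h0
  have hcard : (S.filter (· < a.perm p)).card = (S.filter (· < p)).card + 1 + B.card := by
    have : S.filter (· < a.perm p) = insert p (S.filter (· < p)) ∪ B := by
      ext q
      simp only [Finset.mem_filter, Finset.mem_union, Finset.mem_insert, B]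
      constructor
      · rintro ⟨h1, h2⟩
        rcases lt_trichotomy q p with h | h | h
        · exact Or.inl (Or.inr ⟨h1, h⟩)
        · exact Or.inl (Or.inl h)
        · exact Or.inr ⟨h1, h, h2⟩
      · rintro ((rfl | ⟨h1, h2⟩) | ⟨h1, h2, h3⟩)
        exacts [⟨hpS, hp⟩, ⟨h1, h2.trans hp⟩, ⟨h1, h3⟩]
    rw [this, Finset.card_union_of_disjoint, Finset.card_insert_of_notMem]
    · simp
    · rw [Finset.disjoint_left]
      intro q hq hq'
      have h1 := (Finset.mem_filter.1 hq').2.1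
      rcases Finset.mem_insert.1 hq with rfl | hq
      · exact lt_irrefl _ h1
      · exact lt_asymm h1 (Finset.mem_filter.1 hq).2
  have : Even (S.filter (· < a.perm p)).card ↔ ¬ Even (S.filter (· < p)).card := by
    rw [hcard, Nat.even_add, Nat.even_add_one]
    tauto
  rw [sgn, sgn, ← decide_not]
  exact decide_eq_decide.2 this

theorem CM.bip (a : CM S) : Bip S (sgn S) a.perm where
  inv := a.invol
  mem _ hp := a.mem hp
  flip p hp := by
    rcases lt_or_gt_of_ne ((a.supp p).1 hp) with h | h
    · have := a.sgn_flip_of_lt (p := a.perm p) (by rwa [a.invol])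
      rw [a.invol] at this
      rw [this, Bool.not_not]
    · exact a.sgn_flip_of_lt h
  fix p hp := by
    by_contra h
    exact hp ((a.supp p).2 h)

end Matchings

/-! ### The two-dimensional TQFT -/

section TQFT

variable {n : ℕ}

/-- The relations `x_p² = 0`, `x_p = x_q` if `p, q` are joined by an arc, and `x_p = 0` if `p` does
not lie on the 1-manifold. -/
def relIdeal (S : Finset (Fin n)) (b a : Perm (Fin n)) : Ideal (MvPolynomial (Fin n) ℤ) :=
  Ideal.span {f | (∃ p, f = MvPolynomial.X p ^ 2) ∨
    (∃ p, f = MvPolynomial.X p - MvPolynomial.X (b p)) ∨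
    (∃ p, f = MvPolynomial.X p - MvPolynomial.X (a p)) ∨ ∃ p, p ∉ S ∧ f = MvPolynomial.X p}

/-- The abelian group `𝓕(W(b)a) = 𝓐^{⊗ I}`, where `𝓐 = ℤ[X]/(X²)` and `I` is the set of circles of
the closed 1-manifold `W(b)a` through the points of `S`: this is the quotient of
`ℤ[x_p, p ∈ S]` by the relations `x_p² = 0`, and `x_p = x_q` if `p` and `q` lie on the
same circle. -/
abbrev TQ (S : Finset (Fin n)) (b a : Perm (Fin n)) : Type :=
  MvPolynomial (Fin n) ℤ ⧸ relIdeal S b a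

/-- The class of a polynomial. -/
def cls (S : Finset (Fin n)) (b a : Perm (Fin n)) : MvPolynomial (Fin n) ℤ →+* TQ S b a :=
  Ideal.Quotient.mk _

/-- The number of circles of `W(b)a`. -/
def numCirc (S : Finset (Fin n)) (b a : Perm (Fin n)) : ℕ :=
  Nat.card {C : Quotient (circ b a) // ∃ p ∈ S, Quotient.mk _ p = C}

/-- The degree `d` part of `𝓕(W(b)a)`: `1 ∈ 𝓐` has degree `-1` and `X ∈ 𝓐` has degree `1`, so a
monomial of polynomial degree `k` has degree `2k - #circles`. -/
def tqDeg (S : Finset (Fin n)) (b a : Perm (Fin n)) (d : ℤ) : AddSubgroup (TQ S b a) :=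
  (MvPolynomial.restrictSupport ℤ
    {s : Fin n →₀ ℕ | 2 * (s.degree : ℤ) - numCirc S b a = d}).toAddSubgroup.map
      (cls S b a).toAddMonoidHom

/-- The map induced by the contraction cobordism from `W(c) b W(b) a` to `W(c) a` sends
`f ⊗ g` to `f g` times this polynomial: merging two circles is the
multiplication of `𝓐`, i.e. it identifies the variables of the two circles, and splitting a circle
into two circles with variables `x_p` and `x_{b p}` is the comultiplication
`1 ↦ 1 ⊗ X + X ⊗ 1`, `X ↦ X ⊗ X` of `𝓐`, i.e. multiplication by `x_p + x_{b p}`. -/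
def contr (c b a : Perm (Fin n)) : MvPolynomial (Fin n) ℤ :=
  ((splitArcs c b a).map fun p => MvPolynomial.X p + MvPolynomial.X (b p)).prod

variable {S : Finset (Fin n)}

theorem cls_surjective (b a : Perm (Fin n)) : Function.Surjective (cls S b a) :=
  Ideal.Quotient.mk_surjective

theorem cls_X_sq (b a : Perm (Fin n)) (p : Fin n) : cls S b a (MvPolynomial.X p) ^ 2 = 0 := by
  rw [← map_pow]
  exact Ideal.Quotient.eq_zero_iff_mem.2 (Ideal.subset_span (Or.inl ⟨p, rfl⟩))

theorem cls_X_not_mem (b a : Perm (Fin n)) {p : Fin n} (hp : p ∉ S) :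
    cls S b a (MvPolynomial.X p) = 0 :=
  Ideal.Quotient.eq_zero_iff_mem.2 (Ideal.subset_span (Or.inr (Or.inr (Or.inr ⟨p, hp, rfl⟩))))

theorem cls_X_eq (b a : Perm (Fin n)) (p q : Fin n) (h : circ b a p q) :
    cls S b a (MvPolynomial.X p) = cls S b a (MvPolynomial.X q) := by
  have : circ b a ≤ Setoid.ker fun p => cls S b a (MvPolynomial.X p) := by
    apply circ_le
    · intro p
      refine sub_eq_zero.1 ?_
      rw [← map_sub]
      exact Ideal.Quotient.eq_zero_iff_mem.2 (Ideal.subset_span (Or.inr (Or.inl ⟨p, rfl⟩)))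
    · intro p
      refine sub_eq_zero.1 ?_
      rw [← map_sub]
      exact Ideal.Quotient.eq_zero_iff_mem.2
        (Ideal.subset_span (Or.inr (Or.inr (Or.inl ⟨p, rfl⟩))))
  exact this h

/-- A ring homomorphism out of the polynomial ring, multiplied by an element, kills the
relations. -/
theorem mul_kills {R : Type} [CommRing R] (b a : Perm (Fin n))
    (θ : MvPolynomial (Fin n) ℤ →+* R) (E : R) (h0 : ∀ p, θ (MvPolynomial.X p) ^ 2 = 0)
    (h1 : ∀ p ∉ S, θ (MvPolynomial.X p) = 0)
    (h2 : ∀ p, E * (θ (MvPolynomial.X p) - θ (MvPolynomial.X (b p))) = 0)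
    (h3 : ∀ p, E * (θ (MvPolynomial.X p) - θ (MvPolynomial.X (a p))) = 0)
    (f : MvPolynomial (Fin n) ℤ) (hf : f ∈ relIdeal S b a) : E * θ f = 0 := by
  induction hf using Submodule.span_induction with
  | mem f hf =>
    rcases hf with ⟨p, rfl⟩ | ⟨p, rfl⟩ | ⟨p, rfl⟩ | ⟨p, hp, rfl⟩
    · simp [h0]
    · simpa using h2 p
    · simpa using h3 p
    · simp [h1 p hp]
  | zero => simp
  | add f g _ _ hf hg => simp [mul_add, hf, hg]
  | smul r f _ hf => rw [smul_eq_mul, map_mul, mul_left_comm, hf, mul_zero]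

theorem contr_kills {ε : Fin n → Bool} {c b a : Perm (Fin n)} (hc : Bip S ε c) (hb : Bip S ε b)
    (ha : Bip S ε a) (p q : Fin n) (h : circ c b p q ∨ circ b a p q) :
    cls S c a (contr c b a) *
      (cls S c a (MvPolynomial.X p) - cls S c a (MvPolynomial.X q)) = 0 := by
  let t : Setoid (Fin n) := Setoid.ker fun p =>
    cls S c a (contr c b a) * cls S c a (MvPolynomial.X p)
  have h1 : circ c a ≤ t := fun p q hpq => by
    show _ * _ = _ * _
    rw [cls_X_eq c a p q hpq]
  have h2 : ∀ p ∈ splitArcs c b a, t p (b p) := by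
    intro p hp
    show _ * _ = _ * _
    rw [← sub_eq_zero, ← mul_sub]
    obtain ⟨r, hr⟩ : (MvPolynomial.X p + MvPolynomial.X (b p) : MvPolynomial (Fin n) ℤ) ∣
        contr c b a := List.dvd_prod (List.mem_map.2 ⟨p, hp, rfl⟩)
    rw [hr, map_mul, map_add]
    have e1 := cls_X_sq (S := S) c a p
    have e2 := cls_X_sq (S := S) c a (b p)
    linear_combination cls S c a r * (e1 - e2)
  obtain ⟨h3, h4⟩ := circ_le_of_splits hc hb ha h1 h2
  rw [mul_sub, sub_eq_zero]
  rcases h with h | h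
  exacts [h3 h, h4 h]

theorem contr_kills_left {c b a : CM S} (f : MvPolynomial (Fin n) ℤ)
    (hf : f ∈ relIdeal S c.perm b.perm) :
    cls S c.perm a.perm (contr c.perm b.perm a.perm) * cls S c.perm a.perm f = 0 :=
  mul_kills c.perm b.perm _ _ (cls_X_sq _ _) (fun _ => cls_X_not_mem _ _)
    (fun p => contr_kills c.bip b.bip a.bip _ _ (Or.inl (circ_left _ _ p)))
    (fun p => contr_kills c.bip b.bip a.bip _ _ (Or.inl (circ_right _ _ p))) f hf

theorem contr_kills_right {c b a : CM S} (f : MvPolynomial (Fin n) ℤ)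
    (hf : f ∈ relIdeal S b.perm a.perm) :
    cls S c.perm a.perm (contr c.perm b.perm a.perm) * cls S c.perm a.perm f = 0 :=
  mul_kills b.perm a.perm _ _ (cls_X_sq _ _) (fun _ => cls_X_not_mem _ _)
    (fun p => contr_kills c.bip b.bip a.bip _ _ (Or.inr (circ_left _ _ p)))
    (fun p => contr_kills c.bip b.bip a.bip _ _ (Or.inr (circ_right _ _ p))) f hf

/-- `𝓕(W(b)a)` for crossingless matchings. -/
abbrev FF (b a : CM S) : Type := TQ S b.perm a.perm

/-- The class of a polynomial. -/
abbrev FF.mk (b a : CM S) : MvPolynomial (Fin n) ℤ →+* FF b a := cls S b.perm a.perm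

/-- The map `𝓕(W(c)b) ⊗ 𝓕(W(b)a) → 𝓕(W(c)a)` induced by the contraction cobordism. -/
def FF.mul (c b a : CM S) : FF c b →+ FF b a →+ FF c a :=
  QuotientAddGroup.lift (relIdeal S c.perm b.perm).toAddSubgroup
    (AddMonoidHom.mk'
      (fun f => QuotientAddGroup.lift (relIdeal S b.perm a.perm).toAddSubgroup
        (AddMonoidHom.mk' (fun g => FF.mk c a (f * g * contr c.perm b.perm a.perm))
          (fun g g' => by rw [← map_add]; congr 1; ring))
        (fun g hg => by
          have := contr_kills_right (c := c) g hg
          show FF.mk c a _ = 0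
          simp only [map_mul]
          linear_combination FF.mk c a f * this))
      (fun f f' => by
        refine AddMonoidHom.ext fun x => ?_
        obtain ⟨g, rfl⟩ := cls_surjective _ _ x
        show FF.mk c a _ = FF.mk c a _ + FF.mk c a _
        rw [← map_add]; congr 1; ring))
    (fun f hf => by
      refine AddMonoidHom.ext fun x => ?_
      obtain ⟨g, rfl⟩ := cls_surjective _ _ x
      have := contr_kills_left (a := a) f hf
      show FF.mk c a _ = 0
      simp only [map_mul]
      linear_combination FF.mk c a g * this)

theorem FF.mul_mk (c b a : CM S) (f g : MvPolynomial (Fin n) ℤ) :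
    FF.mul c b a (FF.mk c b f) (FF.mk b a g) =
      FF.mk c a (f * g * contr c.perm b.perm a.perm) := rfl

/-- Contracting `c` and `b` in `W(d)c W(c)b W(b)a` in the two possible orders. -/
theorem contr_assoc (d c b a : CM S) :
    FF.mk d a (contr d.perm c.perm b.perm * contr d.perm b.perm a.perm) =
      FF.mk d a (contr c.perm b.perm a.perm * contr d.perm c.perm a.perm) := by
  let E : Perm (Fin n) → Perm (Fin n) → Perm (Fin n) → List (Fin n × Fin n) :=
    fun c b a => (splitArcs c b a).map fun p => (p, b p)
  let x : Fin n → FF d a := fun p => FF.mk d a (MvPolynomial.X p)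
  have hE : ∀ c b a' : Perm (Fin n), FF.mk d a (contr c b a') = ((E c b a').map fun e => x e.1 + x e.2).prod := by
    intro c b a'
    rw [contr, map_list_prod, List.map_map, List.map_map]
    congr 1
  have hmem : ∀ c b a (e : Fin n × Fin n), e ∈ E c b a ↔ ∃ p ∈ splitArcs c b a, (p, b p) = e := by
    intro c b a e
    simp [E]
  have hS : ∀ c b a : CM S, ∀ e ∈ E c.perm b.perm a.perm, e.1 ∈ S := by
    intro c b a e he
    obtain ⟨p, hp, rfl⟩ := (hmem _ _ _ _).1 he
    exact splitArcs_subset b.bip p hp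
  rw [map_mul, map_mul, hE, hE, hE, hE, ← List.prod_append, ← List.prod_append, ← List.map_append,
    ← List.map_append]
  have key1 : ∀ t : Setoid (Fin n), circ d.perm a.perm ≤ t →
      (∀ e ∈ E d.perm c.perm b.perm ++ E d.perm b.perm a.perm, t e.1 e.2) →
      circ d.perm c.perm ≤ t ∧ circ b.perm a.perm ≤ t := by
    intro t ht hG
    have h1 := circ_le_of_splits d.bip b.bip a.bip ht
      (fun p hp => hG (p, b.perm p) (List.mem_append_right _ ((hmem _ _ _ _).2 ⟨p, hp, rfl⟩)))
    have h2 := circ_le_of_splits d.bip c.bip b.bip h1.1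
      (fun p hp => hG (p, c.perm p) (List.mem_append_left _ ((hmem _ _ _ _).2 ⟨p, hp, rfl⟩)))
    exact ⟨h2.1, h1.2⟩
  have key2 : ∀ t : Setoid (Fin n), circ d.perm a.perm ≤ t →
      (∀ e ∈ E c.perm b.perm a.perm ++ E d.perm c.perm a.perm, t e.1 e.2) →
      circ d.perm c.perm ≤ t ∧ circ b.perm a.perm ≤ t := by
    intro t ht hG
    have h1 := circ_le_of_splits d.bip c.bip a.bip ht
      (fun p hp => hG (p, c.perm p) (List.mem_append_right _ ((hmem _ _ _ _).2 ⟨p, hp, rfl⟩)))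
    have h2 := circ_le_of_splits c.bip b.bip a.bip h1.2
      (fun p hp => hG (p, b.perm p) (List.mem_append_left _ ((hmem _ _ _ _).2 ⟨p, hp, rfl⟩)))
    exact ⟨h1.1, h2.2⟩
  have hall : ∀ (t : Setoid (Fin n)) (y z u : Perm (Fin n)),
      (∀ p, t p (z p)) → ∀ e ∈ E y z u, t e.1 e.2 := by
    intro t y z u hz e he
    obtain ⟨p, _, rfl⟩ := (hmem _ _ _ _).1 he
    exact hz p
  refine prod_edges_eq x (cls_X_sq _ _) (circ d.perm a.perm) (cls_X_eq _ _) _ _ ?_ ?_ ?_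
  · intro t ht hG e he
    obtain ⟨h1, h2⟩ := key1 t ht hG
    rcases List.mem_append.1 he with he | he
    · exact hall t _ _ _ (fun p => h2 (circ_left _ _ p)) e he
    · exact hall t _ _ _ (fun p => h1 (circ_right _ _ p)) e he
  · intro t ht hG e he
    obtain ⟨h1, h2⟩ := key2 t ht hG
    rcases List.mem_append.1 he with he | he
    · exact hall t _ _ _ (fun p => h1 (circ_right _ _ p)) e he
    · exact hall t _ _ _ (fun p => h2 (circ_left _ _ p)) e he
  · intro w hw1 hw2 _
    obtain ⟨h1, h2⟩ := key1 (Setoid.ker w) (fun p q h => hw1 p q h) hw2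
    have wd : ∀ p, w (d.perm p) = w p := fun p => (h1 (circ_left _ _ p)).symm
    have wc : ∀ p, w (c.perm p) = w p := fun p => (h1 (circ_right _ _ p)).symm
    have wb : ∀ p, w (b.perm p) = w p := fun p => (h2 (circ_left _ _ p)).symm
    have wa : ∀ p, w (a.perm p) = w p := fun p => (h2 (circ_right _ _ p)).symm
    let w' : Fin n → ℤ := fun p => if p ∈ S then w p else 0
    have hw' : ∀ (y : CM S), (∀ p, w (y.perm p) = w p) → ∀ p, w' (y.perm p) = w' p := by
      intro y hy p
      by_cases hp : p ∈ S
      · simp [w', hp, y.mem hp, hy]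
      · rw [y.bip.fix p hp]
    have hw0 : ∀ p, p ∉ S → w' p = 0 := fun p hp => by simp [w', hp]
    have hsum : ∀ z y u : CM S, ((E z.perm y.perm u.perm).map fun e => w e.1).sum =
        ((splitArcs z.perm y.perm u.perm).map w').sum := by
      intro z y u
      rw [List.map_map]
      congr 1
      apply List.map_congr_left
      intro p hp
      simp [w', splitArcs_subset y.bip p hp]
    rw [List.map_append, List.map_append, List.sum_append, List.sum_append, hsum, hsum, hsum, hsum]
    have c1 := wt_splits d.bip c.bip b.bip w' (hw' d wd) (hw' c wc) (hw' b wb) hw0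
    have c2 := wt_splits d.bip b.bip a.bip w' (hw' d wd) (hw' b wb) (hw' a wa) hw0
    have c3 := wt_splits c.bip b.bip a.bip w' (hw' c wc) (hw' b wb) (hw' a wa) hw0
    have c4 := wt_splits d.bip c.bip a.bip w' (hw' d wd) (hw' c wc) (hw' a wa) hw0
    linarith

theorem FF.mul_assoc (d c b a : CM S) (x : FF d c) (y : FF c b) (z : FF b a) :
    FF.mul d b a (FF.mul d c b x y) z = FF.mul d c a x (FF.mul c b a y z) := by
  obtain ⟨f, rfl⟩ := cls_surjective _ _ x
  obtain ⟨g, rfl⟩ := cls_surjective _ _ y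
  obtain ⟨h, rfl⟩ := cls_surjective _ _ z
  rw [FF.mul_mk, FF.mul_mk, FF.mul_mk, FF.mul_mk]
  have := contr_assoc d c b a
  rw [map_mul, map_mul] at this
  simp only [map_mul]
  linear_combination FF.mk d a f * FF.mk d a g * FF.mk d a h * this

end TQFT

/-! ### Gradings -/

section Gradings

/-- A criterion for a family of subgroups to be a grading. -/
theorem isInternal_of_proj {M : Type} [AddCommGroup M] (A : ℤ → AddSubgroup M)
    (π : ℤ → M →+ M) (h1 : ∀ d x, π d x ∈ A d) (h2 : ∀ d x, x ∈ A d → π d x = x)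
    (h3 : ∀ d e x, x ∈ A d → d ≠ e → π e x = 0)
    (h4 : ∀ x, ∃ s : Finset ℤ, ∑ d ∈ s, π d x = x) : DirectSum.IsInternal A := by
  classical
  have key : ∀ (v : DirectSum ℤ fun d => A d) (e : ℤ),
      π e (DirectSum.coeAddMonoidHom A v) = v e := by
    intro v e
    induction v using DirectSum.induction_on with
    | zero => simp
    | of d x =>
      rw [DirectSum.coeAddMonoidHom_of]
      by_cases h : d = e
      · subst h; rw [h2 _ _ x.2, DirectSum.of_eq_same]
      · rw [h3 _ _ _ x.2 h, DirectSum.of_eq_of_ne _ _ _ (Ne.symm h)]; rfl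
    | add v w hv hw => simp [hv, hw]
  constructor
  · intro v w hvw
    refine DFinsupp.ext fun e => Subtype.ext ?_
    rw [← key, ← key, hvw]
  · intro x
    obtain ⟨s, hs⟩ := h4 x
    refine ⟨∑ d ∈ s, DirectSum.of (fun d => A d) d ⟨π d x, h1 d x⟩, ?_⟩
    rw [map_sum]
    simpa using hs

theorem proj_of_isInternal {M : Type} [AddCommGroup M] {A : ℤ → AddSubgroup M}
    (h : DirectSum.IsInternal A) : ∃ π : ℤ → M →+ M, (∀ d x, π d x ∈ A d) ∧
      (∀ d x, x ∈ A d → π d x = x) ∧ (∀ d e x, x ∈ A d → d ≠ e → π e x = 0) ∧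
      (∀ x, ∃ s : Finset ℤ, ∀ t, s ⊆ t → ∑ d ∈ t, π d x = x) := by
  classical
  let _ := h.chooseDecomposition
  refine ⟨fun d => (AddSubgroup.subtype (A d)).comp
    ((DFinsupp.evalAddMonoidHom d).comp (DirectSum.decomposeAddEquiv A).toAddMonoidHom),
    fun d x => ?_, fun d x hx => ?_, fun d e x hx hde => ?_, fun x => ?_⟩
  · exact (DirectSum.decompose A x d).2
  · exact DirectSum.decompose_of_mem_same A hx
  · exact DirectSum.decompose_of_mem_ne A hx hde
  · refine ⟨(DirectSum.decompose A x).support, fun t ht => ?_⟩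
    conv_rhs => rw [← DirectSum.sum_support_decompose A x]
    symm
    refine Finset.sum_subset ht fun d _ hd => ?_
    simpa using hd

theorem isInternal_pi {ι : Type} [Finite ι] {M : ι → Type} [∀ i, AddCommGroup (M i)]
    (A : ∀ i, ℤ → AddSubgroup (M i)) (h : ∀ i, DirectSum.IsInternal (A i)) :
    DirectSum.IsInternal fun d => AddSubgroup.pi Set.univ fun i => A i d := by
  classical
  have := Fintype.ofFinite ι
  choose π h1 h2 h3 h4 using fun i => proj_of_isInternal (h i)
  refine isInternal_of_proj _ (fun d => AddMonoidHom.mk' (fun x i => π i d (x i)) fun x y => by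
    ext i; simp) (fun d x i _ => h1 i d (x i)) (fun d x hx => ?_) (fun d e x hx hde => ?_) ?_
  · ext i; exact h2 i d (x i) (hx i trivial)
  · ext i; exact h3 i d e (x i) (hx i trivial) hde
  · intro x
    choose s hs using fun i => h4 i (x i)
    refine ⟨Finset.univ.biUnion s, ?_⟩
    ext i
    rw [Finset.sum_apply]
    exact hs i _ (Finset.subset_biUnion_of_mem s (Finset.mem_univ i))

theorem isInternal_shift {M : Type} [AddCommGroup M] {A : ℤ → AddSubgroup M}
    (h : DirectSum.IsInternal A) (m : ℤ) : DirectSum.IsInternal fun d => A (d - m) := by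
  classical
  obtain ⟨π, h1, h2, h3, h4⟩ := proj_of_isInternal h
  refine isInternal_of_proj _ (fun d => π (d - m)) (fun d x => h1 _ x) (fun d x => h2 _ x)
    (fun d e x hx hde => h3 _ _ x hx (by omega)) fun x => ?_
  obtain ⟨s, hs⟩ := h4 x
  refine ⟨s.map (addRightEmbedding m), ?_⟩
  rw [Finset.sum_map]
  simpa using hs s subset_rfl

end Gradings

section TQGrading

variable {n : ℕ} {S : Finset (Fin n)}

theorem mem_tqDeg {b a : Perm (Fin n)} {d : ℤ} {x : TQ S b a} : x ∈ tqDeg S b a d ↔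
    ∃ f : MvPolynomial (Fin n) ℤ,
      (∀ s ∈ f.support, 2 * (s.degree : ℤ) - numCirc S b a = d) ∧ cls S b a f = x := by
  simp only [tqDeg, AddSubgroup.mem_map, Submodule.mem_toAddSubgroup,
    MvPolynomial.mem_restrictSupport_iff]
  rfl

theorem C_mul_X_pow {A : Type} [CommRing A] (x : A) (k : ℕ) :
    (Polynomial.C x * Polynomial.X) ^ k = Polynomial.C x ^ k * Polynomial.X ^ k :=
  mul_pow _ _ _

/-- Record the polynomial degree by a formal variable. -/
def degHom (S : Finset (Fin n)) (b a : Perm (Fin n)) : TQ S b a →+ Polynomial (TQ S b a) :=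
  QuotientAddGroup.lift (relIdeal S b a).toAddSubgroup
    (MvPolynomial.aeval fun p : Fin n => Polynomial.C (cls S b a (MvPolynomial.X p)) *
      (Polynomial.X : Polynomial (TQ S b a))).toRingHom.toAddMonoidHom (by
    intro f hf
    have := mul_kills (R := Polynomial (TQ S b a)) (S := S) b a (MvPolynomial.aeval fun p : Fin n =>
      Polynomial.C (cls S b a (MvPolynomial.X p)) *
        (Polynomial.X : Polynomial (TQ S b a))).toRingHom 1
      (fun p => by
        simp [C_mul_X_pow, ← Polynomial.C_pow, cls_X_sq])
      (fun p hp => by simp [cls_X_not_mem b a hp])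
      (fun p => by simp [cls_X_eq b a _ _ (circ_left b a p)])
      (fun p => by simp [cls_X_eq b a _ _ (circ_right b a p)]) f hf
    rw [one_mul] at this
    exact this)

theorem degHom_cls (b a : Perm (Fin n)) (f : MvPolynomial (Fin n) ℤ) :
    degHom S b a (cls S b a f) = MvPolynomial.aeval (fun p : Fin n =>
      Polynomial.C (cls S b a (MvPolynomial.X p)) * (Polynomial.X : Polynomial (TQ S b a))) f := rfl

theorem degHom_monomial (b a : Perm (Fin n)) (s : Fin n →₀ ℕ) (z : ℤ) :
    degHom S b a (cls S b a (MvPolynomial.monomial s z)) =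
      Polynomial.C (cls S b a (MvPolynomial.monomial s z)) * Polynomial.X ^ s.degree := by
  rw [degHom_cls, MvPolynomial.aeval_monomial, MvPolynomial.monomial_eq]
  have h : ∀ p : Fin n, (Polynomial.C (cls S b a (MvPolynomial.X p)) *
      (Polynomial.X : Polynomial (TQ S b a))) ^ s p =
      Polynomial.C (cls S b a (MvPolynomial.X p)) ^ s p * Polynomial.X ^ s p :=
    fun p => C_mul_X_pow _ _
  simp only [Finsupp.prod, h, map_mul, map_prod, map_pow]
  rw [Finset.prod_mul_distrib, Finset.prod_pow_eq_pow_sum, ← mul_assoc]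
  congr 2

theorem degHom_coeff (b a : Perm (Fin n)) (k : ℕ) (x : TQ S b a) :
    (degHom S b a x).coeff k ∈ tqDeg S b a (2 * k - numCirc S b a) := by
  obtain ⟨f, rfl⟩ := cls_surjective _ _ x
  induction f using MvPolynomial.induction_on' with
  | add f g hf hg => rw [map_add, map_add, Polynomial.coeff_add]; exact add_mem hf hg
  | monomial s z =>
    rw [degHom_monomial, Polynomial.coeff_C_mul_X_pow]
    split_ifs with h
    · refine mem_tqDeg.2 ⟨_, fun t ht => ?_, rfl⟩
      have := MvPolynomial.support_monomial_subset ht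
      rw [Finset.mem_singleton] at this
      rw [this, h]
    · exact zero_mem _

theorem degHom_of_mem {b a : Perm (Fin n)} {d : ℤ} {x : TQ S b a} (hx : x ∈ tqDeg S b a d)
    (k : ℕ) : (degHom S b a x).coeff k = if 2 * (k : ℤ) - numCirc S b a = d then x else 0 := by
  obtain ⟨f, hf, rfl⟩ := mem_tqDeg.1 hx
  conv_lhs => rw [f.as_sum]
  rw [map_sum, map_sum, Polynomial.finsetSum_coeff]
  simp only [degHom_monomial, Polynomial.coeff_C_mul_X_pow]
  split_ifs with h
  · conv_rhs => rw [f.as_sum, map_sum]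
    refine Finset.sum_congr rfl fun s hs => if_pos ?_
    have := hf s hs
    omega
  · refine Finset.sum_eq_zero fun s hs => if_neg ?_
    have := hf s hs
    omega

theorem degHom_sum (b a : Perm (Fin n)) (x : TQ S b a) :
    (degHom S b a x).sum (fun _ y => y) = x := by
  obtain ⟨f, rfl⟩ := cls_surjective _ _ x
  have : ∀ P : Polynomial (TQ S b a), P.sum (fun _ y => y) = P.eval 1 := by
    intro P; simp [Polynomial.eval_eq_sum]
  rw [this]
  induction f using MvPolynomial.induction_on' with
  | add f g hf hg => rw [map_add, map_add, Polynomial.eval_add, hf, hg]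
  | monomial s z => simp [degHom_monomial]

theorem tqDeg_isInternal (S : Finset (Fin n)) (b a : Perm (Fin n)) :
    DirectSum.IsInternal (tqDeg S b a) := by
  classical
  set c : ℤ := (numCirc S b a : ℤ) with hc
  refine isInternal_of_proj _ (fun d => if h : ∃ k : ℕ, 2 * (k : ℤ) - c = d then
    AddMonoidHom.mk' (fun x => (degHom S b a x).coeff h.choose) (fun x y => by simp) else 0)
    ?_ ?_ ?_ ?_
  · intro d x
    by_cases h : ∃ k : ℕ, 2 * (k : ℤ) - c = d
    · simp only [h, dif_pos]
      have := degHom_coeff b a h.choose x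
      rw [← hc, h.choose_spec] at this
      exact this
    · simp only [h, dif_neg, not_false_iff]
      exact zero_mem _
  · intro d x hx
    by_cases h : ∃ k : ℕ, 2 * (k : ℤ) - c = d
    · simp only [h, dif_pos]
      exact (degHom_of_mem hx _).trans (if_pos h.choose_spec)
    · simp only [h, dif_neg, not_false_iff]
      obtain ⟨f, hf, rfl⟩ := mem_tqDeg.1 hx
      have : f = 0 := by
        by_contra h0
        obtain ⟨s, hs⟩ := Finset.nonempty_of_ne_empty (mt MvPolynomial.support_eq_empty.1 h0)
        exact h ⟨_, hf s hs⟩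
      simp [this]
  · intro d e x hx hde
    by_cases h : ∃ k : ℕ, 2 * (k : ℤ) - c = e
    · simp only [h, dif_pos]
      exact (degHom_of_mem hx _).trans (if_neg fun h' => hde (h'.symm.trans h.choose_spec))
    · simp only [h, dif_neg, not_false_iff]
      rfl
  · intro x
    have hinj : Function.Injective fun k : ℕ => 2 * (k : ℤ) - c := fun k l h => by
      have h' : 2 * (k : ℤ) - c = 2 * (l : ℤ) - c := h
      omega
    refine ⟨(degHom S b a x).support.map ⟨fun k : ℕ => 2 * (k : ℤ) - c, hinj⟩, ?_⟩
    rw [Finset.sum_map]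
    conv_rhs => rw [← degHom_sum b a x, Polynomial.sum_def]
    refine Finset.sum_congr rfl fun k _ => ?_
    have h : ∃ l : ℕ, 2 * (l : ℤ) - c = 2 * (k : ℤ) - c := ⟨k, rfl⟩
    have h' : h.choose = k := by have := h.choose_spec; omega
    simp only [Function.Embedding.coeFn_mk, h, dif_pos]
    show (degHom S b a x).coeff h.choose = _
    rw [h']

instance (b a : Perm (Fin n)) : Module.Finite ℤ (TQ S b a) := by
  have h : Algebra.adjoin ℤ (Set.range fun p => cls S b a (MvPolynomial.X p)) = ⊤ := by
    have e : (Ideal.Quotient.mkₐ ℤ (relIdeal S b a)).range = ⊤ :=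
      AlgHom.range_eq_top _ |>.2 (Ideal.Quotient.mkₐ_surjective _ _)
    rw [← e, ← Algebra.map_top, ← MvPolynomial.adjoin_range_X, AlgHom.map_adjoin, ← Set.range_comp]
    rfl
  have hfg : (Subalgebra.toSubmodule (⊤ : Subalgebra ℤ (TQ S b a))).FG := by
    rw [← h]
    refine fg_adjoin_of_finite (Set.finite_range _) ?_
    rintro _ ⟨p, rfl⟩
    refine ⟨Polynomial.X ^ 2, Polynomial.monic_X_pow 2, ?_⟩
    simp [cls_X_sq]
  exact ⟨by simpa using hfg⟩

end TQGrading

section Counts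

variable {n : ℕ} {S : Finset (Fin n)}

/-- The weight of the points of `S`. -/
def one' (S : Finset (Fin n)) (p : Fin n) : ℤ := if p ∈ S then 1 else 0

theorem one'_invariant (a : CM S) (p : Fin n) : one' S (a.perm p) = one' S p := by
  by_cases hp : p ∈ S
  · simp [one', hp, a.mem hp]
  · rw [a.bip.fix p hp]

theorem numCirc_eq (b a : CM S) :
    (numCirc S b.perm a.perm : ℤ) = wt (circ b.perm a.perm) (one' S) := by
  classical
  rw [numCirc, Nat.card_eq_fintype_card, Fintype.card_subtype, wt]
  simp only [one']
  rw [Finset.sum_boole]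
  congr 2
  ext C
  simp only [Finset.mem_filter, Finset.mem_univ, true_and]
  constructor
  · rintro ⟨p, hp, rfl⟩
    have := circ_invariant (one'_invariant b) (one'_invariant a) _ _
      (out_rel (circ b.perm a.perm) p)
    simp only [one', hp, if_true] at this
    by_contra h
    rw [if_neg h] at this
    exact zero_ne_one this
  · intro h
    exact ⟨_, h, Quotient.out_eq C⟩

theorem arcs_sum (a : CM S) (w : Fin n → ℤ) :
    ((arcs a.perm).map w).sum = ∑ p ∈ Finset.univ.filter (fun p => p < a.perm p), w p := by
  rw [Finset.sum, ← Finset.sort_eq (Finset.univ.filter fun p => p < a.perm p) (· ≤ ·)]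
  rfl

theorem arcs_card (a : CM S) : ((arcs a.perm).map (one' S)).sum = (S.card / 2 : ℕ) := by
  have h1 : ∀ p, p < a.perm p → p ∈ S := fun p hp => (a.supp p).2 hp.ne'
  have h2 : S.card = 2 * (Finset.univ.filter fun p => p < a.perm p).card := by
    have e : S = (Finset.univ.filter fun p => p < a.perm p) ∪
        (Finset.univ.filter fun p => p < a.perm p).map a.perm.toEmbedding := by
      ext p
      simp only [Finset.mem_union, Finset.mem_filter, Finset.mem_univ, true_and, Finset.mem_map,
        Equiv.coe_toEmbedding]
      constructor
      · intro hp
        rcases lt_or_gt_of_ne ((a.supp p).1 hp) with h | h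
        · exact Or.inr ⟨a.perm p, by rwa [a.invol], a.invol p⟩
        · exact Or.inl h
      · rintro (h | ⟨q, h, rfl⟩)
        · exact h1 p h
        · exact a.mem (h1 q h)
    conv_lhs => rw [e]
    rw [Finset.card_union_of_disjoint, Finset.card_map, two_mul]
    rw [Finset.disjoint_left]
    intro p hp hp'
    obtain ⟨q, hq, rfl⟩ := Finset.mem_map.1 hp'
    simp only [Finset.mem_filter, Finset.mem_univ, true_and, Equiv.coe_toEmbedding, a.invol]
      at hp hq
    exact lt_asymm hp hq
  rw [arcs_sum, h2, Nat.mul_div_cancel_left _ two_pos, Finset.card_eq_sum_ones, Nat.cast_sum]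
  refine Finset.sum_congr rfl fun p hp => ?_
  simp [one', h1 p (Finset.mem_filter.1 hp).2]

theorem splits_count (c b a : CM S) :
    2 * ((splitArcs c.perm b.perm a.perm).length : ℤ) + numCirc S c.perm b.perm +
      numCirc S b.perm a.perm = numCirc S c.perm a.perm + (S.card / 2 : ℕ) := by
  have h := wt_splits c.bip b.bip a.bip (one' S) (one'_invariant c) (one'_invariant b)
    (one'_invariant a) (fun p hp => by simp [one', hp])
  rw [← numCirc_eq, ← numCirc_eq, ← numCirc_eq, arcs_card] at h
  have : ((splitArcs c.perm b.perm a.perm).map (one' S)).sum =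
      (splitArcs c.perm b.perm a.perm).length := by
    rw [List.map_congr_left (g := fun _ => (1 : ℤ)) fun p hp => by
      simp [one', splitArcs_subset b.bip p hp]]
    simp
  rw [this] at h
  linarith

theorem numCirc_self (a : CM S) : numCirc S a.perm a.perm = S.card / 2 := by
  classical
  have h : (numCirc S a.perm a.perm : ℤ) = (S.card / 2 : ℕ) := by
    rw [numCirc_eq, ← arcs_card a, arcs_sum, wt]
    symm
    have hcl : ∀ x y, circ a.perm a.perm x y → y = x ∨ y = a.perm x := by
      intro x y hxy
      induction hxy with
      | rel x y h => rcases h with h | h <;> exact Or.inr h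
      | refl x => exact Or.inl rfl
      | symm x y _ ih =>
        rcases ih with rfl | rfl
        · exact Or.inl rfl
        · exact Or.inr (a.invol x).symm
      | trans x y z _ _ h1 h2 =>
        rcases h1 with rfl | rfl <;> rcases h2 with rfl | rfl
        · exact Or.inl rfl
        · exact Or.inr rfl
        · exact Or.inr rfl
        · exact Or.inl (a.invol x)
    have hval : ∀ p, one' S (Quotient.mk (circ a.perm a.perm) p).out = one' S p := fun p =>
      circ_invariant (one'_invariant a) (one'_invariant a) _ _ (out_rel _ p)
    refine Finset.sum_of_injOn (fun p => Quotient.mk (circ a.perm a.perm) p) ?_ ?_ ?_ ?_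
    · intro p hp q hq hpq
      simp only [Finset.coe_filter, Finset.mem_univ, true_and, Set.mem_ofPred_eq] at hp hq
      rcases hcl p q (Quotient.exact hpq) with h | h
      · exact h.symm
      · rw [h, a.invol] at hq
        exact absurd hp hq.asymm
    · intro _ _; simp
    · intro C _ hC
      by_contra h0
      have hS : C.out ∈ S := by by_contra h'; exact h0 (by simp [one', h'])
      apply hC
      rcases lt_or_gt_of_ne ((a.supp _).1 hS) with h | h
      · refine ⟨a.perm C.out, by simpa [a.invol] using h, ?_⟩
        have : Quotient.mk (circ a.perm a.perm) (a.perm C.out) = Quotient.mk _ C.out :=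
          Quotient.sound ((circ a.perm a.perm).symm (circ_left _ _ _))
        exact this.trans (Quotient.out_eq C)
      · exact ⟨C.out, by simpa using h, Quotient.out_eq C⟩
    · intro p _; exact (hval p).symm
  exact_mod_cast h

theorem contr_left_unit (b a : CM S) : contr b.perm b.perm a.perm = 1 := by
  have h := splits_count b b a
  rw [numCirc_self] at h
  have : (splitArcs b.perm b.perm a.perm).length = 0 := by omega
  rw [contr, List.length_eq_zero_iff.1 this]
  rfl

theorem contr_right_unit (b a : CM S) : contr b.perm a.perm a.perm = 1 := by
  have h := splits_count b a a
  rw [numCirc_self] at h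
  have : (splitArcs b.perm a.perm a.perm).length = 0 := by omega
  rw [contr, List.length_eq_zero_iff.1 this]
  rfl

theorem FF.one_mul (b a : CM S) (x : FF b a) : FF.mul b b a 1 x = x := by
  obtain ⟨f, rfl⟩ := cls_surjective _ _ x
  have := FF.mul_mk b b a 1 f
  rw [contr_left_unit, _root_.one_mul, _root_.mul_one, map_one] at this
  exact this

theorem FF.mul_one (b a : CM S) (x : FF b a) : FF.mul b a a x 1 = x := by
  obtain ⟨f, rfl⟩ := cls_surjective _ _ x
  have := FF.mul_mk b a a f 1
  rw [contr_right_unit, _root_.mul_one, _root_.mul_one, map_one] at this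
  exact this

theorem support_contr (c b a : Perm (Fin n)) :
    ∀ s ∈ (contr c b a).support, s.degree = (splitArcs c b a).length := by
  have key : ∀ L : List (Fin n), MvPolynomial.IsHomogeneous
      ((L.map fun p => (MvPolynomial.X p + MvPolynomial.X (b p) : MvPolynomial (Fin n) ℤ)).prod)
      L.length := by
    intro L
    induction L with
    | nil => exact MvPolynomial.isHomogeneous_one (Fin n) ℤ
    | cons p L ih =>
      rw [List.map_cons, List.prod_cons, List.length_cons, Nat.add_comm L.length 1]
      exact ((MvPolynomial.isHomogeneous_X ℤ p).add (MvPolynomial.isHomogeneous_X ℤ (b p))).mul ih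
  intro s hs
  have := key (splitArcs c b a) (MvPolynomial.mem_support_iff.1 hs)
  rwa [Finsupp.degree_eq_weight_one]

/-- The contraction map has degree `m`, half of the number of points of `S`. -/
theorem FF.mul_mem {c b a : CM S} {d e : ℤ} {x : FF c b} {y : FF b a}
    (hx : x ∈ tqDeg S c.perm b.perm d) (hy : y ∈ tqDeg S b.perm a.perm e) :
    FF.mul c b a x y ∈ tqDeg S c.perm a.perm (d + e + (S.card / 2 : ℕ)) := by
  classical
  obtain ⟨f, hf, rfl⟩ := mem_tqDeg.1 hx
  obtain ⟨g, hg, rfl⟩ := mem_tqDeg.1 hy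
  refine mem_tqDeg.2 ⟨_, fun s hs => ?_, (FF.mul_mk c b a f g).symm⟩
  obtain ⟨s', hs', u, hu, rfl⟩ := Finset.mem_add.1 (MvPolynomial.support_mul _ _ hs)
  clear hs
  obtain ⟨s, hs, t, ht, rfl⟩ := Finset.mem_add.1 (MvPolynomial.support_mul _ _ hs')
  have h1 := hf s hs
  have h2 := hg t ht
  have h3 := support_contr _ _ _ u hu
  have h4 := splits_count c b a
  rw [map_add, map_add]
  push_cast at h4 ⊢
  rw [h3]
  linarith

theorem FF.one_mem (a : CM S) : (1 : FF a a) ∈ tqDeg S a.perm a.perm (-(S.card / 2 : ℕ)) := by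
  refine mem_tqDeg.2 ⟨1, fun s hs => ?_, map_one _⟩
  have : s = 0 := by
    have h := MvPolynomial.support_monomial_subset (s := (0 : Fin n →₀ ℕ)) (a := (1 : ℤ)) hs
    simpa using h
  rw [this, numCirc_self]
  simp

end Counts

/-! ### Graded modules, graded bimodules and tensor products -/

/-- A finitely generated graded left module over a graded ring. -/
structure GrMod (R : Type) [Ring R] (𝓡 : ℤ → AddSubgroup R) : Type 1 where
  carrier : Type
  [grp : AddCommGroup carrier]
  [mod : Module R carrier]
  gr : ℤ → AddSubgroup carrier
  isInternal : DirectSum.IsInternal gr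
  smul_mem : ∀ (i j : ℤ) (r : R) (x : carrier), r ∈ 𝓡 i → x ∈ gr j → r • x ∈ gr (i + j)
  finite : Module.Finite R carrier

attribute [instance] GrMod.grp GrMod.mod

section Modules

variable {R : Type} [Ring R] {𝓡 : ℤ → AddSubgroup R}

/-- Grading-preserving module homomorphisms. -/
@[ext]
structure GrMod.Hom (M N : GrMod R 𝓡) : Type where
  lin : M.carrier →ₗ[R] N.carrier
  map_mem : ∀ (d : ℤ) (x : M.carrier), x ∈ M.gr d → lin x ∈ N.gr d

instance : Category (GrMod R 𝓡) where
  Hom := GrMod.Hom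
  id M := ⟨LinearMap.id, fun _ _ h => h⟩
  comp f g := ⟨g.lin ∘ₗ f.lin, fun d x h => g.map_mem d _ (f.map_mem d x h)⟩

theorem GrMod.hom_ext {M N : GrMod R 𝓡} {f g : M ⟶ N} (h : ∀ x, f.lin x = g.lin x) : f = g :=
  GrMod.Hom.ext (LinearMap.ext h)

/-- The grading shift `M{i}`, which shifts the grading of `M` up by `i`. -/
def GrMod.shift (M : GrMod R 𝓡) (i : ℤ) : GrMod R 𝓡 where
  carrier := M.carrier
  gr d := M.gr (d - i)
  isInternal := isInternal_shift M.isInternal i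
  smul_mem j k r x hr hx := by
    have := M.smul_mem _ _ r x hr hx
    rwa [← add_sub_assoc] at this
  finite := M.finite

/-- The direct sum of two graded modules. -/
def GrMod.sum (M N : GrMod R 𝓡) : GrMod R 𝓡 where
  carrier := M.carrier × N.carrier
  gr d := (M.gr d).prod (N.gr d)
  isInternal := by
    classical
    obtain ⟨π, h1, h2, h3, h4⟩ := proj_of_isInternal M.isInternal
    obtain ⟨π', h1', h2', h3', h4'⟩ := proj_of_isInternal N.isInternal
    refine isInternal_of_proj _ (fun d => (π d).prodMap (π' d)) (fun d x => ⟨h1 _ _, h1' _ _⟩)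
      (fun d x hx => Prod.ext (h2 _ _ hx.1) (h2' _ _ hx.2))
      (fun d e x hx hde => Prod.ext (h3 _ _ _ hx.1 hde) (h3' _ _ _ hx.2 hde)) fun x => ?_
    obtain ⟨s, hs⟩ := h4 x.1
    obtain ⟨s', hs'⟩ := h4' x.2
    refine ⟨s ∪ s', Prod.ext ?_ ?_⟩
    · rw [Prod.fst_sum]; exact hs _ Finset.subset_union_left
    · rw [Prod.snd_sum]; exact hs' _ Finset.subset_union_right
  smul_mem i j r x hr hx := ⟨M.smul_mem _ _ _ _ hr hx.1, N.smul_mem _ _ _ _ hr hx.2⟩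
  finite := by
    have := M.finite
    have := N.finite
    infer_instance

/-- The zero module. -/
def GrMod.zero : GrMod R 𝓡 where
  carrier := PUnit
  gr _ := ⊤
  isInternal := isInternal_of_proj _ (fun _ => 0) (fun _ _ => trivial) (fun _ _ _ => rfl)
    (fun _ _ _ _ _ => rfl) (fun _ => ⟨∅, rfl⟩)
  smul_mem _ _ _ _ _ _ := trivial
  finite := inferInstance

end Modules

/-- A graded bimodule: a left module over `R` and a right module over `T`; it is finitely generated
as a left module. -/
structure GrBimod (R : Type) [Ring R] (𝓡 : ℤ → AddSubgroup R) (T : Type) [Ring T]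
    (𝓣 : ℤ → AddSubgroup T) : Type 1 where
  carrier : Type
  [grp : AddCommGroup carrier]
  [left : Module R carrier]
  [right : Module Tᵐᵒᵖ carrier]
  [comm : SMulCommClass R Tᵐᵒᵖ carrier]
  gr : ℤ → AddSubgroup carrier
  isInternal : DirectSum.IsInternal gr
  smul_mem : ∀ (i j : ℤ) (r : R) (x : carrier), r ∈ 𝓡 i → x ∈ gr j → r • x ∈ gr (i + j)
  mul_mem : ∀ (i j : ℤ) (t : T) (x : carrier), x ∈ gr i → t ∈ 𝓣 j →
    MulOpposite.op t • x ∈ gr (i + j)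
  finite : Module.Finite R carrier

attribute [instance] GrBimod.grp GrBimod.left GrBimod.right GrBimod.comm

theorem isInternal_induction {M : Type} [AddCommGroup M] {A : ℤ → AddSubgroup M}
    (h : DirectSum.IsInternal A) {P : M → Prop} (h0 : P 0) (ha : ∀ x y, P x → P y → P (x + y))
    (hm : ∀ d x, x ∈ A d → P x) (x : M) : P x := by
  classical
  obtain ⟨v, rfl⟩ := h.2 x
  induction v using DirectSum.induction_on with
  | zero => simpa using h0
  | of d x => rw [DirectSum.coeAddMonoidHom_of]; exact hm d x x.2
  | add v w hv hw => rw [map_add]; exact ha _ _ hv hw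

section Tensor

variable {R : Type} [Ring R] {𝓡 : ℤ → AddSubgroup R} {T : Type} [Ring T] {𝓣 : ℤ → AddSubgroup T}

/-- The relations `b t ⊗ x = b ⊗ t x`. -/
def tensorRel (B : GrBimod R 𝓡 T 𝓣) (M : GrMod T 𝓣) :
    Submodule R (B.carrier ⊗[ℤ] M.carrier) :=
  Submodule.span R {z | ∃ (b : B.carrier) (t : T) (x : M.carrier),
    z = (MulOpposite.op t • b) ⊗ₜ[ℤ] x - b ⊗ₜ[ℤ] (t • x)}

/-- The tensor product `B ⊗_T M` of a bimodule with a left module. -/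
abbrev Tens (B : GrBimod R 𝓡 T 𝓣) (M : GrMod T 𝓣) : Type :=
  (B.carrier ⊗[ℤ] M.carrier) ⧸ tensorRel B M

/-- The class of `b ⊗ x`. -/
def Tens.mk (B : GrBimod R 𝓡 T 𝓣) (M : GrMod T 𝓣) (b : B.carrier) (x : M.carrier) : Tens B M :=
  Submodule.Quotient.mk (b ⊗ₜ[ℤ] x)

/-- The degree `d` part of the tensor product. -/
def Tens.gr (B : GrBimod R 𝓡 T 𝓣) (M : GrMod T 𝓣) (d : ℤ) : AddSubgroup (Tens B M) :=
  AddSubgroup.closure {z | ∃ (i j : ℤ) (b : B.carrier) (x : M.carrier),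
    b ∈ B.gr i ∧ x ∈ M.gr j ∧ i + j = d ∧ z = Tens.mk B M b x}

variable (B : GrBimod R 𝓡 T 𝓣) (M : GrMod T 𝓣)

theorem Tens.mk_add (b : B.carrier) (x y : M.carrier) :
    Tens.mk B M b (x + y) = Tens.mk B M b x + Tens.mk B M b y := by
  simp [Tens.mk, TensorProduct.tmul_add]

theorem Tens.add_mk (b c : B.carrier) (x : M.carrier) :
    Tens.mk B M (b + c) x = Tens.mk B M b x + Tens.mk B M c x := by
  simp [Tens.mk, TensorProduct.add_tmul]

theorem Tens.mk_zero (b : B.carrier) : Tens.mk B M b 0 = 0 := by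
  simp [Tens.mk]

theorem Tens.zero_mk (x : M.carrier) : Tens.mk B M 0 x = 0 := by
  simp [Tens.mk]

theorem Tens.balanced (b : B.carrier) (t : T) (x : M.carrier) :
    Tens.mk B M (MulOpposite.op t • b) x = Tens.mk B M b (t • x) :=
  (Submodule.Quotient.eq _).2 (Submodule.subset_span ⟨b, t, x, rfl⟩)

theorem Tens.smul_mk (r : R) (b : B.carrier) (x : M.carrier) :
    r • Tens.mk B M b x = Tens.mk B M (r • b) x := rfl

theorem Tens.induction {P : Tens B M → Prop} (h0 : P 0) (ha : ∀ x y, P x → P y → P (x + y))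
    (hm : ∀ b x, P (Tens.mk B M b x)) (z : Tens B M) : P z := by
  obtain ⟨z, rfl⟩ := Submodule.Quotient.mk_surjective _ z
  induction z using TensorProduct.induction_on with
  | zero => exact h0
  | tmul b x => exact hm b x
  | add x y hx hy => exact ha _ _ hx hy

/-- Additive maps out of the tensor product. -/
theorem tens_lift {P : Type} [AddCommGroup P] (f : B.carrier →+ M.carrier →+ P)
    (hf : ∀ (b : B.carrier) (t : T) (x : M.carrier), f (MulOpposite.op t • b) x = f b (t • x)) :
    ∃ g : Tens B M →+ P, ∀ b x, g (Tens.mk B M b x) = f b x := by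
  let g₀ : B.carrier ⊗[ℤ] M.carrier →+ P := TensorProduct.liftAddHom f (fun r b x => by simp)
  have hker : ∀ z ∈ tensorRel B M, g₀ z = 0 := by
    intro z hz
    have : ∀ r : R, g₀ (r • z) = 0 := by
      induction hz using Submodule.span_induction with
      | mem z hz =>
        obtain ⟨b, t, x, rfl⟩ := hz
        intro r
        rw [smul_sub, TensorProduct.smul_tmul', TensorProduct.smul_tmul', map_sub, smul_comm]
        show f _ _ - f _ _ = 0
        rw [hf, sub_self]
      | zero => simp
      | add x y _ _ hx hy => intro r; rw [smul_add, map_add, hx, hy, add_zero]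
      | smul s x _ hx => intro r; rw [smul_smul]; exact hx _
    simpa using this 1
  exact ⟨QuotientAddGroup.lift (tensorRel B M).toAddSubgroup g₀ hker, fun b x => rfl⟩

theorem Tens.gr_isInternal (hT : DirectSum.IsInternal 𝓣) :
    DirectSum.IsInternal (Tens.gr B M) := by
  classical
  obtain ⟨π, h1, h2, h3, h4⟩ := proj_of_isInternal M.isInternal
  let _ := B.isInternal.chooseDecomposition
  have hπ : ∀ (d k : ℤ) (t : T) (x : M.carrier), t ∈ 𝓣 k → π d (t • x) = t • π (d - k) x := by
    intro d k t x ht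
    induction x using isInternal_induction M.isInternal with
    | h0 => simp
    | ha x y hx hy => simp [hx, hy]
    | hm j x hx =>
      have := M.smul_mem k j t x ht hx
      by_cases h : k + j = d
      · subst h
        rw [h2 _ _ this, add_sub_cancel_left, h2 _ _ hx]
      · rw [h3 _ _ _ this h, h3 j (d - k) x hx (by omega), smul_zero]
  let F : ℤ → B.carrier →+ M.carrier →+ Tens B M := fun d =>
    (DirectSum.toAddMonoid fun i => AddMonoidHom.mk' (fun b : B.gr i =>
      AddMonoidHom.mk' (fun x => Tens.mk B M b (π (d - i) x))
        (fun x y => by rw [map_add, Tens.mk_add]))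
      (fun b c => by ext x; exact Tens.add_mk B M _ _ _)).comp
    (DirectSum.decomposeAddEquiv B.gr).toAddMonoidHom
  have hF : ∀ d i b x, b ∈ B.gr i → F d b x = Tens.mk B M b (π (d - i) x) := by
    intro d i b x hb
    simp only [F, AddMonoidHom.comp_apply]
    have : (DirectSum.decomposeAddEquiv B.gr).toAddMonoidHom b =
        DirectSum.of (fun i => B.gr i) i ⟨b, hb⟩ := DirectSum.decompose_of_mem _ hb
    rw [this, DirectSum.toAddMonoid_of]
    rfl
  have hbal : ∀ (d : ℤ) (b : B.carrier) (t : T) (x : M.carrier),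
      F d (MulOpposite.op t • b) x = F d b (t • x) := by
    intro d b t x
    induction b using isInternal_induction B.isInternal with
    | h0 => simp
    | ha b c hb hc => simp [hb, hc]
    | hm i b hb =>
      induction t using isInternal_induction hT with
      | h0 => simp
      | ha t s ht hs => simp [add_smul, ht, hs]
      | hm k t ht =>
        rw [hF d (i + k) _ _ (B.mul_mem _ _ _ _ hb ht), hF d i _ _ hb, hπ _ k _ _ ht,
          Tens.balanced, sub_sub]
  choose G hG using fun d => tens_lift B M (F d) (hbal d)
  refine isInternal_of_proj _ G ?_ ?_ ?_ ?_
  · intro d z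
    induction z using Tens.induction B M with
    | h0 => simp
    | ha x y hx hy => rw [map_add]; exact add_mem hx hy
    | hm b x =>
      rw [hG]
      induction b using isInternal_induction B.isInternal with
      | h0 => simp
      | ha b c hb hc => rw [map_add]; exact add_mem hb hc
      | hm i b hb =>
        rw [hF d i _ _ hb]
        exact AddSubgroup.subset_closure ⟨i, d - i, b, _, hb, h1 _ _, by ring, rfl⟩
  · intro d z hz
    induction hz using AddSubgroup.closure_induction with
    | mem z hz =>
      obtain ⟨i, j, b, x, hb, hx, rfl, rfl⟩ := hz
      rw [hG, hF _ i _ _ hb, add_sub_cancel_left, h2 _ _ hx]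
    | zero => simp
    | add x y _ _ hx hy => rw [map_add, hx, hy]
    | neg x _ hx => rw [map_neg, hx]
  · intro d e z hz hde
    induction hz using AddSubgroup.closure_induction with
    | mem z hz =>
      obtain ⟨i, j, b, x, hb, hx, rfl, rfl⟩ := hz
      rw [hG, hF _ i _ _ hb, h3 j _ x hx (by omega), Tens.mk_zero]
    | zero => simp
    | add x y _ _ hx hy => rw [map_add, hx, hy, add_zero]
    | neg x _ hx => rw [map_neg, hx, neg_zero]
  · intro z
    suffices h : ∃ s : Finset ℤ, ∀ t, s ⊆ t → ∑ d ∈ t, G d z = z by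
      obtain ⟨s, hs⟩ := h
      exact ⟨s, hs s subset_rfl⟩
    have hadd : ∀ x y : Tens B M, (∃ s : Finset ℤ, ∀ t, s ⊆ t → ∑ d ∈ t, G d x = x) →
        (∃ s : Finset ℤ, ∀ t, s ⊆ t → ∑ d ∈ t, G d y = y) →
        ∃ s : Finset ℤ, ∀ t, s ⊆ t → ∑ d ∈ t, G d (x + y) = x + y := by
      rintro x y ⟨s, hs⟩ ⟨s', hs'⟩
      refine ⟨s ∪ s', fun t ht => ?_⟩
      simp only [map_add, Finset.sum_add_distrib]
      rw [hs t (Finset.union_subset_left ht), hs' t (Finset.union_subset_right ht)]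
    induction z using Tens.induction B M with
    | h0 => exact ⟨∅, fun t _ => by simp⟩
    | ha x y hx hy => exact hadd x y hx hy
    | hm b x =>
      induction b using isInternal_induction B.isInternal with
      | h0 => rw [Tens.zero_mk]; exact ⟨∅, fun t _ => by simp⟩
      | ha b c hb hc => rw [Tens.add_mk]; exact hadd _ _ hb hc
      | hm i b hb =>
        obtain ⟨s, hs⟩ := h4 x
        refine ⟨s.map (addRightEmbedding i), fun t ht => ?_⟩
        let φ : M.carrier →+ Tens B M :=
          AddMonoidHom.mk' (fun x => Tens.mk B M b x) (Tens.mk_add B M b)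
        have e : ∑ d ∈ t, G d (Tens.mk B M b x) = φ (∑ d ∈ t, π (d - i) x) := by
          rw [map_sum]
          refine Finset.sum_congr rfl fun d _ => ?_
          rw [hG, hF d i _ _ hb]
          rfl
        have e' : ∑ d ∈ t, π (d - i) x = ∑ d ∈ t.map (addRightEmbedding (-i)), π d x := by
          rw [Finset.sum_map]
          rfl
        rw [e, e', hs _ ?_]
        · rfl
        · intro d hd
          refine Finset.mem_map.2 ⟨d + i, ht (Finset.mem_map.2 ⟨d, hd, rfl⟩), ?_⟩
          simp

theorem Tens.finite : Module.Finite R (Tens B M) := by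
  classical
  have := B.finite
  obtain ⟨s, hs⟩ := M.finite
  let φ : (s → B.carrier) →ₗ[R] Tens B M :=
    { toFun := fun v => ∑ x : s, Tens.mk B M (v x) x
      map_add' := fun v w => by simp [Tens.add_mk, Finset.sum_add_distrib]
      map_smul' := fun r v => by simp [Finset.smul_sum, Tens.smul_mk] }
  refine Module.Finite.of_surjective φ ?_
  rw [← LinearMap.range_eq_top, eq_top_iff]
  rintro z -
  induction z using Tens.induction B M with
  | h0 => exact zero_mem _
  | ha x y hx hy => exact add_mem hx hy
  | hm b x =>
    have hx : x ∈ Submodule.span T (s : Set M.carrier) := by rw [hs]; trivial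
    induction hx using Submodule.span_induction generalizing b with
    | mem x hx =>
      refine ⟨Pi.single ⟨x, hx⟩ b, ?_⟩
      show ∑ y : s, Tens.mk B M ((Pi.single ⟨x, hx⟩ b : s → B.carrier) y) y = _
      rw [Finset.sum_eq_single ⟨x, hx⟩]
      · simp
      · intro y _ hy
        rw [Pi.single_eq_of_ne hy, Tens.zero_mk]
      · simp
    | zero => rw [Tens.mk_zero]; exact zero_mem _
    | add x y _ _ hx hy => rw [Tens.mk_add]; exact add_mem (hx b) (hy b)
    | smul t x _ hx => rw [← Tens.balanced]; exact hx _

/-- The graded `R`-module `B ⊗_T M`. -/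
def GrBimod.tensorObj (hT : DirectSum.IsInternal 𝓣) : GrMod R 𝓡 where
  carrier := Tens B M
  gr := Tens.gr B M
  isInternal := Tens.gr_isInternal B M hT
  smul_mem i j r z hr hz := by
    induction hz using AddSubgroup.closure_induction with
    | mem z hz =>
      obtain ⟨k, l, b, x, hb, hx, rfl, rfl⟩ := hz
      rw [Tens.smul_mk]
      exact AddSubgroup.subset_closure
        ⟨i + k, l, r • b, x, B.smul_mem _ _ _ _ hr hb, hx, by ring, rfl⟩
    | zero => rw [smul_zero]; exact zero_mem _
    | add x y _ _ hx hy => rw [smul_add]; exact add_mem hx hy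
    | neg x _ hx => rw [smul_neg]; exact neg_mem hx
  finite := Tens.finite B M

/-- The map `id ⊗ f`. -/
def Tens.map {M N : GrMod T 𝓣} (f : M ⟶ N) : Tens B M →ₗ[R] Tens B N :=
  Submodule.mapQ _ _ (TensorProduct.AlgebraTensorModule.map
    (LinearMap.id : B.carrier →ₗ[R] B.carrier) f.lin.toAddMonoidHom.toIntLinearMap) (by
      refine Submodule.span_le.2 ?_
      rintro _ ⟨b, t, x, rfl⟩
      refine Submodule.subset_span ⟨b, t, f.lin x, ?_⟩
      simp)

theorem Tens.map_mk {M N : GrMod T 𝓣} (f : M ⟶ N) (b : B.carrier) (x : M.carrier) :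
    Tens.map B f (Tens.mk B M b x) = Tens.mk B N b (f.lin x) := rfl

theorem Tens.map_gr {M N : GrMod T 𝓣} (f : M ⟶ N) (d : ℤ) (z : Tens B M)
    (hz : z ∈ Tens.gr B M d) : Tens.map B f z ∈ Tens.gr B N d := by
  induction hz using AddSubgroup.closure_induction with
  | mem z hz =>
    obtain ⟨i, j, b, x, hb, hx, rfl, rfl⟩ := hz
    exact AddSubgroup.subset_closure ⟨i, j, b, f.lin x, hb, f.map_mem _ _ hx, rfl, rfl⟩
  | zero => rw [(Tens.map B f).map_zero]; exact zero_mem _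
  | add x y _ _ hx hy => rw [(Tens.map B f).map_add]; exact add_mem hx hy
  | neg x _ hx => rw [(Tens.map B f).map_neg]; exact neg_mem hx

theorem Tens.map_id (M : GrMod T 𝓣) (z : Tens B M) : Tens.map B (𝟙 M) z = z := by
  induction z using Tens.induction B M with
  | h0 => rw [(Tens.map B (𝟙 M)).map_zero]
  | ha x y hx hy => rw [(Tens.map B (𝟙 M)).map_add, hx, hy]
  | hm b x => rfl

theorem Tens.map_comp {M N P : GrMod T 𝓣} (f : M ⟶ N) (g : N ⟶ P) (z : Tens B M) :
    Tens.map B (f ≫ g) z = Tens.map B g (Tens.map B f z) := by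
  induction z using Tens.induction B M with
  | h0 => rw [(Tens.map B _).map_zero, (Tens.map B f).map_zero, (Tens.map B g).map_zero]
  | ha x y hx hy =>
    rw [(Tens.map B _).map_add, (Tens.map B f).map_add, (Tens.map B g).map_add, hx, hy]
  | hm b x => rfl

/-- The functor `B ⊗_T -`. -/
def GrBimod.tensor (hT : DirectSum.IsInternal 𝓣) : GrMod T 𝓣 ⥤ GrMod R 𝓡 where
  obj M := B.tensorObj M hT
  map f := ⟨Tens.map B f, Tens.map_gr B f⟩
  map_id M := GrMod.hom_ext fun z => Tens.map_id B M z
  map_comp f g := GrMod.hom_ext fun z => Tens.map_comp B f g z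

end Tensor

/-! ### Flat tangles -/

/-- A flat tangle with bottom end points `S` and top end points `T` and without caps: it consists of
through strands, joining the bottom point `p ∈ S` to the top point `shift p`, and of cups, joining
the top points `p` and `cup p ≠ p`. -/
structure Flat {n : ℕ} (S T : Finset (Fin n)) where
  shift : Perm (Fin n)
  cup : Perm (Fin n)
  invol : ∀ p, cup (cup p) = p
  mono : ∀ p ∈ S, ∀ q ∈ S, p < q → shift p < shift q
  disj : ∀ p ∈ S, cup (shift p) = shift p
  mem_iff : ∀ p, p ∈ T ↔ shift.symm p ∈ S ∨ cup p ≠ p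
  planar : ∀ p q, p < q → q < cup p → cup q ≠ q ∧ p < cup q ∧ cup q < cup p

section Flat

variable {n : ℕ} {S T : Finset (Fin n)}

/-- Bijection of the end points of the tangle composed with a matching `a` of its bottom points. -/
def Flat.glued (f : Flat S T) (a : Perm (Fin n)) : Perm (Fin n) :=
  f.shift * a * f.shift.symm * f.cup

theorem Flat.glued_shift (f : Flat S T) (a : Perm (Fin n)) {p : Fin n} (hp : p ∈ S) :
    f.glued a (f.shift p) = f.shift (a p) := by
  simp [Flat.glued, f.disj p hp]

theorem Flat.symm_not_mem (f : Flat S T) {p : Fin n} (hp : f.cup p ≠ p) : f.shift.symm p ∉ S := by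
  intro h
  have := f.disj _ h
  rw [apply_symm_apply] at this
  exact hp this

theorem Flat.glued_cup (f : Flat S T) (a : CM S) {p : Fin n} (hp : f.cup p ≠ p) :
    f.glued a.perm p = f.cup p := by
  have : f.shift.symm (f.cup p) ∉ S := f.symm_not_mem (by rw [f.invol]; exact hp.symm)
  simp [Flat.glued, a.bip.fix _ this]

theorem Flat.glued_fix (f : Flat S T) (a : CM S) {p : Fin n} (hp : p ∉ T) :
    f.glued a.perm p = p := by
  rw [f.mem_iff, not_or, not_ne_iff] at hp
  simp [Flat.glued, hp.2, a.bip.fix _ hp.1]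

theorem Flat.cases (f : Flat S T) (p : Fin n) :
    (∃ q ∈ S, p = f.shift q) ∨ f.cup p ≠ p ∨ p ∉ T := by
  by_cases h : p ∈ T
  · rcases (f.mem_iff p).1 h with h | h
    · exact Or.inl ⟨_, h, by simp⟩
    · exact Or.inr (Or.inl h)
  · exact Or.inr (Or.inr h)

theorem Flat.shift_mem (f : Flat S T) {p : Fin n} (hp : p ∈ S) : f.shift p ∈ T :=
  (f.mem_iff _).2 (Or.inl (by simpa using hp))

/-- The matching `f a` of the top points. -/
def Flat.onMatch (f : Flat S T) (a : CM S) : CM T where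
  perm := f.glued a.perm
  invol p := by
    rcases f.cases p with ⟨q, hq, rfl⟩ | h | h
    · rw [f.glued_shift _ hq, f.glued_shift _ (a.mem hq), a.invol]
    · rw [f.glued_cup a h, f.glued_cup a (by rw [f.invol]; exact h.symm), f.invol]
    · rw [f.glued_fix a h, f.glued_fix a h]
  supp p := by
    rcases f.cases p with ⟨q, hq, rfl⟩ | h | h
    · rw [f.glued_shift _ hq]
      simpa [f.shift_mem hq] using (a.supp q).1 hq
    · rw [f.glued_cup a h]
      simp [f.mem_iff, h]
    · rw [f.glued_fix a h]
      simp [h]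
  noncrossing p q h1 h2 h3 := by
    have cmp : ∀ x ∈ S, ∀ y ∈ S, f.shift x < f.shift y → x < y := by
      intro x hx y hy hxy
      by_contra h
      rcases lt_or_eq_of_le (not_lt.1 h) with h | h
      · exact lt_asymm hxy (f.mono _ hy _ hx h)
      · rw [h] at hxy; exact lt_irrefl _ hxy
    rcases f.cases p with ⟨p, hp, rfl⟩ | h | h
    · rw [f.glued_shift _ hp] at h2 h3
      rcases f.cases q with ⟨q, hq, rfl⟩ | h | h
      · rw [f.glued_shift _ hq] at h3
        exact a.noncrossing p q (cmp _ hp _ hq h1) (cmp _ hq _ (a.mem hp) h2)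
          (cmp _ (a.mem hp) _ (a.mem hq) h3)
      · rw [f.glued_cup a h] at h3
        exact (f.planar q _ h2 h3).1 (f.disj _ (a.mem hp))
      · rw [f.glued_fix a h] at h3
        exact lt_asymm h2 h3
    · rw [f.glued_cup a h] at h2 h3
      obtain ⟨h4, h5, h6⟩ := f.planar p q h1 h2
      rw [f.glued_cup a h4] at h3
      exact lt_asymm h3 h6
    · rw [f.glued_fix a h] at h2
      exact lt_asymm h1 h2

theorem Flat.onMatch_perm (f : Flat S T) (a : CM S) : (f.onMatch a).perm = f.glued a.perm := rfl

/-- An equivalence relation containing the cups and (the images of) the arcs of `a` contains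
the arcs of `f a`. -/
theorem Flat.rel_onMatch (f : Flat S T) (a : CM S) {t : Setoid (Fin n)}
    (hc : ∀ p, t p (f.cup p)) (ha : ∀ p ∈ S, t (f.shift p) (f.shift (a.perm p))) (p : Fin n) :
    t p ((f.onMatch a).perm p) := by
  rw [f.onMatch_perm]
  rcases f.cases p with ⟨q, hq, rfl⟩ | h | h
  · rw [f.glued_shift _ hq]; exact ha q hq
  · rw [f.glued_cup a h]; exact hc p
  · rw [f.glued_fix a h]

/-- An equivalence relation containing the arcs of `f a` contains the images of the arcs
of `a`. -/
theorem Flat.rel_of_onMatch (f : Flat S T) (a : CM S) {t : Setoid (Fin n)}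
    (h : ∀ p, t p ((f.onMatch a).perm p)) (p : Fin n) : t (f.shift p) (f.shift (a.perm p)) := by
  by_cases hp : p ∈ S
  · have := h (f.shift p)
    rwa [f.onMatch_perm, f.glued_shift _ hp] at this
  · rw [a.bip.fix p hp]

theorem Flat.rel_cup (f : Flat S T) (a : CM S) {t : Setoid (Fin n)}
    (h : ∀ p, t p ((f.onMatch a).perm p)) (p : Fin n) : t p (f.cup p) := by
  by_cases hp : f.cup p = p
  · rw [hp]
  · have := h p
    rwa [f.onMatch_perm, f.glued_cup a hp] at this

/-- Components of the glued manifolds meeting the through strands. -/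
theorem Flat.circ_shift (f : Flat S T) (b a : CM S) (p q : Fin n) (hp : p ∈ S) :
    circ b.perm a.perm p q ↔
      circ (f.onMatch b).perm (f.onMatch a).perm (f.shift p) (f.shift q) := by
  classical
  constructor
  · have : circ b.perm a.perm ≤
        Setoid.comap f.shift (circ (f.onMatch b).perm (f.onMatch a).perm) :=
      circ_le (f.rel_of_onMatch b (circ_left _ _)) (f.rel_of_onMatch a (circ_right _ _))
    exact fun h => this h
  · let t : Setoid (Fin n) :=
      { r := fun x y => (f.shift.symm x ∈ S ↔ f.shift.symm y ∈ S) ∧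
          (f.shift.symm x ∈ S → circ b.perm a.perm (f.shift.symm x) (f.shift.symm y))
        iseqv := ⟨fun x => ⟨Iff.rfl, fun _ => (circ b.perm a.perm).refl _⟩,
          fun h => ⟨h.1.symm, fun h' => (circ b.perm a.perm).symm (h.2 (h.1.2 h'))⟩,
          fun h h' => ⟨h.1.trans h'.1, fun h'' =>
            (circ b.perm a.perm).trans (h.2 h'') (h'.2 (h.1.1 h''))⟩⟩ }
    have hcup : ∀ p, t p (f.cup p) := by
      intro p
      by_cases hp : f.cup p = p
      · rw [hp]
      · have h1 := f.symm_not_mem hp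
        have h2 : f.shift.symm (f.cup p) ∉ S :=
          f.symm_not_mem (by rw [f.invol]; exact Ne.symm hp)
        exact ⟨by tauto, by tauto⟩
    have hle : circ (f.onMatch b).perm (f.onMatch a).perm ≤ t := by
      refine circ_le (f.rel_onMatch b hcup ?_) (f.rel_onMatch a hcup ?_)
      · intro p hp
        exact ⟨by simp [hp, b.mem hp], fun _ => by simpa using circ_left b.perm a.perm p⟩
      · intro p hp
        exact ⟨by simp [hp, a.mem hp], fun _ => by simpa using circ_right b.perm a.perm p⟩
    intro h
    have := (hle h).2 (by simpa using hp)
    simpa using this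

/-- Components of the glued manifolds meeting the cups. -/
theorem Flat.circ_cup (f : Flat S T) (b a : CM S) (p q : Fin n) (hp : f.cup p ≠ p) :
    circ f.cup f.cup p q ↔ circ (f.onMatch b).perm (f.onMatch a).perm p q := by
  constructor
  · have : circ f.cup f.cup ≤ circ (f.onMatch b).perm (f.onMatch a).perm :=
      circ_le (f.rel_cup b (circ_left _ _)) (f.rel_cup b (circ_left _ _))
    exact fun h => this h
  · let t : Setoid (Fin n) :=
      { r := fun x y => (f.cup x ≠ x ↔ f.cup y ≠ y) ∧ (f.cup x ≠ x → circ f.cup f.cup x y)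
        iseqv := ⟨fun x => ⟨Iff.rfl, fun _ => (circ f.cup f.cup).refl _⟩,
          fun h => ⟨h.1.symm, fun h' => (circ f.cup f.cup).symm (h.2 (h.1.2 h'))⟩,
          fun h h' => ⟨h.1.trans h'.1, fun h'' =>
            (circ f.cup f.cup).trans (h.2 h'') (h'.2 (h.1.1 h''))⟩⟩ }
    have hcup : ∀ p, t p (f.cup p) := fun p =>
      ⟨by rw [f.invol]; exact ne_comm, fun _ => circ_left _ _ p⟩
    have hs : ∀ a : CM S, ∀ p ∈ S, t (f.shift p) (f.shift (a.perm p)) := fun a p hp =>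
      ⟨by simp [f.disj p hp, f.disj _ (a.mem hp)], fun h => absurd (f.disj p hp) h⟩
    have hle : circ (f.onMatch b).perm (f.onMatch a).perm ≤ t :=
      circ_le (f.rel_onMatch b hcup (hs b)) (f.rel_onMatch a hcup (hs a))
    exact fun h => (hle h).2 hp

/-- Counting circles before and after gluing. -/
theorem Flat.wt_onMatch (f : Flat S T) (b a : CM S) (w : Fin n → ℤ) (hw0 : ∀ p, p ∉ T → w p = 0)
    (hb : ∀ p, w ((f.onMatch b).perm p) = w p) (ha : ∀ p, w ((f.onMatch a).perm p) = w p) :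
    wt (circ (f.onMatch b).perm (f.onMatch a).perm) w =
      wt (circ b.perm a.perm) (fun p => if p ∈ S then w (f.shift p) else 0) +
        wt (circ f.cup f.cup) (fun p => if f.cup p ≠ p then w p else 0) := by
  classical
  set r := circ (f.onMatch b).perm (f.onMatch a).perm
  let w1 : Fin n → ℤ := fun p => if f.shift.symm p ∈ S then w p else 0
  let w2 : Fin n → ℤ := fun p => if f.cup p ≠ p then w p else 0
  let w3 : Fin n → ℤ := fun p => if p ∈ S then w (f.shift p) else 0
  have hsum : w = w1 + w2 := by
    funext p
    rw [Pi.add_apply]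
    rcases f.cases p with ⟨q, hq, rfl⟩ | h | h
    · simp [w1, w2, hq, f.disj q hq]
    · simp [w1, w2, h, f.symm_not_mem h]
    · have h' := h
      rw [f.mem_iff, not_or, not_ne_iff] at h
      simp [w1, w2, h.1, h.2, hw0 p h']
  have hcup : ∀ p, w (f.cup p) = w p := fun p => (f.rel_cup b (t := Setoid.ker w)
    (fun p => (hb p).symm) p).symm
  have hw2c : ∀ p, w2 (f.cup p) = w2 p := by
    intro p
    simp only [w2, f.invol, hcup, ne_comm]
  have hinv1 : ∀ a : CM S, (∀ p, w ((f.onMatch a).perm p) = w p) →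
      ∀ p ∈ S, w (f.shift (a.perm p)) = w (f.shift p) := fun a ha p _ =>
    (f.rel_of_onMatch a (t := Setoid.ker w) (fun p => (ha p).symm) p).symm
  have hw1c : ∀ p, w1 (f.cup p) = w1 p := by
    intro p
    by_cases hp : f.cup p = p
    · rw [hp]
    · have h2 : f.shift.symm (f.cup p) ∉ S :=
        f.symm_not_mem (by rw [f.invol]; exact Ne.symm hp)
      simp [w1, h2, f.symm_not_mem hp]
  have hw1 : ∀ a : CM S, (∀ p, w ((f.onMatch a).perm p) = w p) →
      ∀ p, w1 ((f.onMatch a).perm p) = w1 p := fun a ha p =>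
    (f.rel_onMatch a (t := Setoid.ker w1) (fun p => (hw1c p).symm)
      (fun p hp => by
        show w1 _ = w1 _
        simp [w1, hp, a.mem hp, hinv1 a ha p hp]) p).symm
  have hw2 : ∀ a : CM S, ∀ p, w2 ((f.onMatch a).perm p) = w2 p := fun a p =>
    (f.rel_onMatch a (t := Setoid.ker w2) (fun p => (hw2c p).symm)
      (fun p hp => by
        show w2 _ = w2 _
        simp [w2, f.disj p hp, f.disj _ (a.mem hp)]) p).symm
  have hw3 : ∀ a : CM S, (∀ p, w ((f.onMatch a).perm p) = w p) →
      ∀ p, w3 (a.perm p) = w3 p := by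
    intro a ha p
    by_cases hp : p ∈ S
    · simp [w3, hp, a.mem hp, hinv1 a ha p hp]
    · rw [a.bip.fix p hp]
  have e1 : wt r w1 = wt (circ b.perm a.perm) w3 := by
    have i1 := wt_comap (fun p : S => f.shift p) (r := Setoid.comap (fun p : S => f.shift p) r)
      (r' := r) (fun _ _ => Iff.rfl) w1 (circ_invariant (hw1 b hb) (hw1 a ha))
      (fun z hz => by
        have : f.shift.symm z ∈ S := by by_contra h; exact hz (if_neg h)
        exact ⟨⟨_, this⟩, by simp⟩)
    have i2 := wt_comap (fun p : S => (p : Fin n))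
      (r := Setoid.comap (fun p : S => f.shift p) r) (r' := circ b.perm a.perm)
      (fun x y => (f.circ_shift b a x y x.2).symm) w3 (circ_invariant (hw3 b hb) (hw3 a ha))
      (fun z hz => by
        have : z ∈ S := by by_contra h; exact hz (if_neg h)
        exact ⟨⟨_, this⟩, (circ b.perm a.perm).refl _⟩)
    rw [← i1, ← i2]
    congr 1
    funext p
    simp [w1, w3]
  have e2 : wt r w2 = wt (circ f.cup f.cup) w2 := by
    have i1 := wt_comap (fun p : {p // f.cup p ≠ p} => (p : Fin n))
      (r := Setoid.comap (fun p : {p // f.cup p ≠ p} => (p : Fin n)) r)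
      (r' := r) (fun _ _ => Iff.rfl) w2 (circ_invariant (hw2 b) (hw2 a))
      (fun z hz => by
        have : f.cup z ≠ z := fun h => hz (if_neg (not_not.2 h))
        exact ⟨⟨_, this⟩, r.refl _⟩)
    have i2 := wt_comap (fun p : {p // f.cup p ≠ p} => (p : Fin n))
      (r := Setoid.comap (fun p : {p // f.cup p ≠ p} => (p : Fin n)) r)
      (r' := circ f.cup f.cup) (fun x y => (f.circ_cup b a x y x.2).symm) w2
      (circ_invariant hw2c hw2c)
      (fun z hz => by
        have : f.cup z ≠ z := fun h => hz (if_neg (not_not.2 h))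
        exact ⟨⟨_, this⟩, (circ f.cup f.cup).refl _⟩)
    rw [← i1, ← i2]
  rw [← e1, ← e2, ← wt_add, ← hsum]

theorem arcs_wt (b : CM S) (w : Fin n → ℤ) (hb : ∀ p, w (b.perm p) = w p)
    (hw0 : ∀ p, p ∉ S → w p = 0) : ((arcs b.perm).map w).sum = wt (circ b.perm b.perm) w := by
  have h := wt_splits b.bip b.bip b.bip w hb hb hb hw0
  have hl := splits_count b b b
  rw [numCirc_self] at hl
  have : splitArcs b.perm b.perm b.perm = [] := List.length_eq_zero_iff.1 (by omega)
  rw [this] at h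
  simp at h
  linarith

/-- The effect of gluing on the variables. -/
def Flat.onVar (f : Flat S T) (p : Fin n) : MvPolynomial (Fin n) ℤ :=
  if p ∈ S then MvPolynomial.X (f.shift p) else 0

/-- The effect of gluing on polynomials. -/
def Flat.onPoly (f : Flat S T) (b a : CM S) :
    MvPolynomial (Fin n) ℤ →+* FF (f.onMatch b) (f.onMatch a) :=
  (FF.mk _ _).comp (MvPolynomial.aeval f.onVar : MvPolynomial (Fin n) ℤ →ₐ[ℤ] _).toRingHom

theorem Flat.onPoly_X (f : Flat S T) (b a : CM S) (p : Fin n) :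
    f.onPoly b a (MvPolynomial.X p) = if p ∈ S then FF.mk _ _ (MvPolynomial.X (f.shift p)) else 0 := by
  simp [Flat.onPoly, Flat.onVar, apply_ite (FF.mk (f.onMatch b) (f.onMatch a))]

/-- The ring homomorphism `𝓕(W(b)a) → 𝓕(W(f b) f a)` induced by the inclusion of the circles
of `W(b)a` into those of `W(f b) f a`; each further circle of `W(f b) f a`, formed by two cups, is
created by the unit of `𝓐`. -/
def Flat.onF (f : Flat S T) (b a : CM S) : FF b a →+* FF (f.onMatch b) (f.onMatch a) :=
  Ideal.Quotient.lift _ (f.onPoly b a) fun g hg => by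
    have hX : ∀ x y : CM S, ∀ p q, (p ∈ S ↔ q ∈ S) →
        (p ∈ S → circ (f.onMatch x).perm (f.onMatch y).perm (f.shift p) (f.shift q)) →
        f.onPoly x y (MvPolynomial.X p) = f.onPoly x y (MvPolynomial.X q) := by
      intro x y p q h1 h2
      rw [f.onPoly_X, f.onPoly_X]
      by_cases hp : p ∈ S
      · rw [if_pos hp, if_pos (h1.1 hp)]
        exact cls_X_eq _ _ _ _ (h2 hp)
      · rw [if_neg hp, if_neg (mt h1.2 hp)]
    have hm : ∀ a : CM S, ∀ p, p ∈ S ↔ a.perm p ∈ S := fun a p =>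
      ⟨a.mem, fun h => by have := a.mem h; rwa [a.invol] at this⟩
    have := mul_kills b.perm a.perm (f.onPoly b a) 1
      (fun p => by
        rw [f.onPoly_X]
        split_ifs
        · exact cls_X_sq _ _ _
        · simp)
      (fun p hp => by rw [f.onPoly_X, if_neg hp])
      (fun p => by
        rw [hX b a p _ (hm b p) (fun _ => f.rel_of_onMatch b (circ_left _ _) p), sub_self,
          mul_zero])
      (fun p => by
        rw [hX b a p _ (hm a p) (fun _ => f.rel_of_onMatch a (circ_right _ _) p), sub_self,
          mul_zero]) g hg
    rwa [one_mul] at this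

theorem Flat.onF_mk (f : Flat S T) (b a : CM S) (g : MvPolynomial (Fin n) ℤ) :
    f.onF b a (FF.mk b a g) = FF.mk _ _ (MvPolynomial.aeval f.onVar g) := rfl

theorem Flat.onPoly_contr (f : Flat S T) (c b a : CM S) :
    f.onPoly c a (contr c.perm b.perm a.perm) =
      FF.mk _ _ (contr (f.onMatch c).perm (f.onMatch b).perm (f.onMatch a).perm) := by
  classical
  let x : Fin n → FF (f.onMatch c) (f.onMatch a) := fun p => FF.mk _ _ (MvPolynomial.X p)
  let G : List (Fin n × Fin n) :=
    (splitArcs c.perm b.perm a.perm).map fun p => (f.shift p, f.shift (b.perm p))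
  let G' : List (Fin n × Fin n) :=
    (splitArcs (f.onMatch c).perm (f.onMatch b).perm (f.onMatch a).perm).map
      fun p => (p, (f.onMatch b).perm p)
  have e1 : f.onPoly c a (contr c.perm b.perm a.perm) = (G.map fun e => x e.1 + x e.2).prod := by
    rw [contr, map_list_prod, List.map_map, List.map_map]
    congr 1
    refine List.map_congr_left fun p hp => ?_
    have hp' := splitArcs_subset b.bip p hp
    simp [f.onPoly_X, hp', b.mem hp', x]
  have e2 : FF.mk _ _ (contr (f.onMatch c).perm (f.onMatch b).perm (f.onMatch a).perm) =
      (G'.map fun e => x e.1 + x e.2).prod := by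
    rw [contr, map_list_prod, List.map_map, List.map_map]
    congr 1
  have key1 : ∀ t : Setoid (Fin n), circ (f.onMatch c).perm (f.onMatch a).perm ≤ t →
      (∀ e ∈ G, t e.1 e.2) → ∀ p, t p ((f.onMatch b).perm p) := by
    intro t ht hG
    have hS := circ_le_of_splits c.bip b.bip a.bip (t := Setoid.comap f.shift t)
      (circ_le (f.rel_of_onMatch c fun p => ht (circ_left _ _ p))
        (f.rel_of_onMatch a fun p => ht (circ_right _ _ p)))
      (fun p hp => hG (f.shift p, f.shift (b.perm p)) (List.mem_map.2 ⟨p, hp, rfl⟩))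
    exact f.rel_onMatch b (f.rel_cup c fun p => ht (circ_left _ _ p))
      fun p _ => hS.2 (circ_left _ _ p)
  rw [e1, e2]
  refine prod_edges_eq x (cls_X_sq _ _) (circ (f.onMatch c).perm (f.onMatch a).perm)
    (cls_X_eq _ _) G G' ?_ ?_ ?_
  · intro t ht hG e he
    obtain ⟨p, -, rfl⟩ := List.mem_map.1 he
    exact key1 t ht hG p
  · intro t ht hG' e he
    have hT := circ_le_of_splits (f.onMatch c).bip (f.onMatch b).bip (f.onMatch a).bip ht
      (fun p hp => hG' (p, _) (List.mem_map.2 ⟨p, hp, rfl⟩))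
    obtain ⟨p, -, rfl⟩ := List.mem_map.1 he
    exact f.rel_of_onMatch b (fun p => hT.2 (circ_left _ _ p)) p
  · intro w hr hG _
    have hb : ∀ p, w ((f.onMatch b).perm p) = w p :=
      fun p => (key1 (Setoid.ker w) (fun p q h => hr p q h) hG p).symm
    have hc : ∀ p, w ((f.onMatch c).perm p) = w p := fun p => (hr _ _ (circ_left _ _ p)).symm
    have ha : ∀ p, w ((f.onMatch a).perm p) = w p := fun p => (hr _ _ (circ_right _ _ p)).symm
    let w' : Fin n → ℤ := fun p => if p ∈ T then w p else 0
    let v : Fin n → ℤ := fun p => if p ∈ S then w' (f.shift p) else 0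
    have hw' : ∀ y : CM S, (∀ p, w ((f.onMatch y).perm p) = w p) →
        ∀ p, w' ((f.onMatch y).perm p) = w' p := by
      intro y hy p
      by_cases hp : p ∈ T
      · simp [w', hp, (f.onMatch y).mem hp, hy]
      · rw [(f.onMatch y).bip.fix p hp]
    have hw0 : ∀ p, p ∉ T → w' p = 0 := fun p hp => by simp [w', hp]
    have hv0 : ∀ p, p ∉ S → v p = 0 := fun p hp => by simp [v, hp]
    have hv : ∀ y : CM S, (∀ p, w ((f.onMatch y).perm p) = w p) → ∀ p, v (y.perm p) = v p := by
      intro y hy p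
      by_cases hp : p ∈ S
      · simpa [v, hp, y.mem hp] using (f.rel_of_onMatch y (t := Setoid.ker w')
          (fun p => (hw' y hy p).symm) p).symm
      · rw [y.bip.fix p hp]
    have hS := wt_splits c.bip b.bip a.bip v (hv c hc) (hv b hb) (hv a ha) hv0
    have hT := wt_splits (f.onMatch c).bip (f.onMatch b).bip (f.onMatch a).bip w' (hw' c hc)
      (hw' b hb) (hw' a ha) hw0
    rw [arcs_wt b v (hv b hb) hv0] at hS
    rw [arcs_wt (f.onMatch b) w' (hw' b hb) hw0,
      f.wt_onMatch c a w' hw0 (hw' c hc) (hw' a ha), f.wt_onMatch b b w' hw0 (hw' b hb) (hw' b hb),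
      f.wt_onMatch c b w' hw0 (hw' c hc) (hw' b hb),
      f.wt_onMatch b a w' hw0 (hw' b hb) (hw' a ha)] at hT
    have g1 : (G.map fun e => w e.1).sum = ((splitArcs c.perm b.perm a.perm).map v).sum := by
      rw [List.map_map]
      congr 1
      refine List.map_congr_left fun p hp => ?_
      have hp' := splitArcs_subset b.bip p hp
      simp [v, w', hp', f.shift_mem hp']
    have g2 : (G'.map fun e => w e.1).sum = ((splitArcs (f.onMatch c).perm (f.onMatch b).perm
        (f.onMatch a).perm).map w').sum := by
      rw [List.map_map]
      congr 1
      refine List.map_congr_left fun p hp => ?_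
      have hp' := splitArcs_subset (f.onMatch b).bip p hp
      simp [w', hp']
    rw [g1, g2]
    linarith

/-- Gluing is compatible with the contraction maps. -/
theorem Flat.onF_mul (f : Flat S T) (c b a : CM S) (x : FF c b) (y : FF b a) :
    f.onF c a (FF.mul c b a x y) = FF.mul _ _ _ (f.onF c b x) (f.onF b a y) := by
  obtain ⟨g, rfl⟩ := cls_surjective _ _ x
  obtain ⟨h, rfl⟩ := cls_surjective _ _ y
  have := f.onPoly_contr c b a
  have e := FF.mul_mk c b a g h
  rw [e, f.onF_mk]
  have e' := FF.mul_mk (f.onMatch c) (f.onMatch b) (f.onMatch a)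
    (MvPolynomial.aeval f.onVar g) (MvPolynomial.aeval f.onVar h)
  rw [f.onF_mk, f.onF_mk, e', map_mul (FF.mk _ _) (_ * _), ← this, map_mul (MvPolynomial.aeval _),
    map_mul (MvPolynomial.aeval _)]
  exact map_mul (FF.mk _ _) _ _

theorem Flat.numCirc_onMatch (f : Flat S T) (b a : CM S) :
    (numCirc T (f.onMatch b).perm (f.onMatch a).perm : ℤ) + (S.card / 2 : ℕ) =
      numCirc S b.perm a.perm + (T.card / 2 : ℕ) := by
  have hw0 : ∀ p, p ∉ T → one' T p = 0 := fun p hp => by simp [one', hp]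
  have hone : (fun p => if p ∈ S then one' T (f.shift p) else 0) = one' S := by
    funext p
    by_cases hp : p ∈ S
    · simp [one', hp, f.shift_mem hp]
    · simp [one', hp]
  have h1 := f.wt_onMatch b a (one' T) hw0 (one'_invariant _) (one'_invariant _)
  have h2 := f.wt_onMatch b b (one' T) hw0 (one'_invariant _) (one'_invariant _)
  rw [hone, ← numCirc_eq, ← numCirc_eq] at h1 h2
  rw [numCirc_self, numCirc_self] at h2
  linarith

theorem Flat.onF_mem (f : Flat S T) (b a : CM S) (d : ℤ) (x : FF b a)
    (hx : x ∈ tqDeg S b.perm a.perm (d - (S.card / 2 : ℕ))) :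
    f.onF b a x ∈ tqDeg T (f.onMatch b).perm (f.onMatch a).perm (d - (T.card / 2 : ℕ)) := by
  obtain ⟨g, hg, rfl⟩ := mem_tqDeg.1 hx
  rcases eq_or_ne g 0 with rfl | hg0
  · rw [map_zero, map_zero]; exact zero_mem _
  obtain ⟨s₀, hs₀⟩ := Finset.nonempty_of_ne_empty (mt MvPolynomial.support_eq_empty.1 hg0)
  have hdeg : ∀ s : Fin n →₀ ℕ, s.degree = Finsupp.weight 1 s := fun s => by
    rw [Finsupp.degree_eq_weight_one]
    rfl
  have hhom : g.IsHomogeneous s₀.degree := by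
    intro s hs
    have h1 := hg s (MvPolynomial.mem_support_iff.2 hs)
    have h2 := hg s₀ hs₀
    rw [← hdeg]
    omega
  have hvar : ∀ p, (f.onVar p).IsHomogeneous 1 := by
    intro p
    rw [Flat.onVar]
    split_ifs
    · exact MvPolynomial.isHomogeneous_X _ _
    · exact MvPolynomial.isHomogeneous_zero _ _ _
  have := hhom.aeval f.onVar hvar
  refine mem_tqDeg.2 ⟨_, fun s hs => ?_, (f.onF_mk b a g).symm⟩
  have h1 := this (MvPolynomial.mem_support_iff.1 hs)
  rw [← hdeg] at h1
  have h2 := hg s₀ hs₀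
  have h3 := f.numCirc_onMatch b a
  rw [h1, one_mul]
  linarith

end Flat

/-! ### The arc ring and the bimodules of flat tangles -/

section Matrices

variable {n : ℕ} {S : Finset (Fin n)}

/-- Matrix multiplication, the entries being multiplied by means of the contraction maps. -/
def mm {I J K : Type} [Fintype J] (f : I → CM S) (g : J → CM S) (h : K → CM S) :
    (∀ i j, FF (f i) (g j)) →+ (∀ j k, FF (g j) (h k)) →+ ∀ i k, FF (f i) (h k) :=
  AddMonoidHom.mk' (fun x => AddMonoidHom.mk'
    (fun y i k => ∑ j, FF.mul (f i) (g j) (h k) (x i j) (y j k))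
    (fun y z => by
      funext i k
      simp [Finset.sum_add_distrib]))
    (fun x y => by
      refine AddMonoidHom.ext fun z => ?_
      funext i k
      simp [Finset.sum_add_distrib])

theorem mm_apply {I J K : Type} [Fintype J] (f : I → CM S) (g : J → CM S) (h : K → CM S)
    (x : ∀ i j, FF (f i) (g j)) (y : ∀ j k, FF (g j) (h k)) (i : I) (k : K) :
    mm f g h x y i k = ∑ j, FF.mul (f i) (g j) (h k) (x i j) (y j k) := rfl

theorem mm_assoc {I J K L : Type} [Fintype J] [Fintype K] (f : I → CM S) (g : J → CM S)
    (h : K → CM S) (l : L → CM S) (x : ∀ i j, FF (f i) (g j)) (y : ∀ j k, FF (g j) (h k))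
    (z : ∀ k m, FF (h k) (l m)) : mm f h l (mm f g h x y) z = mm f g l x (mm g h l y z) := by
  funext i m
  simp only [mm_apply, map_sum, AddMonoidHom.finsetSum_apply]
  rw [Finset.sum_comm]
  refine Finset.sum_congr rfl fun j _ => Finset.sum_congr rfl fun k _ => ?_
  exact FF.mul_assoc _ _ _ _ _ _ _

/-- The identity matrix. -/
def mOne {I : Type} [DecidableEq I] (f : I → CM S) (i j : I) : FF (f i) (f j) :=
  if i = j then 1 else 0

theorem mOne_mm {I K : Type} [Fintype I] [DecidableEq I] (f : I → CM S) (h : K → CM S)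
    (x : ∀ i k, FF (f i) (h k)) : mm f f h (mOne f) x = x := by
  funext i k
  rw [mm_apply, Finset.sum_eq_single i]
  · rw [mOne, if_pos rfl, FF.one_mul]
  · intro j _ hj
    rw [mOne, if_neg hj.symm, map_zero, AddMonoidHom.zero_apply]
  · simp

theorem mm_mOne {I K : Type} [Fintype K] [DecidableEq K] (f : I → CM S) (h : K → CM S)
    (x : ∀ i k, FF (f i) (h k)) : mm f h h x (mOne h) = x := by
  funext i k
  rw [mm_apply, Finset.sum_eq_single k]
  · rw [mOne, if_pos rfl, FF.mul_one]
  · intro j _ hj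
    rw [mOne, if_neg hj, map_zero]
  · simp

/-- Matrices whose entries have degree `d` after a shift by `m`. -/
def mDeg {I J : Type} (f : I → CM S) (g : J → CM S) (m : ℕ) (d : ℤ) :
    AddSubgroup (∀ i j, FF (f i) (g j)) :=
  AddSubgroup.pi Set.univ fun i => AddSubgroup.pi Set.univ fun j =>
    tqDeg S (f i).perm (g j).perm (d - m)

theorem mem_mDeg {I J : Type} {f : I → CM S} {g : J → CM S} {m : ℕ} {d : ℤ}
    {x : ∀ i j, FF (f i) (g j)} :
    x ∈ mDeg f g m d ↔ ∀ i j, x i j ∈ tqDeg S (f i).perm (g j).perm (d - m) := by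
  simp [mDeg, AddSubgroup.mem_pi]

theorem mDeg_isInternal {I J : Type} [Finite I] [Finite J] (f : I → CM S) (g : J → CM S) (m : ℕ) :
    DirectSum.IsInternal (mDeg f g m) :=
  isInternal_pi (fun i d => AddSubgroup.pi Set.univ fun j => tqDeg S (f i).perm (g j).perm (d - m))
    fun i => isInternal_pi (fun j d => tqDeg S (f i).perm (g j).perm (d - m))
      fun _ => isInternal_shift (tqDeg_isInternal _ _ _) m

theorem mm_mem {I J K : Type} [Fintype J] {f : I → CM S} {g : J → CM S} {h : K → CM S}
    {m m' m'' : ℕ} {d e : ℤ} {x : ∀ i j, FF (f i) (g j)} {y : ∀ j k, FF (g j) (h k)}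
    (hx : x ∈ mDeg f g m d) (hy : y ∈ mDeg g h m' e) (hm : m + m' = S.card / 2 + m'') :
    mm f g h x y ∈ mDeg f h m'' (d + e) := by
  rw [mem_mDeg] at hx hy ⊢
  intro i k
  rw [mm_apply]
  refine sum_mem fun j _ => ?_
  have := FF.mul_mem (hx i j) (hy j k)
  have e : d - m + (e - m') + (S.card / 2 : ℕ) = d + e - m'' := by
    have : (m : ℤ) + m' = (S.card / 2 : ℕ) + m'' := by exact_mod_cast hm
    linarith
  rwa [e] at this

end Matrices

section Ring

variable {n : ℕ} (S : Finset (Fin n))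

/-- The arc ring `H(S) = ⨁_{b, a} 𝓕(W(b)a){m}`, the sum over all pairs of crossingless matchings of
the set `S` of `2m` points. -/
def H : Type := ∀ b a : CM S, FF b a

instance : AddCommGroup (H S) := inferInstanceAs (AddCommGroup (∀ b a : CM S, FF b a))

instance : Ring (H S) :=
  { (inferInstance : AddCommGroup (H S)) with
    mul := fun x y => mm id id id x y
    one := mOne (id : CM S → CM S)
    mul_assoc := fun x y z => mm_assoc id id id id x y z
    one_mul := fun x => mOne_mm id id x
    mul_one := fun x => mm_mOne id id x
    left_distrib := fun x y z => map_add (mm id id id x) y z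
    right_distrib := fun x y z => DFunLike.congr_fun (map_add (mm id id id) x y) z
    zero_mul := fun x => DFunLike.congr_fun (map_zero (mm id id id)) x
    mul_zero := fun x => map_zero (mm id id id x) }

/-- The degree `d` part of the arc ring. -/
def Hgr (d : ℤ) : AddSubgroup (H S) := mDeg (id : CM S → CM S) id (S.card / 2) d

theorem Hgr_isInternal : DirectSum.IsInternal (Hgr S) := mDeg_isInternal id id _

theorem Hgr_mul_mem {d e : ℤ} {x y : H S} (hx : x ∈ Hgr S d) (hy : y ∈ Hgr S e) :
    x * y ∈ Hgr S (d + e) := mm_mem hx hy rfl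

theorem Hgr_one_mem : (1 : H S) ∈ Hgr S 0 := by
  refine mem_mDeg.2 fun b a => ?_
  show (if b = a then (1 : FF b a) else 0) ∈ tqDeg S b.perm a.perm _
  split_ifs with h
  · subst h
    rw [zero_sub]
    exact FF.one_mem b
  · exact zero_mem _

end Ring

section Bimodules

variable {n : ℕ} {S S' T : Finset (Fin n)}

/-- The homomorphism from the arc ring to matrices induced by a flat tangle. -/
def Flat.onH (f : Flat S T) : H S →+ ∀ b a : CM S, FF (f.onMatch b) (f.onMatch a) :=
  AddMonoidHom.mk' (fun x b a => f.onF b a (x b a)) fun x y => by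
    funext b a
    exact map_add (f.onF b a) _ _

theorem Flat.onH_one (f : Flat S T) : f.onH 1 = mOne f.onMatch := by
  funext b a
  show f.onF b a (if b = a then (1 : FF b a) else 0) = if b = a then 1 else 0
  split_ifs
  · exact map_one _
  · exact map_zero _

theorem Flat.onH_mul (f : Flat S T) (x y : H S) :
    f.onH (x * y) = mm f.onMatch f.onMatch f.onMatch (f.onH x) (f.onH y) := by
  funext c a
  show f.onF c a (∑ b, FF.mul c b a (x c b) (y b a)) = _
  rw [map_sum]
  exact Finset.sum_congr rfl fun b _ => f.onF_mul c b a _ _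

theorem Flat.onH_mem (f : Flat S T) {d : ℤ} {x : H S} (hx : x ∈ Hgr S d) :
    f.onH x ∈ mDeg f.onMatch f.onMatch (T.card / 2) d :=
  mem_mDeg.2 fun b a => f.onF_mem b a d _ (mem_mDeg.1 hx b a)

/-- The abelian group `⨁_{b, a} 𝓕(W(b) f^* g a)`, where `f^*` is the mirror image of the flat tangle
`f`: the manifold `W(b) f^* g a` is `W(f b) (g a)`. -/
def Bim (f : Flat S T) (g : Flat S' T) : Type :=
  ∀ (b : CM S) (a : CM S'), FF (f.onMatch b) (g.onMatch a)

variable (f : Flat S T) (g : Flat S' T)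

instance : AddCommGroup (Bim f g) :=
  inferInstanceAs (AddCommGroup (∀ (b : CM S) (a : CM S'), FF (f.onMatch b) (g.onMatch a)))

instance : Module (H S) (Bim f g) where
  smul x z := mm f.onMatch f.onMatch g.onMatch (f.onH x) z
  one_smul z := by
    show mm _ _ _ (f.onH 1) z = z
    rw [f.onH_one]
    exact mOne_mm _ _ z
  mul_smul x y z := by
    show mm _ _ _ (f.onH (x * y)) z = mm _ _ _ _ (mm _ _ _ _ _)
    rw [f.onH_mul]
    exact mm_assoc _ _ _ _ _ _ _
  smul_zero x := map_zero (mm f.onMatch f.onMatch g.onMatch (f.onH x))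
  smul_add x y z := map_add (mm f.onMatch f.onMatch g.onMatch (f.onH x)) y z
  add_smul x y z := by
    show mm _ _ _ (f.onH (x + y)) z = mm _ _ _ (f.onH x) z + mm _ _ _ (f.onH y) z
    rw [map_add, map_add]
    rfl
  zero_smul z := by
    show mm _ _ _ (f.onH 0) z = 0
    rw [map_zero, map_zero]
    rfl

instance : Module (H S')ᵐᵒᵖ (Bim f g) where
  smul x z := mm f.onMatch g.onMatch g.onMatch z (g.onH x.unop)
  one_smul z := by
    show mm _ _ _ z (g.onH 1) = z
    rw [g.onH_one]
    exact mm_mOne _ _ z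
  mul_smul x y z := by
    show mm _ _ _ z (g.onH (y.unop * x.unop)) = mm _ _ _ (mm _ _ _ _ _) _
    rw [g.onH_mul]
    exact (mm_assoc _ _ _ _ _ _ _).symm
  smul_zero x := DFunLike.congr_fun (map_zero (mm f.onMatch g.onMatch g.onMatch)) _
  smul_add x y z := DFunLike.congr_fun (map_add (mm f.onMatch g.onMatch g.onMatch) y z) _
  add_smul x y z := by
    show mm _ _ _ z (g.onH (x.unop + y.unop)) = mm _ _ _ z (g.onH x.unop) + mm _ _ _ z _
    rw [map_add, map_add]
    rfl
  zero_smul z := by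
    show mm _ _ _ z (g.onH 0) = 0
    rw [map_zero, map_zero]

instance : Module.Finite (H S) (Bim f g) := by
  have : Module.Finite ℤ (Bim f g) := inferInstanceAs
    (Module.Finite ℤ (∀ (b : CM S) (a : CM S'), FF (f.onMatch b) (g.onMatch a)))
  exact Module.Finite.of_restrictScalars_finite ℤ (H S) (Bim f g)

/-- The graded `(H(S), H(S'))`-bimodule `𝓕(f^* g) = ⨁_{b, a} 𝓕(W(b) f^* g a){m}` of the flat tangle
`f^* g` with `2m` bottom end points. -/
def bimodule : GrBimod (H S) (Hgr S) (H S') (Hgr S') where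
  carrier := Bim f g
  comm := ⟨fun _ _ _ => (mm_assoc f.onMatch f.onMatch g.onMatch g.onMatch _ _ _).symm⟩
  gr := mDeg f.onMatch g.onMatch (S'.card / 2)
  isInternal := mDeg_isInternal _ _ _
  smul_mem _ _ _ _ hx hz := mm_mem (f.onH_mem hx) hz rfl
  mul_mem _ _ _ _ hz hx := mm_mem hz (g.onH_mem hx) (add_comm _ _)
  finite := inferInstance

end Bimodules

/-! ### Elementary flat tangles -/

section Elementary

variable {n : ℕ} {S T : Finset (Fin n)}

/-- The identity tangle. -/
def Flat.idTangle (S : Finset (Fin n)) : Flat S S where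
  shift := 1
  cup := 1
  invol _ := rfl
  mono _ _ _ _ h := h
  disj _ _ := rfl
  mem_iff p := by
    show p ∈ S ↔ p ∈ S ∨ p ≠ p
    simp
  planar p q h1 h2 := absurd h1 h2.asymm

/-- The flat tangle without cups and caps which moves an end point from `u` to the adjacent
position `v`, or from `v` to `u`. -/
def Flat.moveTangle (u v : Fin n) (huv : (u : ℕ) + 1 = v ∨ (v : ℕ) + 1 = u)
    (hS : u ∈ S ↔ v ∉ S) (hT : ∀ p, p ∈ T ↔ swap u v p ∈ S) : Flat S T where
  shift := swap u v
  cup := 1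
  invol _ := rfl
  mono p hp q hq h := by
    simp only [swap_apply_def]
    rw [Fin.lt_def] at h ⊢
    split_ifs with h1 h2 h3 h4 h5 h6 <;> subst_vars <;> try omega
    all_goals tauto
  disj _ _ := rfl
  mem_iff p := by simp [hT]
  planar p q h1 h2 := absurd h1 h2.asymm

/-- The flat tangle with one cup, which joins the adjacent top points `u` and `v`. -/
def Flat.cupTangle (u v : Fin n) (huv : (u : ℕ) + 1 = v ∨ (v : ℕ) + 1 = u) (hu : u ∉ S)
    (hv : v ∉ S) (hT : ∀ p, p ∈ T ↔ p ∈ S ∨ p = u ∨ p = v) : Flat S T where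
  shift := 1
  cup := swap u v
  invol p := swap_apply_self u v p
  mono _ _ _ _ h := h
  disj p hp := swap_apply_of_ne_of_ne (by rintro rfl; exact hu hp) (by rintro rfl; exact hv hp)
  mem_iff p := by
    have : u ≠ v := by rintro rfl; omega
    rw [hT, swap_apply_ne_self_iff]
    exact or_congr Iff.rfl (by simp [this])
  planar p q h1 h2 := by
    exfalso
    rw [swap_apply_def] at h2
    rw [Fin.lt_def] at h1 h2
    split_ifs at h2 with h3 h4 <;> subst_vars <;> omega

end Elementary

/-! ### The categories -/

section Weights

variable {n k : ℕ}

/-- The admissible weights: sequences of `n` numbers from `{0, 1, 2}` with sum `2k`. -/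
structure Weight (n k : ℕ) where
  val : Fin n → ℕ
  le_two : ∀ p, val p ≤ 2
  sum_eq : ∑ p, val p = 2 * k

/-- The positions of the ones of a weight. -/
def Weight.ones (l : Weight n k) : Finset (Fin n) := Finset.univ.filter fun p => l.val p = 1

theorem Weight.mem_ones (l : Weight n k) (p : Fin n) : p ∈ l.ones ↔ l.val p = 1 := by
  simp [Weight.ones]

/-- The weight `μ - j e_u + j e_v`, where `e_u` and `e_v` are standard basis vectors. -/
def Weight.source (μ : Weight n k) (u v : Fin n) (huv : u ≠ v) (j : ℕ)
    (h : j ≤ μ.val u ∧ μ.val v + j ≤ 2) : Weight n k where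
  val p := if p = u then μ.val u - j else if p = v then μ.val v + j else μ.val p
  le_two p := by
    have := μ.le_two u
    have := μ.le_two p
    split_ifs <;> omega
  sum_eq := by
    rw [← μ.sum_eq]
    have hv : v ∈ Finset.univ.erase u := by simp [huv.symm]
    rw [← Finset.add_sum_erase _ _ (Finset.mem_univ u), ← Finset.add_sum_erase _ _ hv,
      ← Finset.add_sum_erase _ μ.val (Finset.mem_univ u), ← Finset.add_sum_erase _ μ.val hv,
      if_pos rfl, if_neg huv.symm, if_pos rfl]
    have e : ∑ p ∈ (Finset.univ.erase u).erase v,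
        (if p = u then μ.val u - j else if p = v then μ.val v + j else μ.val p) =
        ∑ p ∈ (Finset.univ.erase u).erase v, μ.val p := by
      refine Finset.sum_congr rfl fun p hp => ?_
      simp only [Finset.mem_erase] at hp
      rw [if_neg hp.2.1, if_neg hp.1]
    rw [e]
    omega

/-- The category `𝓒(λ)` of finitely generated graded left modules over the arc ring of the ones
of `λ`, with grading-preserving homomorphisms. -/
abbrev CW (l : Weight n k) : Type 1 := GrMod (H l.ones) (Hgr l.ones)

/-- The direct sum `𝓒` of the categories `𝓒(λ)` over all admissible weights `λ`. -/
abbrev C (n k : ℕ) : Type 1 := ∀ l : Weight n k, CW l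

/-- The functor `𝓒(λ) ⥤ 𝓒(μ)`, `μ = λ + e_u - e_v`, given by the tensor product with the bimodule of
the following flat tangle: a cup at the positions `u, v` if `(λ_u, λ_v) = (0, 2)`, a cap at these
positions if `(λ_u, λ_v) = (1, 1)`, and if `(λ_u, λ_v) = (0, 1)` or `(1, 2)`, the tangle
moving the end point among the positions `u, v` to the other position. -/
def moveFunctor (u v : Fin n) (huv : (u : ℕ) + 1 = v ∨ (v : ℕ) + 1 = u) (l μ : Weight n k)
    (hu : μ.val u = l.val u + 1) (hv : l.val v = μ.val v + 1)
    (h : ∀ p, p ≠ u → p ≠ v → μ.val p = l.val p) : CW l ⥤ CW μ :=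
  if h02 : l.val u = 0 ∧ l.val v = 2 then
    (bimodule (Flat.idTangle μ.ones)
      (Flat.cupTangle (S := l.ones) u v huv (by rw [l.mem_ones]; omega) (by rw [l.mem_ones]; omega)
        (fun p => by
          by_cases h1 : p = u
          · subst h1; simp [μ.mem_ones]; omega
          · by_cases h2 : p = v
            · subst h2; simp [μ.mem_ones]; omega
            · simp [μ.mem_ones, l.mem_ones, h1, h2, h p h1 h2]))).tensor (Hgr_isInternal _)
  else if h11 : l.val u = 1 ∧ l.val v = 1 then
    (bimodule
      (Flat.cupTangle (S := μ.ones) u v huv (by rw [μ.mem_ones]; omega) (by rw [μ.mem_ones]; omega)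
        (fun p => by
          by_cases h1 : p = u
          · subst h1; simp [l.mem_ones]; omega
          · by_cases h2 : p = v
            · subst h2; simp [l.mem_ones]; omega
            · simp [μ.mem_ones, l.mem_ones, h1, h2, h p h1 h2]))
      (Flat.idTangle l.ones)).tensor (Hgr_isInternal _)
  else
    (bimodule (Flat.idTangle μ.ones)
      (Flat.moveTangle (S := l.ones) u v huv
        (by
          have := l.le_two v
          have := μ.le_two u
          rw [l.mem_ones, l.mem_ones]
          omega)
        (fun p => by
          have := l.le_two v
          have := μ.le_two u
          rw [μ.mem_ones, l.mem_ones]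
          by_cases h1 : p = u
          · subst h1; rw [swap_apply_left]; omega
          · by_cases h2 : p = v
            · subst h2; rw [swap_apply_right]; omega
            · rw [swap_apply_of_ne_of_ne h1 h2, h p h1 h2]))).tensor (Hgr_isInternal _)

/-- The zero functor. -/
def zeroFunctor (μ : Weight n k) : C n k ⥤ CW μ := (Functor.const _).obj GrMod.zero

/-- The functor `𝓒 ⥤ 𝓒` that takes `𝓒(λ)` to `𝓒(λ + e_u - e_v)`; it is zero on `𝓒(λ)` if the
weight `λ + e_u - e_v` is not admissible. -/
def transfer (k : ℕ) (u v : Fin n) (huv : (u : ℕ) + 1 = v ∨ (v : ℕ) + 1 = u) : C n k ⥤ C n k :=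
  Functor.pi' fun μ =>
    have hne : u ≠ v := by rintro rfl; omega
    if h : 1 ≤ μ.val u ∧ μ.val v + 1 ≤ 2 then
      Pi.eval (fun l : Weight n k => CW l) (μ.source u v hne 1 h) ⋙
        moveFunctor u v huv (μ.source u v hne 1 h) μ (by simp [Weight.source]; omega)
          (by simp [Weight.source, hne.symm])
          (fun p h1 h2 => by simp [Weight.source, h1, h2])
    else zeroFunctor μ

/-- For `S = T`, the equivalence induced by the canonical isomorphism `H(S) = H(T)`. -/
def castFunctor {S T : Finset (Fin n)} (h : S = T) :
    GrMod (H S) (Hgr S) ⥤ GrMod (H T) (Hgr T) :=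
  h ▸ 𝟭 _

/-- The functor `𝓒 ⥤ 𝓒` that takes `𝓒(λ)` with `(λ_u, λ_v) = (0, 2)` to `𝓒(λ + 2 e_u - 2 e_v)` by the
canonical equivalence (these weights have the same ones), and is zero on the other `𝓒(λ)`. -/
def divided (k : ℕ) (u v : Fin n) (huv : u ≠ v) : C n k ⥤ C n k :=
  Functor.pi' fun μ =>
    if h : 2 ≤ μ.val u ∧ μ.val v + 2 ≤ 2 then
      Pi.eval (fun l : Weight n k => CW l) (μ.source u v huv 2 h) ⋙
        castFunctor (by
          have := μ.le_two u
          ext p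
          rw [Weight.mem_ones, Weight.mem_ones]
          by_cases h1 : p = u
          · subst h1; simp [Weight.source]; omega
          · by_cases h2 : p = v
            · subst h2; simp [Weight.source, h1]; omega
            · simp [Weight.source, h1, h2])
    else zeroFunctor μ

/-- The functor of the grading shift `{j}` on `𝓒`. -/
def shiftC (n k : ℕ) (j : ℤ) : C n k ⥤ C n k where
  obj M l := (M l).shift j
  map f l := ⟨(f l).lin, fun d x hx => (f l).map_mem (d - j) x hx⟩

/-- The direct sum of two functors. -/
def dsum (A B : C n k ⥤ C n k) : C n k ⥤ C n k where
  obj M l := (A.obj M l).sum (B.obj M l)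
  map f l := ⟨(A.map f l).lin.prodMap (B.map f l).lin,
    fun d _ hx => ⟨(A.map f l).map_mem d _ hx.1, (B.map f l).map_mem d _ hx.2⟩⟩
  map_id M := by
    funext l
    refine GrMod.hom_ext fun x => ?_
    rw [A.map_id, B.map_id]
    rfl
  map_comp f g := by
    funext l
    refine GrMod.hom_ext fun x => ?_
    rw [A.map_comp, B.map_comp]
    rfl

/-- The `i`-th position (counting from zero). -/
def pos (i : Fin (n - 1)) : Fin n := ⟨i, by omega⟩

/-- The position after the `i`-th one. -/
def next (i : Fin (n - 1)) : Fin n := ⟨i + 1, by omega⟩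

theorem pos_ne_next (i : Fin (n - 1)) : pos i ≠ next i := by
  simp [pos, next]

/-- The functor `E_i`, which adds `ε_i = (0, …, 1, -1, …, 0)` to the weight. -/
def E (k : ℕ) (i : Fin (n - 1)) : C n k ⥤ C n k := transfer k (pos i) (next i) (Or.inl rfl)

/-- The functor `F_i`, which subtracts `ε_i` from the weight. -/
def F (k : ℕ) (i : Fin (n - 1)) : C n k ⥤ C n k := transfer k (next i) (pos i) (Or.inr rfl)

/-- The divided power `E_i^{(2)}`. -/
def E2 (k : ℕ) (i : Fin (n - 1)) : C n k ⥤ C n k := divided k (pos i) (next i) (pos_ne_next i)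

/-- The divided power `F_i^{(2)}`. -/
def F2 (k : ℕ) (i : Fin (n - 1)) : C n k ⥤ C n k :=
  divided k (next i) (pos i) (pos_ne_next i).symm

end Weights

end ArcAlg

end

open CategoryTheory

noncomputable section

namespace ArcAlg

open Equiv
open scoped TensorProduct

/-! ### Isomorphisms of graded modules and of functors between them -/

section GradedModules

variable {R : Type} [Ring R] {𝓡 : ℤ → AddSubgroup R}

/-! Each of the functors is, on each weight space, tensoring with the bimodule of a very small flat
tangle, so the relations come down to facts about tangles.

Composition of tangles is tensor product of bimodules. For a tangle `g` without caps, the left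
module 𝓕(g) is the direct sum over `a` of the projective modules of the matchings `g a`, with
explicit generators and coordinates. A balanced pairing B₁ × B₂ → B₃ together with such a dual basis
of B₂ gives B₁ ⊗ (B₂ ⊗ M) ≅ B₃ ⊗ M (`tensor_comp_iso`, `bimodule_comp_iso`). Hence cups followed by
cups, and cups followed by caps, can be composed freely.

Isotopic tangles have isomorphic bimodules. The isotopies that occur are the straightening of a
zigzag and the cancellation of strands against their mirror image. Both give a bijection of circles.
Comparing the numbers of circles shows that the contractions in the comparison map never split a
circle, so this map is a renaming of variables (`Isotopy.transport_eq`, `bimodule_iso_of_isotopy`).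

A closed circle contributes a tensor factor 𝓐, which is free on X and 1, central elements of degrees
1 and -1. Removing the circle therefore leaves two shifted copies (`circle_iso`).

It remains to look at weights. E and F are both instances of `transfer`, which moves one unit from
position `v` to the adjacent position `u`. The square of a transfer is nonzero only from (0,2)
through (1,1) to (2,0), where it is a cup followed by a cap at the same positions, that is, a circle
(`transfer_sq_iso`). In the cubic relation, the nonzero components of the left side are four
composites of three elementary tangles. In each of them exactly one summand of the right side
survives, and the two tangles are isotopic. The component functors are compared by
`cap_move_move_iso`, `cap_cup_move_iso`, `move_cap_cup_iso` and `move_move_cup_iso`, and assembled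
in `transfer_serre_right` and `transfer_serre_left`, according to whether the third position is a
neighbour of `v` or of `u`. In all other components both sides are zero. -/

/-- An injective grading-preserving map reflects the grading. -/
theorem mem_of_injective {M N : Type} [AddCommGroup M] [AddCommGroup N] {A : ℤ → AddSubgroup M}
    {B : ℤ → AddSubgroup N} (hA : DirectSum.IsInternal A) (hB : DirectSum.IsInternal B)
    (f : M →+ N) (hf : Function.Injective f) (h : ∀ d x, x ∈ A d → f x ∈ B d) (d : ℤ) (x : M)
    (hx : f x ∈ B d) : x ∈ A d := by
  obtain ⟨π, h1, h2, h3, -⟩ := proj_of_isInternal hA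
  obtain ⟨π', -, h2', h3', -⟩ := proj_of_isInternal hB
  -- A grading-preserving map commutes with the projections. If `f x` has degree `d`, then `f x = f
  -- (π d x)`, and injectivity gives `x = π d x`.
  have key : ∀ x, π' d (f x) = f (π d x) := by
    intro x
    induction x using isInternal_induction hA with
    | h0 => simp
    | ha x y hx hy => simp [hx, hy]
    | hm e y hy =>
      by_cases hde : e = d
      · subst hde; rw [h2 _ _ hy, h2' _ _ (h _ _ hy)]
      · rw [h3 _ _ _ hy hde, h3' _ _ _ (h _ _ hy) hde, map_zero]
  have e := key x
  rw [h2' _ _ hx] at e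
  rw [hf e]
  exact h1 d x

/-- A bijective homomorphism of graded modules is an isomorphism. -/
def GrMod.isoOfBijective {M N : GrMod R 𝓡} (f : M ⟶ N) (hf : Function.Bijective f.lin) :
    M ≅ N where
  hom := f
  inv := ⟨(LinearEquiv.ofBijective f.lin hf).symm, fun d x hx =>
    mem_of_injective M.isInternal N.isInternal f.lin.toAddMonoidHom hf.1 f.map_mem d _ (by
      have : f.lin.toAddMonoidHom ((LinearEquiv.ofBijective f.lin hf).symm x) = x :=
        (LinearEquiv.ofBijective f.lin hf).apply_symm_apply x
      exact this.symm ▸ hx)⟩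
  hom_inv_id := GrMod.hom_ext fun x => (LinearEquiv.ofBijective f.lin hf).symm_apply_apply x
  inv_hom_id := GrMod.hom_ext fun x => (LinearEquiv.ofBijective f.lin hf).apply_symm_apply x

/-- A natural family of additive homogeneous isomorphisms of graded modules is an isomorphism of
functors. -/
def natIsoOfInverse {A : Type*} [Category A] {F G : A ⥤ GrMod R 𝓡}
    (φ : ∀ X, (F.obj X).carrier →+ (G.obj X).carrier) (ψ : ∀ X, (G.obj X).carrier → (F.obj X).carrier)
    (hφ : ∀ X (r : R) x, φ X (r • x) = r • φ X x)
    (hg : ∀ X d x, x ∈ (F.obj X).gr d → φ X x ∈ (G.obj X).gr d)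
    (h1 : ∀ X x, ψ X (φ X x) = x) (h2 : ∀ X x, φ X (ψ X x) = x)
    (nat : ∀ X Y (f : X ⟶ Y) x, φ Y ((F.map f).lin x) = (G.map f).lin (φ X x)) :
    F ≅ G :=
  -- `ψ` serves only to show bijectivity. Linearity, homogeneity and naturality of the inverse come
  -- for free, homogeneity by `mem_of_injective`.
  NatIso.ofComponents (fun X => GrMod.isoOfBijective
    (⟨{ φ X with map_smul' := hφ X }, hg X⟩ : GrMod.Hom _ _)
    (Function.bijective_iff_has_inverse.2 ⟨ψ X, h1 X, h2 X⟩))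
    fun {X Y} f => GrMod.hom_ext fun x => nat X Y f x

end GradedModules

/-! ### Tensor products of bimodules with modules, and their composition -/

section TensorFunctors

variable {R : Type} [Ring R] {𝓡 : ℤ → AddSubgroup R} {T : Type} [Ring T] {𝓣 : ℤ → AddSubgroup T}
  {U : Type} [Ring U] {𝓤 : ℤ → AddSubgroup U}

theorem Tens.addHom_ext {B : GrBimod R 𝓡 T 𝓣} {M : GrMod T 𝓣} {P : Type} [AddCommGroup P]
    {f g : Tens B M →+ P} (h : ∀ b x, f (Tens.mk B M b x) = g (Tens.mk B M b x)) : f = g := by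
  ext z
  induction z using Tens.induction B M with
  | h0 => simp
  | ha x y hx hy => simp [hx, hy]
  | hm b x => exact h b x

/-- The additive map out of a tensor product induced by a balanced biadditive map. -/
def Tens.lift {B : GrBimod R 𝓡 T 𝓣} {M : GrMod T 𝓣} {P : Type} [AddCommGroup P]
    (f : B.carrier →+ M.carrier →+ P)
    (hf : ∀ (b : B.carrier) (t : T) (x : M.carrier), f (MulOpposite.op t • b) x = f b (t • x)) :
    Tens B M →+ P := (tens_lift B M f hf).choose

theorem Tens.lift_mk {B : GrBimod R 𝓡 T 𝓣} {M : GrMod T 𝓣} {P : Type} [AddCommGroup P]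
    (f : B.carrier →+ M.carrier →+ P)
    (hf : ∀ (b : B.carrier) (t : T) (x : M.carrier), f (MulOpposite.op t • b) x = f b (t • x))
    (b : B.carrier) (x : M.carrier) : Tens.lift f hf (Tens.mk B M b x) = f b x :=
  (tens_lift B M f hf).choose_spec b x

/-- `Tens.mk` as a biadditive map. -/
def Tens.mkHom (B : GrBimod R 𝓡 T 𝓣) (M : GrMod T 𝓣) : B.carrier →+ M.carrier →+ Tens B M :=
  AddMonoidHom.mk' (fun b => AddMonoidHom.mk' (Tens.mk B M b) (Tens.mk_add B M b)) fun b c => by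
    ext x; exact Tens.add_mk B M b c x

theorem Tens.mkHom_apply (B : GrBimod R 𝓡 T 𝓣) (M : GrMod T 𝓣) (b : B.carrier) (x : M.carrier) :
    Tens.mkHom B M b x = Tens.mk B M b x := rfl

theorem Tens.sum_mk (B : GrBimod R 𝓡 T 𝓣) (M : GrMod T 𝓣) {ι : Type} (s : Finset ι)
    (b : ι → B.carrier) (x : M.carrier) :
    Tens.mk B M (∑ i ∈ s, b i) x = ∑ i ∈ s, Tens.mk B M (b i) x := by
  simp only [← Tens.mkHom_apply, map_sum, AddMonoidHom.finsetSum_apply]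

theorem Tens.mk_mem {B : GrBimod R 𝓡 T 𝓣} {M : GrMod T 𝓣} {i j d : ℤ} {b : B.carrier}
    {x : M.carrier} (hb : b ∈ B.gr i) (hx : x ∈ M.gr j) (h : i + j = d) :
    Tens.mk B M b x ∈ Tens.gr B M d :=
  AddSubgroup.subset_closure ⟨i, j, b, x, hb, hx, h, rfl⟩

/-- Isomorphic bimodules have isomorphic tensor product functors. -/
theorem tensor_iso_of_bimodule_iso (hT : DirectSum.IsInternal 𝓣) (B B' : GrBimod R 𝓡 T 𝓣)
    (φ : B.carrier →+ B'.carrier) (hl : ∀ (r : R) b, φ (r • b) = r • φ b)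
    (hr : ∀ (t : T) b, φ (MulOpposite.op t • b) = MulOpposite.op t • φ b)
    (hg : ∀ d b, b ∈ B.gr d → φ b ∈ B'.gr d) (hφ : Function.Bijective φ) :
    Nonempty (B.tensor hT ≅ B'.tensor hT) := by
  let F : ∀ M : GrMod T 𝓣, Tens B M →+ Tens B' M := fun M =>
    Tens.lift ((Tens.mkHom B' M).comp φ) fun b t x => by
      show Tens.mk B' M (φ _) x = Tens.mk B' M (φ _) _
      rw [hr, Tens.balanced]
  have hF : ∀ M b x, F M (Tens.mk B M b x) = Tens.mk B' M (φ b) x := fun M b x => Tens.lift_mk _ _ b x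
  let ψ : B'.carrier →+ B.carrier := (AddEquiv.ofBijective φ hφ).symm
  have h1 : ∀ b, φ (ψ b) = b := (AddEquiv.ofBijective φ hφ).apply_symm_apply
  have h2 : ∀ b, ψ (φ b) = b := (AddEquiv.ofBijective φ hφ).symm_apply_apply
  let G : ∀ M : GrMod T 𝓣, Tens B' M →+ Tens B M := fun M =>
    Tens.lift ((Tens.mkHom B M).comp ψ) fun b t x => by
      show Tens.mk B M (ψ _) x = Tens.mk B M (ψ _) _
      rw [← Tens.balanced]
      congr 1
      apply hφ.1
      rw [hr, h1, h1]
  have hG : ∀ M b x, G M (Tens.mk B' M b x) = Tens.mk B M (ψ b) x := fun M b x => Tens.lift_mk _ _ b x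
  have hs : ∀ M (r : R) z, F M (r • z) = r • F M z := by
    intro M r z
    induction z using Tens.induction B M with
    | h0 => simp
    | ha x y hx hy => rw [smul_add, map_add, hx, hy, map_add, smul_add]
    | hm b x => rw [Tens.smul_mk, hF, hF, hl, Tens.smul_mk]
  have hgr : ∀ M d z, z ∈ Tens.gr B M d → F M z ∈ Tens.gr B' M d := by
    intro M d z hz
    induction hz using AddSubgroup.closure_induction with
    | mem z hz =>
      obtain ⟨i, j, b, x, hb, hx, rfl, rfl⟩ := hz
      rw [hF]
      exact Tens.mk_mem (hg _ _ hb) hx rfl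
    | zero => rw [map_zero]; exact zero_mem _
    | add x y _ _ hx hy => rw [map_add]; exact add_mem hx hy
    | neg x _ hx => rw [map_neg]; exact neg_mem hx
  have hGF : ∀ M, (G M).comp (F M) = AddMonoidHom.id _ := fun M =>
    Tens.addHom_ext fun b x => by simp [hF, hG, h2]
  have hFG : ∀ M, (F M).comp (G M) = AddMonoidHom.id _ := fun M =>
    Tens.addHom_ext fun b x => by simp [hF, hG, h1]
  have hn : ∀ M N (f : M ⟶ N) z, F N (Tens.map B f z) = Tens.map B' f (F M z) := by
    intro M N f z
    induction z using Tens.induction B M with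
    | h0 => simp
    | ha x y hx hy => simp only [map_add, hx, hy]
    | hm b x => rw [Tens.map_mk, hF, hF, Tens.map_mk]
  exact ⟨natIsoOfInverse F (fun M => G M) hs hgr (fun M => DFunLike.congr_fun (hGF M))
    (fun M => DFunLike.congr_fun (hFG M)) hn⟩

section Double

variable {B₁ : GrBimod R 𝓡 T 𝓣} {B₂ : GrBimod T 𝓣 U 𝓤} (hU : DirectSum.IsInternal 𝓤)
  {M : GrMod U 𝓤}

/-- The class of `x ⊗ (b ⊗ n)`. -/
def Tens.mk₂ (x : B₁.carrier) (b : B₂.carrier) (n : M.carrier) : Tens B₁ (B₂.tensorObj M hU) :=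
  Tens.mk B₁ (B₂.tensorObj M hU) x (Tens.mk B₂ M b n)

theorem Tens.induction₂ {P : Tens B₁ (B₂.tensorObj M hU) → Prop} (h0 : P 0)
    (ha : ∀ x y, P x → P y → P (x + y)) (hm : ∀ x b n, P (Tens.mk₂ hU x b n)) (z) : P z := by
  have key : ∀ (x : B₁.carrier) (w : Tens B₂ M), P (Tens.mk B₁ (B₂.tensorObj M hU) x w) := by
    intro x w
    induction w using Tens.induction B₂ M with
    | h0 => exact (Tens.mk_zero B₁ (B₂.tensorObj M hU) x).symm ▸ h0
    | ha v w hv hw => exact (Tens.mk_add B₁ (B₂.tensorObj M hU) x v w).symm ▸ ha _ _ hv hw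
    | hm b n => exact hm x b n
  induction z using Tens.induction B₁ (B₂.tensorObj M hU) with
  | h0 => exact h0
  | ha x y hx hy => exact ha x y hx hy
  | hm x w => exact key x w

theorem Tens.gr_induction₂ {P : Tens B₁ (B₂.tensorObj M hU) → Prop} (d : ℤ) (h0 : P 0)
    (ha : ∀ x y, P x → P y → P (x + y)) (hneg : ∀ x, P x → P (-x))
    (hm : ∀ i j k x b n, x ∈ B₁.gr i → b ∈ B₂.gr j → n ∈ M.gr k → i + j + k = d →
      P (Tens.mk₂ hU x b n)) (z) (hz : z ∈ Tens.gr B₁ (B₂.tensorObj M hU) d) : P z := by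
  have key : ∀ (i j : ℤ) (x : B₁.carrier) (w : Tens B₂ M), x ∈ B₁.gr i → w ∈ Tens.gr B₂ M j →
      i + j = d → P (Tens.mk B₁ (B₂.tensorObj M hU) x w) := by
    intro i j x w hx hw hij
    induction hw using AddSubgroup.closure_induction with
    | mem w hw =>
      obtain ⟨k, l, b, n, hb, hn, rfl, rfl⟩ := hw
      exact hm i k l x b n hx hb hn (by omega)
    | zero => exact (Tens.mk_zero B₁ (B₂.tensorObj M hU) x).symm ▸ h0
    | add v w _ _ hv hw =>
      exact (Tens.mk_add B₁ (B₂.tensorObj M hU) x v w).symm ▸ ha _ _ hv hw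
    | neg w _ hw =>
      have e : Tens.mk B₁ (B₂.tensorObj M hU) x (-w) = -Tens.mk B₁ (B₂.tensorObj M hU) x w :=
        map_neg (Tens.mkHom B₁ (B₂.tensorObj M hU) x) w
      exact e.symm ▸ hneg _ hw
  induction hz using AddSubgroup.closure_induction with
  | mem z hz =>
    obtain ⟨i, j, x, w, hx, hw, hij, rfl⟩ := hz
    exact key i j x w hx hw hij
  | zero => exact h0
  | add x y _ _ hx hy => exact ha _ _ hx hy
  | neg x _ hx => exact hneg _ hx

theorem Tens.smul_mk₂ (r : R) (x : B₁.carrier) (b : B₂.carrier) (n : M.carrier) :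
    r • Tens.mk₂ hU x b n = Tens.mk₂ hU (r • x) b n := rfl

theorem Tens.balanced₂ (t : T) (x : B₁.carrier) (b : B₂.carrier) (n : M.carrier) :
    Tens.mk₂ hU (MulOpposite.op t • x) b n = Tens.mk₂ hU x (t • b) n :=
  Tens.balanced B₁ (B₂.tensorObj M hU) x t (Tens.mk B₂ M b n)

theorem Tens.balanced₂' (u : U) (x : B₁.carrier) (b : B₂.carrier) (n : M.carrier) :
    Tens.mk₂ hU x (MulOpposite.op u • b) n = Tens.mk₂ hU x b (u • n) :=
  congrArg (Tens.mk B₁ (B₂.tensorObj M hU) x) (Tens.balanced B₂ M b u n)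

/-- `Tens.mk₂` as an additive map. -/
def Tens.mk₂Hom (B₁ : GrBimod R 𝓡 T 𝓣) (B₂ : GrBimod T 𝓣 U 𝓤) (M : GrMod U 𝓤) :
    B₁.carrier →+ B₂.carrier →+ M.carrier →+ Tens B₁ (B₂.tensorObj M hU) :=
  AddMonoidHom.mk' (fun x => AddMonoidHom.mk' (fun b => (Tens.mkHom B₁ (B₂.tensorObj M hU) x).comp
    (Tens.mkHom B₂ M b)) fun b c => AddMonoidHom.ext fun n =>
      (congrArg (Tens.mk B₁ _ x) (Tens.add_mk B₂ M b c n)).trans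
        (Tens.mk_add B₁ (B₂.tensorObj M hU) x _ _)) fun x y => by
      ext b n
      exact Tens.add_mk B₁ (B₂.tensorObj M hU) x y _

theorem Tens.sum_mk₂ {ι : Type} (s : Finset ι) (x : ι → B₁.carrier) (b : B₂.carrier)
    (n : M.carrier) : Tens.mk₂ hU (∑ i ∈ s, x i) b n = ∑ i ∈ s, Tens.mk₂ hU (x i) b n := by
  have h : ∀ x, Tens.mk₂ hU x b n = Tens.mk₂Hom hU B₁ B₂ M x b n := fun _ => rfl
  simp only [h, map_sum, AddMonoidHom.finsetSum_apply]

theorem Tens.mk₂_sum {ι : Type} (s : Finset ι) (x : B₁.carrier) (b : ι → B₂.carrier)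
    (n : M.carrier) : Tens.mk₂ hU x (∑ i ∈ s, b i) n = ∑ i ∈ s, Tens.mk₂ hU x (b i) n := by
  have h : ∀ b, Tens.mk₂ hU x b n = Tens.mk₂Hom hU B₁ B₂ M x b n := fun _ => rfl
  simp only [h, map_sum, AddMonoidHom.finsetSum_apply]

/-- Additive maps out of a double tensor product. -/
theorem Tens.exists_lift₂ {P : Type} [AddCommGroup P]
    (f : B₁.carrier →+ B₂.carrier →+ M.carrier →+ P)
    (hT : ∀ (t : T) x b n, f (MulOpposite.op t • x) b n = f x (t • b) n)
    (hU' : ∀ (u : U) x b n, f x (MulOpposite.op u • b) n = f x b (u • n)) :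
    ∃ g : Tens B₁ (B₂.tensorObj M hU) →+ P, ∀ x b n, g (Tens.mk₂ hU x b n) = f x b n := by
  let F₀ : B₁.carrier →+ Tens B₂ M →+ P :=
    AddMonoidHom.mk' (fun x => Tens.lift (f x) fun b u n => hU' u x b n) fun x x' =>
      Tens.addHom_ext fun b n => by
        rw [AddMonoidHom.add_apply]
        refine (Tens.lift_mk _ _ b n).trans ?_
        rw [map_add]
        exact congrArg₂ (· + ·) (Tens.lift_mk (f x) _ b n).symm (Tens.lift_mk (f x') _ b n).symm
  have hF₀ : ∀ x b n, F₀ x (Tens.mk B₂ M b n) = f x b n := fun x b n =>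
    Tens.lift_mk (f x) (fun b u n => hU' u x b n) b n
  have hbal : ∀ (x : B₁.carrier) (s : T) (z : Tens B₂ M),
      F₀ (MulOpposite.op s • x) z = F₀ x (s • z) := by
    intro x s z
    induction z using Tens.induction B₂ M with
    | h0 => simp
    | ha v w hv hw => rw [smul_add, map_add, map_add, hv, hw]
    | hm b n => rw [Tens.smul_mk, hF₀, hF₀, hT]
  exact ⟨Tens.lift (M := B₂.tensorObj M hU) F₀ hbal, fun x b n =>
    (Tens.lift_mk (M := B₂.tensorObj M hU) F₀ hbal x _).trans (hF₀ x b n)⟩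

end Double

/-- If `m` is a balanced pairing of bimodules `B₁` and `B₂` with values in `B₃`, and `y` is a finite
family of elements of `B₂` with dual coordinates, then `B₁ ⊗ (B₂ ⊗ M)` is isomorphic
to `B₃ ⊗ M`. -/
theorem tensor_comp_iso (hT : DirectSum.IsInternal 𝓣) (hU : DirectSum.IsInternal 𝓤)
    (B₁ : GrBimod R 𝓡 T 𝓣) (B₂ : GrBimod T 𝓣 U 𝓤) (B₃ : GrBimod R 𝓡 U 𝓤)
    (m : B₁.carrier →+ B₂.carrier →+ B₃.carrier)
    (hl : ∀ (r : R) x y, m (r • x) y = r • m x y)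
    (hm : ∀ (t : T) x y, m (MulOpposite.op t • x) y = m x (t • y))
    (hr : ∀ (u : U) x y, m x (MulOpposite.op u • y) = MulOpposite.op u • m x y)
    (hg : ∀ i j x y, x ∈ B₁.gr i → y ∈ B₂.gr j → m x y ∈ B₃.gr (i + j))
    {ι : Type} [Fintype ι] (y : ι → B₂.carrier) (c : ι → B₃.carrier →+ B₁.carrier)
    (t : ι → B₂.carrier → T) (h1 : ∀ z, ∑ a, m (c a z) (y a) = z)
    (h2 : ∀ a x z, c a (m x z) = MulOpposite.op (t a z) • x)
    (h3 : ∀ z, ∑ a, t a z • y a = z) :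
    Nonempty (B₂.tensor hU ⋙ B₁.tensor hT ≅ B₃.tensor hU) := by
  choose F hF using fun M : GrMod U 𝓤 => Tens.exists_lift₂ (B₁ := B₁) (B₂ := B₂) hU (M := M)
    (AddMonoidHom.mk' (fun x => (Tens.mkHom B₃ M).comp (m x)) fun x x' => by
      rw [map_add, AddMonoidHom.comp_add])
    (fun t x b n => by
      show Tens.mk B₃ M (m _ _) n = Tens.mk B₃ M (m _ _) n
      rw [hm])
    (fun u x b n => by
      show Tens.mk B₃ M (m _ _) n = Tens.mk B₃ M (m _ _) _
      rw [hr, Tens.balanced])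
  replace hF : ∀ M x b n, F M (Tens.mk₂ hU x b n) = Tens.mk B₃ M (m x b) n := hF
  -- The coordinate maps `c a` are not assumed right linear. Expanding `z` by `h1`, moving `u`
  -- inside the pairing and applying `h2` shows how the right action mixes them. The mixing
  -- coefficients are the coordinates of `y b · u`, so `h3` recombines them and makes the inverse
  -- below balanced.
  have hc : ∀ a (u : U) z, c a (MulOpposite.op u • z) =
      ∑ b, MulOpposite.op (t a (MulOpposite.op u • y b)) • c b z := by
    intro a u z
    conv_lhs => rw [← h1 z, Finset.smul_sum, map_sum]
    refine Finset.sum_congr rfl fun b _ => ?_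
    rw [← hr, h2]
  -- The inverse sends `z ⊗ n` to the sum of `c a z ⊗ (y a ⊗ n)` over `a`.
  let G₀ : ∀ M : GrMod U 𝓤, B₃.carrier →+ M.carrier →+ Tens B₁ (B₂.tensorObj M hU) := fun M =>
    ∑ a, AddMonoidHom.mk' (fun z => Tens.mk₂Hom hU B₁ B₂ M (c a z) (y a)) fun z z' => by
      rw [map_add, map_add, AddMonoidHom.add_apply]
  have hG₀ : ∀ M z n, G₀ M z n = ∑ a, Tens.mk₂ hU (c a z) (y a) n := by
    intro M z n
    simp only [G₀, AddMonoidHom.finsetSum_apply]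
    rfl
  have hbal : ∀ M (z : B₃.carrier) (u : U) n, G₀ M (MulOpposite.op u • z) n = G₀ M z (u • n) := by
    intro M z u n
    simp only [hG₀, hc, Tens.sum_mk₂]
    rw [Finset.sum_comm]
    refine Finset.sum_congr rfl fun b _ => ?_
    simp only [Tens.balanced₂]
    rw [← Tens.mk₂_sum, h3, Tens.balanced₂']
  let G : ∀ M : GrMod U 𝓤, Tens B₃ M →+ Tens B₁ (B₂.tensorObj M hU) := fun M =>
    Tens.lift (G₀ M) (hbal M)
  have hG : ∀ M z n, G M (Tens.mk B₃ M z n) = ∑ a, Tens.mk₂ hU (c a z) (y a) n := fun M z n =>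
    (Tens.lift_mk _ _ z n).trans (hG₀ M z n)
  have hs : ∀ M (r : R) z, F M (r • z) = r • F M z := by
    intro M r z
    induction z using Tens.induction₂ with
    | h0 => simp
    | ha x y hx hy => rw [smul_add, map_add, hx, hy, map_add, smul_add]
    | hm x b n => rw [Tens.smul_mk₂, hF, hF, hl, Tens.smul_mk]
  have hgr : ∀ M d z, z ∈ Tens.gr B₁ (B₂.tensorObj M hU) d → F M z ∈ Tens.gr B₃ M d := by
    intro M d z hz
    refine Tens.gr_induction₂ hU (P := fun z => F M z ∈ Tens.gr B₃ M d) d ?_ ?_ ?_ ?_ z hz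
    · show F M _ ∈ _; rw [map_zero]; exact zero_mem _
    · intro x y hx hy; show F M _ ∈ _; rw [map_add]; exact add_mem hx hy
    · intro x hx; show F M _ ∈ _; rw [map_neg]; exact neg_mem hx
    · intro i j k x b n hx hb hn h
      show F M _ ∈ _
      rw [hF]
      exact Tens.mk_mem (hg _ _ _ _ hx hb) hn h
  have hGF : ∀ M z, G M (F M z) = z := by
    intro M z
    induction z using Tens.induction₂ with
    | h0 => simp
    | ha x y hx hy => rw [map_add, map_add, hx, hy]
    | hm x b n =>
      rw [hF, hG]
      simp only [h2, Tens.balanced₂]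
      rw [← Tens.mk₂_sum, h3]
  have hFG : ∀ M z, F M (G M z) = z := by
    intro M z
    induction z using Tens.induction B₃ M with
    | h0 => simp
    | ha x y hx hy => rw [map_add, map_add, hx, hy]
    | hm b x =>
      rw [hG, map_sum]
      simp only [hF]
      rw [← Tens.sum_mk, h1]
  have hn : ∀ M N (f : M ⟶ N) z, F N (Tens.map B₁ (M := B₂.tensorObj M hU)
      (N := B₂.tensorObj N hU) ((B₂.tensor hU).map f) z) = Tens.map B₃ f (F M z) := by
    intro M N f z
    induction z using Tens.induction₂ with
    | h0 => simp
    | ha x y hx hy => rw [map_add, map_add, hx, hy, map_add, map_add]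
    | hm x b n =>
      rw [hF, Tens.map_mk]
      exact hF N x b _
  exact ⟨natIsoOfInverse F (fun M => G M) hs hgr hGF hFG hn⟩

end TensorFunctors

/-! ### Bimodules that are free on two central generators -/

section Split

variable {R : Type} [Ring R] {𝓡 : ℤ → AddSubgroup R}

/-- The functor `M ↦ M{1} ⊕ M{-1}`. -/
def shiftSum (R : Type) [Ring R] (𝓡 : ℤ → AddSubgroup R) : GrMod R 𝓡 ⥤ GrMod R 𝓡 where
  obj M := (M.shift 1).sum (M.shift (-1))
  map f := ⟨f.lin.prodMap f.lin, fun d _ hx => ⟨f.map_mem (d - 1) _ hx.1, f.map_mem (d - -1) _ hx.2⟩⟩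

/-- If a bimodule is free on two central elements of degrees `1` and `-1`, then the tensor product
with it is the sum of two shifts. -/
theorem tensor_iso_shiftSum (hR : DirectSum.IsInternal 𝓡) (B : GrBimod R 𝓡 R 𝓡)
    (e₁ e₀ : B.carrier) (hc₁ : ∀ r : R, MulOpposite.op r • e₁ = r • e₁)
    (hc₀ : ∀ r : R, MulOpposite.op r • e₀ = r • e₀) (hg₁ : e₁ ∈ B.gr 1) (hg₀ : e₀ ∈ B.gr (-1))
    (hb : Function.Bijective fun p : R × R => p.1 • e₁ + p.2 • e₀) :
    Nonempty (B.tensor hR ≅ shiftSum R 𝓡) := by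
  let s : B.carrier → R × R := (Equiv.ofBijective _ hb).symm
  have hs : ∀ b, (s b).1 • e₁ + (s b).2 • e₀ = b := (Equiv.ofBijective _ hb).apply_symm_apply
  have hs' : ∀ p q : R, s (p • e₁ + q • e₀) = (p, q) := fun p q =>
    (Equiv.ofBijective _ hb).symm_apply_apply (p, q)
  have hadd : ∀ b c, s (b + c) = s b + s c := by
    intro b c
    conv_lhs => rw [← hs b, ← hs c, add_add_add_comm, ← add_smul, ← add_smul, hs']
    rfl
  -- Since `e₁` and `e₀` are central, the left coordinates are also right linear. This makes the
  -- inverse map `b ⊗ n ↦ (s b) • n` balanced.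
  have hmul : ∀ (b : B.carrier) (t : R), s (MulOpposite.op t • b) = ((s b).1 * t, (s b).2 * t) := by
    intro b t
    conv_lhs => rw [← hs b, smul_add, ← smul_comm (_ : R), ← smul_comm (_ : R), hc₁, hc₀, smul_smul, smul_smul, hs']
  -- The degrees 1 and -1 of `e₁` and `e₀` are exactly the two shifts: `x` of degree `d - 1` goes to
  -- `e₁ ⊗ x` of degree `d`, and `y` of degree `d + 1` to `e₀ ⊗ y`.
  let φ : ∀ M : GrMod R 𝓡, M.carrier × M.carrier →+ Tens B M := fun M =>
    (Tens.mkHom B M e₁).coprod (Tens.mkHom B M e₀)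
  have hφ : ∀ M x, φ M x = Tens.mk B M e₁ x.1 + Tens.mk B M e₀ x.2 := fun M x => rfl
  let ψ : ∀ M : GrMod R 𝓡, Tens B M →+ M.carrier × M.carrier := fun M =>
    Tens.lift (AddMonoidHom.mk' (fun b => AddMonoidHom.mk' (fun n => ((s b).1 • n, (s b).2 • n))
      fun x y => by simp) fun b c => by
        ext n <;> simp [hadd, add_smul]) fun b t x => by
          simp [hmul, mul_smul]
  have hψ : ∀ M b n, ψ M (Tens.mk B M b n) = ((s b).1 • n, (s b).2 • n) := fun M b n =>
    Tens.lift_mk _ _ b n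
  have hsm : ∀ M (r : R) (x : M.carrier × M.carrier), φ M (r • x) = r • φ M x := by
    intro M r x
    rw [hφ, hφ, smul_add, Tens.smul_mk, Tens.smul_mk, ← hc₁, ← hc₀, Tens.balanced, Tens.balanced]
    rfl
  have hgr : ∀ M d x, x ∈ ((M.shift 1).sum (M.shift (-1))).gr d → φ M x ∈ Tens.gr B M d := by
    intro M d x hx
    exact add_mem (Tens.mk_mem hg₁ hx.1 (by ring)) (Tens.mk_mem hg₀ hx.2 (by ring))
  have hψφ : ∀ M x, ψ M (φ M x) = x := by
    intro M x
    rw [hφ, map_add, hψ, hψ]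
    have e1 : s e₁ = (1, 0) := by rw [← hs' 1 0]; simp
    have e0 : s e₀ = (0, 1) := by rw [← hs' 0 1]; simp
    rw [e1, e0]
    simp
  have hφψ : ∀ M z, φ M (ψ M z) = z := by
    intro M z
    induction z using Tens.induction B M with
    | h0 => simp
    | ha x y hx hy => rw [map_add, map_add, hx, hy]
    | hm b n =>
      rw [hψ, hφ]
      show Tens.mk B M e₁ ((s b).1 • n) + Tens.mk B M e₀ ((s b).2 • n) = _
      rw [← Tens.balanced, ← Tens.balanced, ← Tens.add_mk, hc₁, hc₀, hs]
  have hn : ∀ (M N : GrMod R 𝓡) (f : M ⟶ N) (x : M.carrier × M.carrier),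
      φ N (f.lin x.1, f.lin x.2) = Tens.map B f (φ M x) := by
    intro M N f x
    rw [hφ, hφ, map_add, Tens.map_mk, Tens.map_mk]
  exact ⟨(natIsoOfInverse (F := shiftSum R 𝓡) (G := B.tensor hR) (fun M => φ M) (fun M => ψ M)
    hsm hgr hψφ hφψ hn).symm⟩

end Split

/-! ### Unit elements as identifications, and contractions without splitting -/

section Units

variable {n : ℕ} {S S' T T' : Finset (Fin n)}

/-- Matchings that arise in two ways, such as `g₁ (g₂ a)` and `g₃ a`, are only propositionally
equal. Multiplication by the element `1` of the mixed group plays the role of a cast between the two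
groups, with the advantage that it can be moved by associativity. The lemma says that casting there
and back is the identity. -/
theorem FF.mul_one_one {b a a' : CM S} (h : a = a') (z : FF b a) :
    FF.mul b a' a (FF.mul b a a' z 1) 1 = z := by
  subst h
  rw [FF.mul_one, FF.mul_one]

theorem FF.one_one {b b' : CM S} (h : b = b') (a : CM S) (z : FF b a) :
    FF.mul b b' a 1 (FF.mul b' b a 1 z) = z := by
  subst h
  rw [FF.one_mul, FF.one_mul]

theorem FF.one_mem_numCirc (b a : CM S) :
    (1 : FF b a) ∈ tqDeg S b.perm a.perm (-(numCirc S b.perm a.perm : ℤ)) := by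
  refine mem_tqDeg.2 ⟨1, fun s hs => ?_, map_one _⟩
  have : s = 0 := by
    have h := MvPolynomial.support_monomial_subset (s := (0 : Fin n →₀ ℕ)) (a := (1 : ℤ)) hs
    simpa using h
  simp [this]

theorem FF.one_mem_of_eq {b a : CM S} (h : b = a) :
    (1 : FF b a) ∈ tqDeg S b.perm a.perm (-(S.card / 2 : ℕ)) := by
  subst h
  exact FF.one_mem b

theorem Flat.onF_X (f : Flat S T) (b a : CM S) {p : Fin n} (hp : p ∈ S) :
    f.onF b a (FF.mk b a (MvPolynomial.X p)) = FF.mk _ _ (MvPolynomial.X (f.shift p)) := by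
  rw [f.onF_mk]
  simp [Flat.onVar, hp]

/-- Ring homomorphisms out of `𝓕(W(b)a)` are determined by the images of the variables. -/
theorem FF.ringHom_ext {b a : CM S} {A : Type} [CommRing A] {φ ψ : FF b a →+* A}
    (h : ∀ p ∈ S, φ (FF.mk b a (MvPolynomial.X p)) = ψ (FF.mk b a (MvPolynomial.X p))) : φ = ψ := by
  refine Ideal.Quotient.ringHom_ext (MvPolynomial.ringHom_ext (fun z => by simp) fun p => ?_)
  by_cases hp : p ∈ S
  · exact h p hp
  · have : FF.mk b a (MvPolynomial.X p) = 0 := cls_X_not_mem _ _ hp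
    show φ (FF.mk b a _) = ψ (FF.mk b a _)
    rw [this, map_zero, map_zero]

theorem Flat.idTangle_onF (b a : CM S) (z : FF b a) : (Flat.idTangle S).onF b a z = z := by
  have : (Flat.idTangle S).onF b a = RingHom.id (FF b a) :=
    FF.ringHom_ext fun p hp => (Flat.idTangle S).onF_X b a hp
  exact DFunLike.congr_fun this z

/-- When all saddles merge circles, the cobordism map involves no comultiplication and is the
product of representatives. -/
theorem FF.mul_of_contr {c b a : CM S} (h : contr c.perm b.perm a.perm = 1)
    (f g : MvPolynomial (Fin n) ℤ) :
    FF.mul c b a (FF.mk c b f) (FF.mk b a g) = FF.mk c a (f * g) := by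
  rw [FF.mul_mk, h, _root_.mul_one]

/-- The number of splitting saddles is determined by the numbers of circles before and after
(`splits_count`). The hypothesis is the case in which this number is zero, so the cobordism can be
recognized as split-free by counting alone. -/
theorem contr_eq_one {c b a : CM S}
    (h : numCirc S c.perm b.perm + numCirc S b.perm a.perm = numCirc S c.perm a.perm + S.card / 2) :
    contr c.perm b.perm a.perm = 1 := by
  have h' := splits_count c b a
  have : (splitArcs c.perm b.perm a.perm).length = 0 := by omega
  rw [contr, List.length_eq_zero_iff.1 this]
  rfl

/-- The unit elements intertwine the actions of the arc ring by way of `g₁ g₂` and of `g₃`. -/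
theorem Flat.link (g₁ : Flat S T) (g₂ : Flat S' S) (g₃ : Flat S' T) (a a' : CM S')
    (h₁ : contr (g₁.onMatch (g₂.onMatch a)).perm (g₁.onMatch (g₂.onMatch a')).perm
      (g₃.onMatch a').perm = 1)
    (h₂ : contr (g₁.onMatch (g₂.onMatch a)).perm (g₃.onMatch a).perm (g₃.onMatch a').perm = 1)
    (h₃ : ∀ p ∈ S', circ (g₁.onMatch (g₂.onMatch a)).perm (g₃.onMatch a').perm
      (g₁.shift (g₂.shift p)) (g₃.shift p)) (t : FF a a') :
    FF.mul _ _ (g₃.onMatch a') (g₁.onF _ _ (g₂.onF a a' t)) 1 =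
      FF.mul (g₁.onMatch (g₂.onMatch a)) _ _ 1 (g₃.onF a a' t) := by
  obtain ⟨q, rfl⟩ := cls_surjective _ _ t
  rw [g₂.onF_mk, g₁.onF_mk, g₃.onF_mk, ← map_one (FF.mk _ _), ← map_one (FF.mk _ _),
    FF.mul_of_contr h₁, FF.mul_of_contr h₂, one_mul, mul_one]
  let φ : MvPolynomial (Fin n) ℤ →+* FF (g₁.onMatch (g₂.onMatch a)) (g₃.onMatch a') :=
    (FF.mk _ _).comp ((MvPolynomial.aeval g₁.onVar : MvPolynomial (Fin n) ℤ →ₐ[ℤ] _).toRingHom.comp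
      (MvPolynomial.aeval g₂.onVar : MvPolynomial (Fin n) ℤ →ₐ[ℤ] _).toRingHom)
  let ψ : MvPolynomial (Fin n) ℤ →+* FF (g₁.onMatch (g₂.onMatch a)) (g₃.onMatch a') :=
    (FF.mk _ _).comp (MvPolynomial.aeval g₃.onVar : MvPolynomial (Fin n) ℤ →ₐ[ℤ] _).toRingHom
  -- After the two contractions have become products, each side substitutes for `x_p` the variable
  -- of an end point of the same strand, once through `g₁ g₂` and once through `g₃`. By `h₃` these
  -- end points lie on one circle, so the variables agree.
  have : φ = ψ := by
    refine MvPolynomial.ringHom_ext (fun z => by simp) fun p => ?_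
    by_cases hp : p ∈ S'
    · have h : φ (MvPolynomial.X p) = FF.mk _ _ (MvPolynomial.X (g₁.shift (g₂.shift p))) := by
        simp [φ, Flat.onVar, hp, g₂.shift_mem hp]
      have h' : ψ (MvPolynomial.X p) = FF.mk _ _ (MvPolynomial.X (g₃.shift p)) := by
        simp [ψ, Flat.onVar, hp]
      rw [h, h']
      exact cls_X_eq _ _ _ _ (h₃ p hp)
    · simp [φ, ψ, Flat.onVar, hp]
  exact DFunLike.congr_fun this q

/-- If `g₁ g₂` equals `g₃` on the nose, then in each of the two contractions the contracted matching
coincides with one of its neighbours, and such a contraction only merges circles. -/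
theorem Flat.link_of_eq (g₁ : Flat S T) (g₂ : Flat S' S) (g₃ : Flat S' T)
    (h : ∀ a, g₁.onMatch (g₂.onMatch a) = g₃.onMatch a)
    (h' : ∀ p ∈ S', g₁.shift (g₂.shift p) = g₃.shift p) (a a' : CM S') (t : FF a a') :
    FF.mul _ _ (g₃.onMatch a') (g₁.onF _ _ (g₂.onF a a' t)) 1 =
      FF.mul (g₁.onMatch (g₂.onMatch a)) _ _ 1 (g₃.onF a a' t) := by
  refine g₁.link g₂ g₃ a a' ?_ ?_ (fun p hp => by rw [h' p hp]) t
  · rw [h a']; exact contr_right_unit _ _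
  · rw [h a]; exact contr_left_unit _ _

/-- The same intertwining with the unit on the other side. It follows from `Flat.link_of_eq` because
the unit elements are invertible. -/
theorem Flat.link_of_eq' (g₁ : Flat S T) (g₂ : Flat S' S) (g₃ : Flat S' T)
    (h : ∀ a, g₁.onMatch (g₂.onMatch a) = g₃.onMatch a)
    (h' : ∀ p ∈ S', g₁.shift (g₂.shift p) = g₃.shift p) (a a' : CM S') (t : FF a a') :
    FF.mul (g₃.onMatch a) _ _ 1 (g₁.onF _ _ (g₂.onF a a' t)) =
      FF.mul _ _ (g₁.onMatch (g₂.onMatch a')) (g₃.onF a a' t) 1 := by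
  have := g₁.link_of_eq g₂ g₃ h h' a a' t
  have e : g₁.onF _ _ (g₂.onF a a' t) = FF.mul _ (g₃.onMatch a') _
    (FF.mul (g₁.onMatch (g₂.onMatch a)) (g₃.onMatch a) _ 1 (g₃.onF a a' t)) 1 := by
    rw [← this, FF.mul_one_one (h a')]
  rw [e, FF.mul_assoc, FF.one_one (h a).symm]

end Units

/-! ### The bimodule structure in matrix entries -/

section Actions

variable {n : ℕ} {S S' T : Finset (Fin n)} (f : Flat S T) (g : Flat S' T)

theorem Bim.smul_apply (x : H S) (z : Bim f g) (c : CM S) (a : CM S') :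
    (x • z) c a = ∑ b, FF.mul _ _ _ (f.onF c b (x c b)) (z b a) := rfl

theorem Bim.op_smul_apply (x : H S') (z : Bim f g) (c : CM S) (a : CM S') :
    (MulOpposite.op x • z) c a = ∑ b, FF.mul _ _ _ (z c b) (g.onF b a (x b a)) := rfl

theorem Bim.add_apply (y z : Bim f g) (c : CM S) (a : CM S') : (y + z) c a = y c a + z c a := rfl

theorem Bim.sum_apply {ι : Type} (s : Finset ι) (z : ι → Bim f g) (c : CM S) (a : CM S') :
    (∑ i ∈ s, z i) c a = ∑ i ∈ s, z i c a := by
  let ev : Bim f g →+ FF (f.onMatch c) (g.onMatch a) :=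
    AddMonoidHom.mk' (fun z => z c a) fun _ _ => rfl
  exact map_sum ev z s

end Actions

/-! ### Composition of flat tangles as tensor product of bimodules -/

section Composition

variable {n : ℕ} {S₀ S S' T : Finset (Fin n)}

/-- The pairing of the bimodules of `f^* g₁` and of `g₂` with values in the bimodule of `f^* g₃`,
where `g₃ = g₁ g₂`. -/
def Bim.pair (f : Flat S₀ T) (g₁ : Flat S T) (g₂ : Flat S' S) (g₃ : Flat S' T) :
    Bim f g₁ →+ Bim (Flat.idTangle S) g₂ →+ Bim f g₃ :=
  AddMonoidHom.mk' (fun x => AddMonoidHom.mk' (fun y b a => ∑ c : CM S,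
      FF.mul (f.onMatch b) (g₁.onMatch c) (g₃.onMatch a) (x b c)
        (FF.mul (g₁.onMatch c) (g₁.onMatch (g₂.onMatch a)) (g₃.onMatch a)
          (g₁.onF c (g₂.onMatch a) (y c a)) 1)) fun y y' => by
      funext b a
      refine Eq.trans (Finset.sum_congr rfl fun c _ => ?_) Finset.sum_add_distrib
      have : g₁.onF c (g₂.onMatch a) ((y + y') c a) =
        g₁.onF c (g₂.onMatch a) (y c a) + g₁.onF c (g₂.onMatch a) (y' c a) := map_add _ _ _
      rw [this, map_add, AddMonoidHom.add_apply, map_add]) fun x x' => by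
      ext y
      funext b a
      refine Eq.trans (Finset.sum_congr rfl fun c _ => ?_) Finset.sum_add_distrib
      rw [Bim.add_apply, map_add, AddMonoidHom.add_apply]

theorem Bim.pair_apply (f : Flat S₀ T) (g₁ : Flat S T) (g₂ : Flat S' S) (g₃ : Flat S' T)
    (x : Bim f g₁) (y : Bim (Flat.idTangle S) g₂) (b : CM S₀) (a : CM S') :
    Bim.pair f g₁ g₂ g₃ x y b a = ∑ c : CM S,
      FF.mul (f.onMatch b) (g₁.onMatch c) (g₃.onMatch a) (x b c)
        (FF.mul (g₁.onMatch c) (g₁.onMatch (g₂.onMatch a)) (g₃.onMatch a)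
          (g₁.onF c (g₂.onMatch a) (y c a)) 1) := rfl

theorem Bim.id_smul_apply (g : Flat S' S) (x : H S) (z : Bim (Flat.idTangle S) g) (c : CM S)
    (a : CM S') :
    (x • z) c a = ∑ b : CM S, FF.mul c b (g.onMatch a) (x c b) (z b a) := by
  rw [Bim.smul_apply]
  refine Finset.sum_congr rfl fun b _ => ?_
  rw [Flat.idTangle_onF]
  rfl

variable (f : Flat S₀ T) (g₁ : Flat S T) (g₂ : Flat S' S) (g₃ : Flat S' T)

theorem Bim.pair_smul (r : H S₀) (x : Bim f g₁) (y : Bim (Flat.idTangle S) g₂) :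
    Bim.pair f g₁ g₂ g₃ (r • x) y = r • Bim.pair f g₁ g₂ g₃ x y := by
  funext b a
  simp only [Bim.pair_apply, Bim.smul_apply, map_sum, AddMonoidHom.finsetSum_apply, FF.mul_assoc]
  rw [Finset.sum_comm]

/-- The ring `H S` acts on `Bim f g₁` from the right through gluing with `g₁`, and the pairing
applies the same gluing to the entries of `y`. Balancedness is therefore multiplicativity of gluing
(`Flat.onF_mul`) together with associativity. -/
theorem Bim.pair_balanced (s : H S) (x : Bim f g₁) (y : Bim (Flat.idTangle S) g₂) :
    Bim.pair f g₁ g₂ g₃ (MulOpposite.op s • x) y = Bim.pair f g₁ g₂ g₃ x (s • y) := by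
  funext b a
  simp only [Bim.pair_apply, Bim.op_smul_apply, AddMonoidHom.finsetSum_apply, map_sum,
    FF.mul_assoc]
  rw [Finset.sum_comm]
  refine Finset.sum_congr rfl fun c _ => ?_
  have e : g₁.onF c (g₂.onMatch a) ((s • y) c a) = ∑ d : CM S, FF.mul _ _ _ (g₁.onF c d (s c d))
      (g₁.onF d (g₂.onMatch a) (y d a)) := by
    rw [Bim.id_smul_apply]
    refine (map_sum (g₁.onF c (g₂.onMatch a)) _ _).trans (Finset.sum_congr rfl fun d _ => ?_)
    exact g₁.onF_mul _ _ _ _ _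
  rw [e, map_sum, AddMonoidHom.finsetSum_apply, map_sum]
  refine Finset.sum_congr rfl fun d _ => ?_
  rw [FF.mul_assoc]

/-- On the left, `u` acts through `g₂` and then `g₁`; on the right it acts through `g₃`. The
identifying unit at the end of the pairing is carried past the action by `Flat.link_of_eq`. -/
theorem Bim.pair_op_smul (h : ∀ a, g₁.onMatch (g₂.onMatch a) = g₃.onMatch a)
    (h' : ∀ p ∈ S', g₁.shift (g₂.shift p) = g₃.shift p) (u : H S') (x : Bim f g₁)
    (y : Bim (Flat.idTangle S) g₂) :
    Bim.pair f g₁ g₂ g₃ x (MulOpposite.op u • y) =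
      MulOpposite.op u • Bim.pair f g₁ g₂ g₃ x y := by
  funext b a
  simp only [Bim.pair_apply, Bim.op_smul_apply, AddMonoidHom.finsetSum_apply, map_sum]
  rw [Finset.sum_comm]
  refine Finset.sum_congr rfl fun c _ => ?_
  have e (w : CM S' → FF c (g₂.onMatch a)) : g₁.onF c (g₂.onMatch a) (∑ a', w a') =
    ∑ a', g₁.onF c (g₂.onMatch a) (w a') := map_sum _ _ _
  refine (congrArg (fun z => FF.mul (f.onMatch b) (g₁.onMatch c) (g₃.onMatch a) (x b c)
    (FF.mul _ _ (g₃.onMatch a) z 1)) (e _)).trans ?_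
  simp only [AddMonoidHom.finsetSum_apply, map_sum]
  refine Finset.sum_congr rfl fun a' _ => ?_
  have e := g₁.onF_mul c (g₂.onMatch a') (g₂.onMatch a) (y c a') (g₂.onF a' a (u a' a))
  rw [FF.mul_assoc, FF.mul_assoc, ← g₁.link_of_eq g₂ g₃ h h', ← FF.mul_assoc (g₁.onMatch c)]
  exact congrArg _ (DFunLike.congr_fun (congrArg _ e) _)

/-- All shifts cancel. Gluing `g₁` trades the normalization |S|/2 for |T|/2, the unit has degree
-|T|/2, and each of the two contractions over `T` raises the degree by |T|/2. -/
theorem Bim.pair_mem (h : ∀ a, g₁.onMatch (g₂.onMatch a) = g₃.onMatch a) (i j : ℤ) (x : Bim f g₁)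
    (y : Bim (Flat.idTangle S) g₂) (hx : x ∈ (bimodule f g₁).gr i)
    (hy : y ∈ (bimodule (Flat.idTangle S) g₂).gr j) :
    Bim.pair f g₁ g₂ g₃ x y ∈ (bimodule f g₃).gr (i + j) := by
  refine mem_mDeg.2 fun b a => ?_
  refine sum_mem fun c _ => ?_
  have hx' := mem_mDeg.1 hx b c
  have hy' := mem_mDeg.1 hy c a
  have e1 := g₁.onF_mem c (g₂.onMatch a) (j - (S'.card / 2 : ℕ) + (S.card / 2 : ℕ)) (y c a) (by
    rw [add_sub_cancel_right]; exact hy')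
  have e2 := FF.mul_mem hx' (FF.mul_mem e1 (FF.one_mem_of_eq (h a)))
  have e3 : i - (S.card / 2 : ℕ) + (j - (S'.card / 2 : ℕ) + (S.card / 2 : ℕ) - (T.card / 2 : ℕ) +
      -(T.card / 2 : ℕ) + (T.card / 2 : ℕ)) + (T.card / 2 : ℕ) = i + j - (S'.card / 2 : ℕ) := by
    ring
  rwa [e3] at e2

/-- The generators of the left projective module `𝓕(g)`. -/
def Bim.gen (g : Flat S' S) (a : CM S') : Bim (Flat.idTangle S) g := fun c a' =>
  if c = g.onMatch a ∧ a' = a then (1 : FF c (g.onMatch a')) else 0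

/-- The coordinates with respect to the generators `Bim.gen`. -/
def Bim.coeff (g : Flat S' S) (a : CM S') (z : Bim (Flat.idTangle S) g) : H S := fun b c =>
  if c = g.onMatch a then FF.mul b (g.onMatch a) c (z b a) 1 else 0

/-- The columns of a matrix in the bimodule of `f^* g₁ g₂`. -/
def Bim.col (a : CM S') : Bim f g₃ →+ Bim f g₁ :=
  AddMonoidHom.mk' (fun z b c =>
    if c = g₂.onMatch a then FF.mul (f.onMatch b) (g₃.onMatch a) (g₁.onMatch c) (z b a) 1 else 0)
    fun z z' => by
      funext b c
      refine Eq.trans ?_ (Bim.add_apply f g₁ _ _ b c).symm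
      by_cases hc : c = g₂.onMatch a
      · simp only [hc, if_true, Bim.add_apply, map_add, AddMonoidHom.add_apply]
      · simp only [hc, if_false, add_zero]

variable {f g₁ g₂ g₃}

theorem Bim.gen_self (a : CM S') : Bim.gen g₂ a (g₂.onMatch a) a =
    (1 : FF (g₂.onMatch a) (g₂.onMatch a)) := if_pos ⟨rfl, rfl⟩

theorem Bim.gen_of_ne {a a' : CM S'} {c : CM S} (h : ¬ (c = g₂.onMatch a ∧ a' = a)) :
    Bim.gen g₂ a c a' = 0 := if_neg h

theorem Bim.coeff_self (a : CM S') (z : Bim (Flat.idTangle S) g₂) (b : CM S) :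
    Bim.coeff g₂ a z b (g₂.onMatch a) = z b a :=
  (if_pos rfl).trans (FF.mul_one b (g₂.onMatch a) (z b a))

theorem Bim.coeff_of_ne {a : CM S'} (z : Bim (Flat.idTangle S) g₂) (b : CM S) {c : CM S}
    (h : c ≠ g₂.onMatch a) : Bim.coeff g₂ a z b c = 0 := if_neg h

theorem Bim.col_self (a : CM S') (z : Bim f g₃) (b : CM S₀) :
    Bim.col f g₁ g₂ g₃ a z b (g₂.onMatch a) =
      FF.mul (f.onMatch b) (g₃.onMatch a) (g₁.onMatch (g₂.onMatch a)) (z b a) 1 := if_pos rfl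

theorem Bim.col_of_ne {a : CM S'} (z : Bim f g₃) (b : CM S₀) {c : CM S}
    (h : c ≠ g₂.onMatch a) : Bim.col f g₁ g₂ g₃ a z b c = 0 := if_neg h

/-- The dual basis property of 𝓕(g₂) as a left module. Its column with index `a` is the projective
module of all entries 𝓕(W(b) g₂ a), generated by the single entry `1` in the row `g₂ a`. -/
theorem Bim.sum_coeff_smul_gen (z : Bim (Flat.idTangle S) g₂) :
    ∑ a, Bim.coeff g₂ a z • Bim.gen g₂ a = z := by
  funext b a
  rw [Bim.sum_apply, Finset.sum_eq_single a, Bim.id_smul_apply,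
    Finset.sum_eq_single (g₂.onMatch a)]
  · rw [Bim.coeff_self, Bim.gen_self]
    exact FF.mul_one b (g₂.onMatch a) (z b a)
  · intro c' _ hc'
    rw [Bim.coeff_of_ne _ _ hc']
    exact DFunLike.congr_fun (map_zero (FF.mul b c' (g₂.onMatch a))) _
  · simp
  · intro a' _ ha'
    rw [Bim.id_smul_apply]
    refine Finset.sum_eq_zero fun c' _ => ?_
    rw [Bim.gen_of_ne fun h => ha' h.2.symm]
    exact map_zero _
  · simp

/-- The column `a` of the pairing depends on `z` only through its column `a`, and that column is
recorded by `Bim.coeff`. The unit in `Bim.pair` and the one in `Bim.col` undo each other. -/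
theorem Bim.col_pair (h : ∀ a, g₁.onMatch (g₂.onMatch a) = g₃.onMatch a) (a : CM S')
    (x : Bim f g₁) (z : Bim (Flat.idTangle S) g₂) :
    Bim.col f g₁ g₂ g₃ a (Bim.pair f g₁ g₂ g₃ x z) =
      MulOpposite.op (Bim.coeff g₂ a z) • x := by
  funext b c'
  rw [Bim.op_smul_apply]
  by_cases hc' : c' = g₂.onMatch a
  · subst hc'
    rw [Bim.col_self, Bim.pair_apply, map_sum, AddMonoidHom.finsetSum_apply]
    refine Finset.sum_congr rfl fun d _ => ?_
    rw [Bim.coeff_self, FF.mul_assoc, FF.mul_one_one (h a)]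
  · rw [Bim.col_of_ne _ _ hc']
    refine (Finset.sum_eq_zero fun d _ => ?_).symm
    rw [Bim.coeff_of_ne _ _ hc', map_zero, map_zero]

/-- A matrix is the sum of its columns, and pairing with `Bim.gen g₂ a` puts the column extracted by
`Bim.col` back into position `a`. This is the surjectivity half of the composition isomorphism. -/
theorem Bim.sum_pair_col_gen (h : ∀ a, g₁.onMatch (g₂.onMatch a) = g₃.onMatch a) (z : Bim f g₃) :
    ∑ a, Bim.pair f g₁ g₂ g₃ (Bim.col f g₁ g₂ g₃ a z) (Bim.gen g₂ a) = z := by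
  funext b a
  rw [Bim.sum_apply, Finset.sum_eq_single a, Bim.pair_apply, Finset.sum_eq_single (g₂.onMatch a)]
  · have e : g₁.onF (g₂.onMatch a) (g₂.onMatch a) (Bim.gen g₂ a (g₂.onMatch a) a) = 1 := by
      rw [Bim.gen_self, map_one]
    rw [Bim.col_self, e, FF.one_mul, FF.mul_one_one (h a).symm]
  · intro c' _ hc'
    rw [Bim.col_of_ne _ _ hc', map_zero, AddMonoidHom.zero_apply]
  · simp
  · intro a' _ ha'
    rw [Bim.pair_apply]
    refine Finset.sum_eq_zero fun c' _ => ?_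
    have e : g₁.onF c' (g₂.onMatch a) (Bim.gen g₂ a' c' a) = 0 := by
      rw [Bim.gen_of_ne fun h => ha' h.2.symm]; exact map_zero _
    rw [e, map_zero, AddMonoidHom.zero_apply, map_zero]
  · simp

/-- The composition of the functors of `f^* g₁` and of `g₂` is the functor of `f^* g₁ g₂`. -/
theorem bimodule_comp_iso (f : Flat S₀ T) (g₁ : Flat S T) (g₂ : Flat S' S) (g₃ : Flat S' T)
    (h : ∀ a, g₁.onMatch (g₂.onMatch a) = g₃.onMatch a)
    (h' : ∀ p ∈ S', g₁.shift (g₂.shift p) = g₃.shift p) :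
    Nonempty ((bimodule (Flat.idTangle S) g₂).tensor (Hgr_isInternal _) ⋙
      (bimodule f g₁).tensor (Hgr_isInternal _) ≅ (bimodule f g₃).tensor (Hgr_isInternal _)) :=
  tensor_comp_iso (Hgr_isInternal _) (Hgr_isInternal _) (bimodule f g₁)
    (bimodule (Flat.idTangle S) g₂) (bimodule f g₃) (Bim.pair f g₁ g₂ g₃)
    (Bim.pair_smul f g₁ g₂ g₃) (Bim.pair_balanced f g₁ g₂ g₃) (Bim.pair_op_smul f g₁ g₂ g₃ h h')
    (Bim.pair_mem f g₁ g₂ g₃ h) (Bim.gen g₂) (Bim.col f g₁ g₂ g₃) (Bim.coeff g₂)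
    (Bim.sum_pair_col_gen h) (Bim.col_pair h) Bim.sum_coeff_smul_gen

end Composition

/-! ### Planar isotopies of flat tangles -/

section Reparametrization

variable {n : ℕ} {S S' T T' : Finset (Fin n)}

/-- The ring homomorphism out of `𝓕(W(b)a)` with prescribed values on the variables. -/
def FF.lift {b a : CM S} {A : Type} [CommRing A] (x : Fin n → A) (h0 : ∀ p, x p ^ 2 = 0)
    (h1 : ∀ p ∉ S, x p = 0) (hb : ∀ p, x p = x (b.perm p)) (ha : ∀ p, x p = x (a.perm p)) :
    FF b a →+* A :=
  Ideal.Quotient.lift _ (MvPolynomial.eval₂Hom (Int.castRingHom A) x) fun f hf => by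
    have := mul_kills b.perm a.perm (MvPolynomial.eval₂Hom (Int.castRingHom A) x) 1
      (fun p => by simp [h0]) (fun p hp => by simp [h1 p hp]) (fun p => by simp [← hb p])
      (fun p => by simp [← ha p]) f hf
    rwa [_root_.one_mul] at this

theorem FF.lift_X {b a : CM S} {A : Type} [CommRing A] (x : Fin n → A) (h0 : ∀ p, x p ^ 2 = 0)
    (h1 : ∀ p ∉ S, x p = 0) (hb : ∀ p, x p = x (b.perm p)) (ha : ∀ p, x p = x (a.perm p))
    (p : Fin n) : FF.lift x h0 h1 hb ha (FF.mk b a (MvPolynomial.X p)) = x p := by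
  show MvPolynomial.eval₂Hom (Int.castRingHom A) x (MvPolynomial.X p) = x p
  simp

/-- The ring homomorphism `x_p ↦ x_{π p}` induced by a map of circles. -/
def FF.reindex (b a : CM S) (b' a' : CM T) (π : Fin n → Fin n)
    (hb : ∀ p ∈ S, circ b'.perm a'.perm (π p) (π (b.perm p)))
    (ha : ∀ p ∈ S, circ b'.perm a'.perm (π p) (π (a.perm p))) : FF b a →+* FF b' a' :=
  have key : ∀ (c : CM S), (∀ p ∈ S, circ b'.perm a'.perm (π p) (π (c.perm p))) → ∀ p,
      (if p ∈ S then FF.mk b' a' (MvPolynomial.X (π p)) else 0) =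
      (if c.perm p ∈ S then FF.mk b' a' (MvPolynomial.X (π (c.perm p))) else 0) := by
    intro c hc p
    by_cases hp : p ∈ S
    · rw [if_pos hp, if_pos (c.mem hp)]
      exact cls_X_eq _ _ _ _ (hc p hp)
    · rw [c.bip.fix p hp]
  FF.lift (fun p => if p ∈ S then FF.mk b' a' (MvPolynomial.X (π p)) else 0)
    (fun p => by
      split_ifs
      · exact cls_X_sq _ _ _
      · simp)
    (fun p hp => if_neg hp) (key b hb) (key a ha)

theorem FF.reindex_X {b a : CM S} {b' a' : CM T} {π : Fin n → Fin n}
    (hb : ∀ p ∈ S, circ b'.perm a'.perm (π p) (π (b.perm p)))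
    (ha : ∀ p ∈ S, circ b'.perm a'.perm (π p) (π (a.perm p))) {p : Fin n} (hp : p ∈ S) :
    FF.reindex b a b' a' π hb ha (FF.mk b a (MvPolynomial.X p)) =
      FF.mk b' a' (MvPolynomial.X (π p)) := by
  rw [FF.reindex, FF.lift_X, if_pos hp]

/-- The map `𝓕(W(c) g a) → 𝓕(W(h c) g' a)` induced by gluing `h` and a planar isotopy. -/
def Flat.transport (h : Flat T T') (g : Flat S T) (g' : Flat S T') (c : CM T) (a : CM S) :
    FF c (g.onMatch a) →+ FF (h.onMatch c) (g'.onMatch a) :=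
  ((FF.mul (h.onMatch c) (h.onMatch (g.onMatch a)) (g'.onMatch a)).flip 1).comp
    (h.onF c (g.onMatch a)).toAddMonoidHom

theorem Flat.transport_apply (h : Flat T T') (g : Flat S T) (g' : Flat S T') (c : CM T) (a : CM S)
    (z : FF c (g.onMatch a)) : h.transport g g' c a z =
    FF.mul (h.onMatch c) (h.onMatch (g.onMatch a)) (g'.onMatch a) (h.onF c (g.onMatch a) z) 1 := rfl

/-- The combinatorial condition for a planar isotopy between `h^* g'` and `g`; the map `π` sends a
point of the top line of `h` to the bottom point of `h` on the same component. -/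
structure Isotopy (h : Flat T T') (g : Flat S T) (g' : Flat S T') (π : Fin n → Fin n) :
    Prop where
  cup : g.cup = 1
  mem : ∀ q ∈ T', π q ∈ T
  left_cup : ∀ q ∈ T', π (h.cup q) = π q
  right_cup : ∀ q ∈ T', π (g'.cup q) = π q
  left_shift : ∀ p ∈ T, π (h.shift p) = p
  right_shift : ∀ p ∈ S, π (g'.shift p) = g.shift p
  rel : ∀ q ∈ T', circ h.cup g'.cup (h.shift (π q)) q

namespace Isotopy

variable {h : Flat T T'} {g : Flat S T} {g' : Flat S T'} {π : Fin n → Fin n}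
  (H : Isotopy h g g' π) (c : CM T) (a : CM S)

include H

/-- The strand from `q` to its bottom point consists of cups of `h` and of `g'` only, and these cups
are arcs of `h c` and of `g' a` whatever `c` and `a` are. -/
theorem circ_rel {q : Fin n} (hq : q ∈ T') :
    circ (h.onMatch c).perm (g'.onMatch a).perm (h.shift (π q)) q := by
  have : circ h.cup g'.cup ≤ circ (h.onMatch c).perm (g'.onMatch a).perm :=
    circ_le (h.rel_cup c (circ_left _ _)) (g'.rel_cup a (circ_right _ _))
  exact this (H.rel q hq)

theorem circ_shift {p : Fin n} (hp : p ∈ S) :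
    circ (h.onMatch c).perm (g'.onMatch a).perm (h.shift (g.shift p)) (g'.shift p) := by
  have := H.circ_rel c a (g'.shift_mem hp)
  rwa [H.right_shift p hp] at this

omit H in
theorem shift_left (p : Fin n) :
    circ (h.onMatch c).perm (g'.onMatch a).perm (h.shift p) (h.shift (c.perm p)) :=
  h.rel_of_onMatch c (circ_left _ _) p

/-- An arc of `g a` is the image of an arc of `a`, because `g` has no cups. In the larger manifold
its ends continue along strands to the ends of the corresponding arc of `g' a`. -/
theorem shift_right (p : Fin n) : circ (h.onMatch c).perm (g'.onMatch a).perm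
    (h.shift p) (h.shift ((g.onMatch a).perm p)) := by
  refine g.rel_onMatch (t := Setoid.comap h.shift (circ (h.onMatch c).perm (g'.onMatch a).perm))
    a (fun p => ?_) (fun p hp => ?_) p
  · rw [H.cup]
    exact (circ _ _).refl _
  · have e := H.circ_shift c a (a.mem hp)
    refine (circ _ _).trans (H.circ_shift c a hp) ((circ _ _).trans ?_ ((circ _ _).symm e))
    exact g'.rel_of_onMatch a (circ_right _ _) p

/-- An arc of `h c` is either the image of an arc of `c` or a cup, and `π` maps the first to that
arc and collapses the second to a point. -/
theorem proj_left {q : Fin n} (hq : q ∈ T') :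
    circ c.perm (g.onMatch a).perm (π q) (π ((h.onMatch c).perm q)) := by
  rcases h.cases q with ⟨p, hp, rfl⟩ | h1 | h1
  · rw [h.onMatch_perm, h.glued_shift _ hp, H.left_shift p hp, H.left_shift _ (c.mem hp)]
    exact circ_left _ _ _
  · rw [h.onMatch_perm, h.glued_cup c h1, H.left_cup q hq]
  · exact absurd hq h1

theorem proj_right {q : Fin n} (hq : q ∈ T') :
    circ c.perm (g.onMatch a).perm (π q) (π ((g'.onMatch a).perm q)) := by
  rcases g'.cases q with ⟨p, hp, rfl⟩ | h1 | h1
  · rw [g'.onMatch_perm, g'.glued_shift _ hp, H.right_shift p hp, H.right_shift _ (a.mem hp),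
      ← g.glued_shift _ hp]
    exact circ_right _ _ _
  · rw [g'.onMatch_perm, g'.glued_cup a h1, H.right_cup q hq]
  · exact absurd hq h1

/-- `h.shift` and `π` map chains of arcs to chains of arcs in the two directions, and `π` undoes
`h.shift` on `T`. -/
theorem circ_iff {p q : Fin n} (hp : p ∈ T) (hq : q ∈ T) :
    circ c.perm (g.onMatch a).perm p q ↔
      circ (h.onMatch c).perm (g'.onMatch a).perm (h.shift p) (h.shift q) := by
  have h1 : circ c.perm (g.onMatch a).perm ≤
      Setoid.comap h.shift (circ (h.onMatch c).perm (g'.onMatch a).perm) :=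
    circ_le (shift_left c a) (H.shift_right c a)
  refine ⟨fun hh => h1 hh, fun hh => ?_⟩
  -- The pull-back of the circle relation along `π`. Since `π` is controlled only on `T'`, the
  -- relation is imposed there and also required to respect membership in `T'`.
  let t : Setoid (Fin n) :=
    { r := fun x y => (x ∈ T' ↔ y ∈ T') ∧ (x ∈ T' → circ c.perm (g.onMatch a).perm (π x) (π y))
      iseqv := ⟨fun x => ⟨Iff.rfl, fun _ => (circ _ _).refl _⟩,
        fun h => ⟨h.1.symm, fun h' => Setoid.symm' _ (h.2 (h.1.2 h'))⟩,
        fun h h' => ⟨h.1.trans h'.1, fun h'' =>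
          Setoid.trans' _ (h.2 h'') (h'.2 (h.1.1 h''))⟩⟩ }
  have hm : ∀ d : CM T', ∀ p, p ∈ T' ↔ d.perm p ∈ T' := fun d p =>
    ⟨d.mem, fun h => by have := d.mem h; rwa [d.invol] at this⟩
  have h2 : circ (h.onMatch c).perm (g'.onMatch a).perm ≤ t :=
    circ_le (fun p => ⟨hm _ p, H.proj_left c a⟩) (fun p => ⟨hm _ p, H.proj_right c a⟩)
  have h3 := (h2 hh).2 (h.shift_mem hp)
  rwa [H.left_shift p hp, H.left_shift q hq] at h3

/-- An isotopy matches the circles of W(c) g a with those of W(h c) g' a. The bijection is induced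
by `h.shift`, and it is onto because `circ_rel` joins every point of `T'` to a point coming from
`T`; no closed component arises between `h` and `g'`. -/
theorem numCirc_eq : numCirc T c.perm (g.onMatch a).perm =
    numCirc T' (h.onMatch c).perm (g'.onMatch a).perm := by
  refine (Nat.card_congr (Equiv.ofBijective (fun C => ⟨Quotient.map h.shift (fun p q hpq => ?_) C.1,
    ?_⟩) ⟨?_, ?_⟩))
  · exact circ_le (t := Setoid.comap h.shift (circ (h.onMatch c).perm (g'.onMatch a).perm))
      (shift_left c a) (H.shift_right c a) hpq
  · obtain ⟨p, hp, hC⟩ := C.2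
    exact ⟨h.shift p, h.shift_mem hp, by rw [← hC]; rfl⟩
  · rintro ⟨_, p, hp, rfl⟩ ⟨_, q, hq, rfl⟩ hpq
    exact Subtype.ext (Quotient.sound ((H.circ_iff c a hp hq).2
      (Quotient.exact (congrArg Subtype.val hpq))))
  · rintro ⟨_, q, hq, rfl⟩
    exact ⟨⟨_, π q, H.mem q hq, rfl⟩, Subtype.ext (Quotient.sound (H.circ_rel c a hq))⟩

/-- Up to isotopy this manifold is W(g a) g a, which has one circle for each arc. The count gives
the degree of the unit used in `Flat.transport`. -/
theorem numCirc_unit : numCirc T' (h.onMatch (g.onMatch a)).perm (g'.onMatch a).perm =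
    T.card / 2 := by
  rw [← H.numCirc_eq, numCirc_self]

/-- The contraction occurring in `Flat.transport` passes the counting test of `contr_eq_one`: gluing
`h` to both sides adds |T'|/2 - |T|/2 circles, and the isotopy changes no count. -/
theorem contr_left : contr (h.onMatch c).perm (h.onMatch (g.onMatch a)).perm
    (g'.onMatch a).perm = 1 := by
  apply contr_eq_one
  have h1 := h.numCirc_onMatch c (g.onMatch a)
  rw [H.numCirc_unit, ← H.numCirc_eq]
  omega

/-- The contraction on the other side of the unit. Here the numbers of circles of `g a', g a` and of
`g' a', g' a` are both compared with that of `a', a`. -/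
theorem contr_right (a' : CM S) : contr (h.onMatch (g.onMatch a')).perm (g'.onMatch a').perm
    (g'.onMatch a).perm = 1 := by
  apply contr_eq_one
  have h1 := g.numCirc_onMatch a' a
  have h2 := g'.numCirc_onMatch a' a
  rw [H.numCirc_unit, ← H.numCirc_eq]
  omega

/-- As no circle splits, multiplying by the unit leaves the representative unchanged, and what
remains is the renaming of variables along the strands of `h`. -/
theorem transport_eq (z : FF c (g.onMatch a)) : h.transport g g' c a z = FF.reindex _ _ _ _ h.shift
    (fun p _ => shift_left c a p) (fun p _ => H.shift_right c a p) z := by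
  obtain ⟨q, rfl⟩ := cls_surjective _ _ z
  rw [Flat.transport_apply]
  have e := h.onF_mk c (g.onMatch a) q
  rw [e, ← map_one (FF.mk _ _), FF.mul_of_contr (H.contr_left c a), _root_.mul_one]
  let φ : MvPolynomial (Fin n) ℤ →+* FF (h.onMatch c) (g'.onMatch a) :=
    (FF.mk _ _).comp (MvPolynomial.aeval h.onVar : MvPolynomial (Fin n) ℤ →ₐ[ℤ] _).toRingHom
  let ψ : MvPolynomial (Fin n) ℤ →+* FF (h.onMatch c) (g'.onMatch a) :=
    (FF.reindex c (g.onMatch a) (h.onMatch c) (g'.onMatch a) h.shift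
      (fun p _ => shift_left c a p) (fun p _ => H.shift_right c a p)).comp (FF.mk _ _)
  have : φ = ψ := by
    refine MvPolynomial.ringHom_ext (fun z => by simp) fun p => ?_
    by_cases hp : p ∈ T
    · refine Eq.trans ?_ (FF.reindex_X (fun p _ => shift_left c a p)
        (fun p _ => H.shift_right c a p) hp).symm
      simp [φ, Flat.onVar, hp]
    · have e : FF.mk c (g.onMatch a) (MvPolynomial.X p) = 0 := cls_X_not_mem _ _ hp
      refine Eq.trans ?_ ((congrArg (FF.reindex _ _ _ _ h.shift (fun p _ => shift_left c a p)
        (fun p _ => H.shift_right c a p)) e).trans (map_zero _)).symm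
      simp [φ, Flat.onVar, hp]
  exact DFunLike.congr_fun this q

/-- The renaming along `π` is the inverse; both composites fix every variable, one of them because
`q` and `h.shift (π q)` lie on the same circle. -/
theorem transport_bijective : Function.Bijective (h.transport g g' c a) := by
  let φ : FF c (g.onMatch a) →+* FF (h.onMatch c) (g'.onMatch a) := FF.reindex _ _ _ _ h.shift
    (fun p _ => shift_left c a p) (fun p _ => H.shift_right c a p)
  let ψ : FF (h.onMatch c) (g'.onMatch a) →+* FF c (g.onMatch a) := FF.reindex _ _ _ _ π
    (fun q hq => H.proj_left c a hq) (fun q hq => H.proj_right c a hq)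
  have h1 : ψ.comp φ = RingHom.id _ := FF.ringHom_ext fun p hp => by
    rw [RingHom.comp_apply, FF.reindex_X _ _ hp, FF.reindex_X _ _ (h.shift_mem hp),
      H.left_shift p hp]
    rfl
  have h2 : φ.comp ψ = RingHom.id _ := FF.ringHom_ext fun p hp => by
    rw [RingHom.comp_apply, FF.reindex_X _ _ hp, FF.reindex_X _ _ (H.mem p hp)]
    exact cls_X_eq _ _ _ _ (H.circ_rel c a hp)
  have e : ⇑(h.transport g g' c a) = φ := funext (H.transport_eq c a)
  rw [e]
  exact Function.bijective_iff_has_inverse.2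
    ⟨ψ, DFunLike.congr_fun h1, DFunLike.congr_fun h2⟩

/-- The degree is preserved exactly: gluing `h` lowers it by |T'|/2 - |T|/2, the unit has degree
-|T|/2 by `numCirc_unit`, and the contraction adds |T'|/2. -/
theorem transport_mem (d : ℤ) (z : FF c (g.onMatch a)) (hz : z ∈ tqDeg T c.perm (g.onMatch a).perm d) :
    h.transport g g' c a z ∈ tqDeg T' (h.onMatch c).perm (g'.onMatch a).perm d := by
  have h1 := h.onF_mem c (g.onMatch a) (d + (T.card / 2 : ℕ)) z (by rwa [add_sub_cancel_right])
  have h2 := FF.mul_mem h1 (FF.one_mem_numCirc _ (g'.onMatch a))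
  rw [H.numCirc_unit] at h2
  have e : d + (T.card / 2 : ℕ) - (T'.card / 2 : ℕ) + -(T.card / 2 : ℕ) + (T'.card / 2 : ℕ) = d := by
    ring
  rwa [e] at h2

omit H in
theorem transport_mul (b : CM T) (x : FF b c) (y : FF c (g.onMatch a)) :
    h.transport g g' b a (FF.mul b c (g.onMatch a) x y) = FF.mul _ _ _ (h.onF b c x) (h.transport g g' c a y) := by
  rw [h.transport_apply, h.onF_mul, FF.mul_assoc, h.transport_apply]

/-- Right linearity. The tangles `h g` and `g'` may differ on matchings, so `Flat.link_of_eq` does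
not apply; `contr_left`, `contr_right` and `circ_shift` supply the hypotheses of the general
`Flat.link`. -/
theorem transport_mul_right (a' : CM S) (x : FF c (g.onMatch a')) (y : FF a' a) :
    h.transport g g' c a (FF.mul c (g.onMatch a') (g.onMatch a) x (g.onF a' a y)) =
      FF.mul _ _ _ (h.transport g g' c a' x) (g'.onF a' a y) := by
  rw [h.transport_apply, h.onF_mul, FF.mul_assoc, h.transport_apply, FF.mul_assoc]
  exact congrArg _ (h.link g g' a' a (H.contr_left _ a) (H.contr_right a a')
    (fun p hp => H.circ_shift _ a hp) y)

end Isotopy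

variable {S₀ : Finset (Fin n)}

/-- Isotopic flat tangles have isomorphic functors. -/
theorem bimodule_iso_of_isotopy (h : Flat T T') (f : Flat S₀ T) (f' : Flat S₀ T') (g : Flat S T)
    (g' : Flat S T') (hf : ∀ b, h.onMatch (f.onMatch b) = f'.onMatch b)
    (hf' : ∀ p ∈ S₀, h.shift (f.shift p) = f'.shift p) {π : Fin n → Fin n}
    (H : Isotopy h g g' π) :
    Nonempty ((bimodule f g).tensor (Hgr_isInternal _) ≅
      (bimodule f' g').tensor (Hgr_isInternal _)) := by
  -- The right-hand side of the matrix changes by the isotopy. On the left-hand side `h f` and `f'`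
  -- agree strictly, so the factor `1` in front is merely a cast.
  let φ : Bim f g →+ Bim f' g' := AddMonoidHom.mk' (fun z b a =>
    FF.mul (f'.onMatch b) (h.onMatch (f.onMatch b)) (g'.onMatch a) 1 (h.transport g g' _ a (z b a)))
      fun z z' => by
        funext b a
        refine Eq.trans ?_ (Bim.add_apply f' g' _ _ b a).symm
        rw [Bim.add_apply, map_add, map_add]
  have hφ : ∀ z b a, φ z b a =
    FF.mul (f'.onMatch b) (h.onMatch (f.onMatch b)) (g'.onMatch a) 1 (h.transport g g' _ a (z b a)) :=
    fun _ _ _ => rfl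
  refine tensor_iso_of_bimodule_iso _ (bimodule f g) (bimodule f' g') φ ?_ ?_ ?_ ?_
  · have : ∀ (r : ArcAlg.H S₀) (z : Bim f g), φ (r • z) = r • φ z := by
      intro r z
      funext b a
      rw [hφ, Bim.smul_apply, Bim.smul_apply, map_sum, map_sum]
      refine Finset.sum_congr rfl fun b' _ => ?_
      rw [Isotopy.transport_mul, ← FF.mul_assoc, h.link_of_eq' f f' hf hf', FF.mul_assoc, hφ]
    exact this
  · have : ∀ (r : ArcAlg.H S) (z : Bim f g),
        φ (MulOpposite.op r • z) = MulOpposite.op r • φ z := by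
      intro r z
      funext b a
      rw [hφ, Bim.op_smul_apply, Bim.op_smul_apply, map_sum, map_sum]
      refine Finset.sum_congr rfl fun b' _ => ?_
      rw [H.transport_mul_right, ← FF.mul_assoc, hφ]
    exact this
  · intro d z hz
    refine mem_mDeg.2 fun b a => ?_
    have h1 := H.transport_mem _ a _ (z b a) (mem_mDeg.1 hz b a)
    have h2 := FF.mul_mem (FF.one_mem_of_eq (hf b).symm) h1
    rwa [neg_add_cancel_comm] at h2
  · let ψ : ∀ b a, FF (f.onMatch b) (g.onMatch a) → FF (f'.onMatch b) (g'.onMatch a) :=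
      fun b a z => FF.mul (f'.onMatch b) (h.onMatch (f.onMatch b)) (g'.onMatch a) 1 (h.transport g g' _ a z)
    have hψ : ∀ b a, Function.Bijective (ψ b a) := fun b a =>
      Function.Bijective.comp (Function.bijective_iff_has_inverse.2
        ⟨fun z => FF.mul (h.onMatch (f.onMatch b)) _ _ 1 z, FF.one_one (hf b) _,
          FF.one_one (hf b).symm _⟩) (H.transport_bijective _ a)
    refine ⟨fun z z' hz => ?_, fun z => ?_⟩
    · funext b a
      exact (hψ b a).1 (congrFun (congrFun hz b) a)
    · choose w hw using fun b a => (hψ b a).2 (z b a)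
      exact ⟨w, funext fun b => funext fun a => hw b a⟩

end Reparametrization

/-! ### Removing a closed circle -/

section Circle

variable {n : ℕ} {S T : Finset (Fin n)}

/-- Contraction is multiplication of polynomials by a fixed factor, so it commutes with placing a
dot, that is, multiplying by a variable, at any point. -/
theorem FF.mul_X_left (c b a : CM S) (p : Fin n) (x : FF c b) (y : FF b a) :
    FF.mul c b a (FF.mk c b (MvPolynomial.X p) * x) y =
      FF.mk c a (MvPolynomial.X p) * FF.mul c b a x y := by
  obtain ⟨f, rfl⟩ := cls_surjective _ _ x
  obtain ⟨g, rfl⟩ := cls_surjective _ _ y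
  have e := FF.mul_mk c b a f g
  rw [e, ← map_mul (FF.mk c b), FF.mul_mk, ← map_mul (FF.mk c a)]
  congr 1
  ring

theorem FF.mul_X_right (c b a : CM S) (p : Fin n) (x : FF c b) (y : FF b a) :
    FF.mul c b a x (FF.mk b a (MvPolynomial.X p) * y) =
      FF.mk c a (MvPolynomial.X p) * FF.mul c b a x y := by
  obtain ⟨f, rfl⟩ := cls_surjective _ _ x
  obtain ⟨g, rfl⟩ := cls_surjective _ _ y
  have e := FF.mul_mk c b a f g
  rw [e, ← map_mul (FF.mk b a), FF.mul_mk, ← map_mul (FF.mk c a)]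
  congr 1
  ring

variable {u v : Fin n} {huv : (u : ℕ) + 1 = v ∨ (v : ℕ) + 1 = u} {hu : u ∉ S} {hv : v ∉ S}
  {hT : ∀ p, p ∈ T ↔ p ∈ S ∨ p = u ∨ p = v}

theorem cls_X_cup (b a : CM S) :
    FF.mk ((Flat.cupTangle u v huv hu hv hT).onMatch b) ((Flat.cupTangle u v huv hu hv hT).onMatch a)
      (MvPolynomial.X u) = FF.mk _ _ (MvPolynomial.X v) := by
  have h : u ≠ v := by rintro rfl; omega
  have h1 := circ_left ((Flat.cupTangle u v huv hu hv hT).onMatch b).perm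
    ((Flat.cupTangle u v huv hu hv hT).onMatch a).perm u
  have h2 : (Flat.cupTangle u v huv hu hv hT).cup u = v := swap_apply_left u v
  rw [Flat.onMatch_perm _ b, Flat.glued_cup _ b (by rw [h2]; exact h.symm), h2] at h1
  exact cls_X_eq _ _ _ _ h1

-- The circle through `u` and `v` carries a variable that is independent of the others. To detect
-- this, map the glued ring to the dual numbers over `A`, sending `x_u = x_v` to ε and the variables
-- of `S` through `i`. Then `x_u y + z` becomes `i z + ε i y`, and both components can be read off.
-- The lemma is applied with `i` the identity.
open TrivSqZeroExt in
theorem circle_split_injective (b a : CM S) {A : Type} [CommRing A] (i : FF b a →+* A)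
    (y z y' z' : FF b a)
    (h : FF.mk _ _ (MvPolynomial.X u) * (Flat.cupTangle u v huv hu hv hT).onF b a y +
        (Flat.cupTangle u v huv hu hv hT).onF b a z =
      FF.mk _ _ (MvPolynomial.X u) * (Flat.cupTangle u v huv hu hv hT).onF b a y' +
        (Flat.cupTangle u v huv hu hv hT).onF b a z') : i y = i y' ∧ i z = i z' := by
  set f := Flat.cupTangle u v huv hu hv hT with hf
  let x : Fin n → DualNumber A := fun p => if p ∈ S then inl (i (FF.mk b a (MvPolynomial.X p)))
    else if p = u ∨ p = v then DualNumber.eps else 0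
  have hx : ∀ (c : CM S), (∀ p, FF.mk b a (MvPolynomial.X p) = FF.mk b a (MvPolynomial.X (c.perm p)))
      → ∀ p, x p = x ((f.onMatch c).perm p) := by
    intro c hc p
    rcases f.cases p with ⟨q, hq, e⟩ | h1 | h1
    · rw [e, f.onMatch_perm, f.glued_shift _ hq]
      show x q = x (c.perm q)
      simp only [x, hq, c.mem hq, if_true]
      rw [hc]
    · rw [f.onMatch_perm, f.glued_cup c h1]
      have h2 : p = u ∨ p = v := by
        have : swap u v p ≠ p := h1
        rw [swap_apply_ne_self_iff] at this
        exact this.2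
      show x p = x (swap u v p)
      rcases h2 with rfl | rfl
      · simp [x, hu, hv]
      · simp [x, hu, hv]
    · rw [f.onMatch_perm, f.glued_fix c h1]
  let ρ : FF (f.onMatch b) (f.onMatch a) →+* DualNumber A := FF.lift x
    (fun p => by
      simp only [x]
      split_ifs
      · have e := cls_X_sq (S := S) b.perm a.perm p
        rw [sq] at e ⊢
        rw [← inl_mul, ← map_mul, e, map_zero, inl_zero]
      · exact DualNumber.eps_pow_two
      · simp)
    (fun p hp => by
      rw [hT, not_or] at hp
      simp [x, hp])
    (hx b fun p => cls_X_eq _ _ _ _ (circ_left _ _ p))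
    (hx a fun p => cls_X_eq _ _ _ _ (circ_right _ _ p))
  have hρ : ∀ p, ρ (FF.mk _ _ (MvPolynomial.X p)) = x p := FF.lift_X x _ _ _ _
  have h1 : ρ.comp (f.onF b a) = (inlHom A A : A →+* DualNumber A).comp i :=
    FF.ringHom_ext fun p hp => by
      refine (congrArg ρ (f.onF_X b a hp)).trans ((hρ _).trans ?_)
      show x p = inl _
      simp [x, hp]
  have h2 : ∀ z, ρ (f.onF b a z) = inl (i z) := DFunLike.congr_fun h1
  have h3 : ρ (FF.mk _ _ (MvPolynomial.X u)) = DualNumber.eps := by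
    rw [hρ]
    simp [x, hu]
  have h4 := congrArg ρ h
  simp only [map_add, map_mul, h2, h3] at h4
  have h5 := congrArg TrivSqZeroExt.fst h4
  have h6 := congrArg TrivSqZeroExt.snd h4
  simp at h5 h6
  exact ⟨h6, h5⟩

/-- The additive splitting of `𝓕(W(b)a) ⊗ 𝓐`. -/
theorem circle_split_bijective (b a : CM S) : Function.Bijective fun y : FF b a × FF b a =>
    FF.mk _ _ (MvPolynomial.X u) * (Flat.cupTangle u v huv hu hv hT).onF b a y.1 +
      (Flat.cupTangle u v huv hu hv hT).onF b a y.2 := by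
  set f := Flat.cupTangle u v huv hu hv hT with hf
  have hne : u ≠ v := by rintro rfl; omega
  have hX : ∀ p ∈ S, f.onF b a (FF.mk b a (MvPolynomial.X p)) = FF.mk _ _ (MvPolynomial.X p) :=
    fun p hp => f.onF_X b a hp
  constructor
  · intro y y' h
    have := circle_split_injective b a (RingHom.id (FF b a)) y.1 y.2 y'.1 y'.2 h
    exact Prod.ext this.1 this.2
  · intro z
    obtain ⟨g, rfl⟩ := cls_surjective _ _ z
    -- The image contains the constants and is stable under sums and under multiplication by each
    -- variable.
    induction g using MvPolynomial.induction_on with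
    | C k => exact ⟨(0, (k : FF b a)), by simp⟩
    | add g g' hg hg' =>
      obtain ⟨⟨y, z⟩, hy⟩ := hg
      obtain ⟨⟨y', z'⟩, hy'⟩ := hg'
      refine ⟨(y + y', z + z'), ?_⟩
      rw [map_add (FF.mk _ _) g g', ← hy, ← hy']
      simp only [map_add]
      ring
    | mul_X g p hg =>
      obtain ⟨⟨y, z⟩, hy⟩ := hg
      rw [map_mul (FF.mk _ _) g _, ← hy]
      by_cases hp : p ∈ S
      · refine ⟨(y * FF.mk b a (MvPolynomial.X p), z * FF.mk b a (MvPolynomial.X p)), ?_⟩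
        simp only [map_mul, hX p hp]
        ring
      · by_cases hp' : p = u ∨ p = v
        · have e : FF.mk (f.onMatch b) (f.onMatch a) (MvPolynomial.X p) =
              FF.mk _ _ (MvPolynomial.X u) := by
            rcases hp' with rfl | rfl
            · rfl
            · exact (cls_X_cup b a).symm
          -- Since `x_u² = 0`, multiplying `x_u y + z` by `x_u` leaves `x_u z`.
          refine ⟨(z, 0), ?_⟩
          have e2 := cls_X_sq (S := T) (f.onMatch b).perm (f.onMatch a).perm u
          simp only [map_zero, add_zero]
          rw [e]
          linear_combination -(f.onF b a y) * e2
        · refine ⟨(0, 0), ?_⟩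
          have e : FF.mk (f.onMatch b) (f.onMatch a) (MvPolynomial.X p) = 0 :=
            cls_X_not_mem _ _ (by rw [hT]; tauto)
          rw [e]
          simp

/-- Multiplication by a variable on a bimodule. -/
def Bim.mulX {S' : Finset (Fin n)} (f : Flat S T) (g : Flat S' T) (p : Fin n) (z : Bim f g) :
    Bim f g := fun b a => FF.mk _ _ (MvPolynomial.X p) * z b a

theorem Bim.smul_mulX {S' : Finset (Fin n)} (f : Flat S T) (g : Flat S' T) (p : Fin n) (r : H S)
    (z : Bim f g) : r • Bim.mulX f g p z = Bim.mulX f g p (r • z) := by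
  funext b a
  refine (Bim.smul_apply f g r _ b a).trans ?_
  refine Eq.trans ?_ (congrArg (FF.mk _ _ (MvPolynomial.X p) * ·) (Bim.smul_apply f g r z b a)).symm
  rw [Finset.mul_sum]
  exact Finset.sum_congr rfl fun c _ => FF.mul_X_right _ _ _ _ _ _

theorem Bim.op_smul_mulX {S' : Finset (Fin n)} (f : Flat S T) (g : Flat S' T) (p : Fin n)
    (r : H S') (z : Bim f g) :
    MulOpposite.op r • Bim.mulX f g p z = Bim.mulX f g p (MulOpposite.op r • z) := by
  funext b a
  refine (Bim.op_smul_apply f g r _ b a).trans ?_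
  refine Eq.trans ?_ (congrArg (FF.mk _ _ (MvPolynomial.X p) * ·)
    (Bim.op_smul_apply f g r z b a)).symm
  rw [Finset.mul_sum]
  exact Finset.sum_congr rfl fun c _ => FF.mul_X_left _ _ _ _ _ _

/-- The unit matrix as an element of a bimodule. -/
def Bim.unit (f : Flat S T) : Bim f f := mOne f.onMatch

/-- With `Bim.op_smul_unit` this makes the unit matrix central: both actions on it produce the glued
matrix of `r`. -/
theorem Bim.smul_unit (f : Flat S T) (r : H S) : r • Bim.unit f = f.onH r :=
  mm_mOne f.onMatch f.onMatch _

theorem Bim.op_smul_unit (f : Flat S T) (r : H S) : MulOpposite.op r • Bim.unit f = f.onH r :=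
  mOne_mm f.onMatch f.onMatch _

/-- A circle can be removed at the price of two grading shifts. -/
theorem circle_iso (hT : ∀ p, p ∈ T ↔ p ∈ S ∨ p = u ∨ p = v) :
    Nonempty ((bimodule (Flat.cupTangle u v huv hu hv hT)
      (Flat.cupTangle u v huv hu hv hT)).tensor (Hgr_isInternal S) ≅ shiftSum (H S) (Hgr S)) := by
  set f := Flat.cupTangle u v huv hu hv hT with hf
  have hne : u ≠ v := by rintro rfl; omega
  -- `T` has one more pair of points than `S`, while the bimodule is normalized by |S|/2. Hence the
  -- unit matrix has degree -1 rather than 0, and its multiple by `x_u` has degree 1.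
  have hcard : T.card / 2 = S.card / 2 + 1 := by
    have : T = insert u (insert v S) := by
      ext p
      rw [hT]
      simp only [Finset.mem_insert]
      tauto
    rw [this, Finset.card_insert_of_notMem (by simp [hu, hne]), Finset.card_insert_of_notMem hv]
    omega
  refine tensor_iso_shiftSum _ (bimodule f f) (Bim.mulX f f u (Bim.unit f)) (Bim.unit f)
    (fun r => ?_) (fun r => ?_) ?_ ?_ ?_
  · exact (Bim.op_smul_mulX f f u r _).trans ((congrArg (Bim.mulX f f u)
      ((Bim.op_smul_unit f r).trans (Bim.smul_unit f r).symm)).trans (Bim.smul_mulX f f u r _).symm)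
  · exact (Bim.op_smul_unit f r).trans (Bim.smul_unit f r).symm
  · refine mem_mDeg.2 fun b a => ?_
    show FF.mk _ _ (MvPolynomial.X u) * (if b = a then 1 else 0) ∈ _
    split_ifs with h
    · subst h
      rw [_root_.mul_one]
      refine mem_tqDeg.2 ⟨MvPolynomial.X u, fun s hs => ?_, rfl⟩
      have : s = Finsupp.single u 1 := by
        simpa [MvPolynomial.support_X] using hs
      rw [this, numCirc_self, hcard]
      simp
      ring
    · rw [mul_zero]
      exact zero_mem _
  · refine mem_mDeg.2 fun b a => ?_
    show (if b = a then (1 : FF (f.onMatch b) (f.onMatch a)) else 0) ∈ _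
    split_ifs with h
    · have := FF.one_mem_of_eq (congrArg f.onMatch h)
      rw [hcard] at this
      convert this using 2
      push_cast
      ring
    · exact zero_mem _
  -- Freeness on the two generators is checked entry by entry, where it is `circle_split_bijective`.
  · have key : ∀ (p : H S × H S) b a, (p.1 • Bim.mulX f f u (Bim.unit f) + p.2 • Bim.unit f) b a =
        FF.mk _ _ (MvPolynomial.X u) * f.onF b a (p.1 b a) + f.onF b a (p.2 b a) := by
      intro p b a
      refine (Bim.add_apply f f _ _ b a).trans (congrArg₂ (· + ·) ?_ ?_)
      · refine (congrFun (congrFun (Bim.smul_mulX f f u p.1 _) b) a).trans ?_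
        exact congrArg (FF.mk _ _ (MvPolynomial.X u) * ·)
          (congrFun (congrFun (Bim.smul_unit f p.1) b) a)
      · exact congrFun (congrFun (Bim.smul_unit f p.2) b) a
    have hb := circle_split_bijective (huv := huv) (hu := hu) (hv := hv) (hT := hT)
    have hinj : ∀ p q : H S × H S, p.1 • Bim.mulX f f u (Bim.unit f) + p.2 • Bim.unit f =
        q.1 • Bim.mulX f f u (Bim.unit f) + q.2 • Bim.unit f → p = q := by
      intro p q h
      have h' : ∀ b a, (p.1 b a, p.2 b a) = (q.1 b a, q.2 b a) := fun b a =>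
        (hb b a).1 (by
          have := congrFun (congrFun h b) a
          rwa [key, key] at this)
      exact Prod.ext (funext fun b => funext fun a => congrArg Prod.fst (h' b a))
        (funext fun b => funext fun a => congrArg Prod.snd (h' b a))
    have hsurj : ∀ z : Bim f f, ∃ p : H S × H S,
        p.1 • Bim.mulX f f u (Bim.unit f) + p.2 • Bim.unit f = z := by
      intro z
      choose w hw using fun b a => (hb b a).2 (z b a)
      exact ⟨(fun b a => (w b a).1, fun b a => (w b a).2), funext fun b => funext fun a =>
        (key _ b a).trans (hw b a)⟩
    exact ⟨fun p q h => hinj p q h, hsurj⟩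

end Circle

/-! ### Isomorphisms between composites of elementary tangles -/

section Relations

variable {n : ℕ} {S₁ S₂ S₃ S₄ S₅ : Finset (Fin n)}

/-- The cups of a composite are the cups of the upper tangle and the images of the cups of the lower
one, and the remaining arcs come from `a`. This criterion recognizes `g₃` as the composite through
its `shift` and `cup` alone. -/
theorem Flat.onMatch_comp {S S' T : Finset (Fin n)} (g₁ : Flat S T) (g₂ : Flat S' S)
    (g₃ : Flat S' T) (hs : ∀ p ∈ S', g₁.shift (g₂.shift p) = g₃.shift p)
    (hc₁ : ∀ p, g₁.cup p ≠ p → g₃.cup p = g₁.cup p)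
    (hc₂ : ∀ p ∈ S, g₂.cup p ≠ p → g₃.cup (g₁.shift p) = g₁.shift (g₂.cup p)) (a : CM S') :
    g₁.onMatch (g₂.onMatch a) = g₃.onMatch a := by
  apply CM.perm_injective
  ext1 p
  rw [g₃.onMatch_perm, g₁.onMatch_perm]
  rcases g₁.cases p with ⟨q, hq, rfl⟩ | h | h
  · rw [g₁.glued_shift _ hq, g₂.onMatch_perm]
    rcases g₂.cases q with ⟨r, hr, rfl⟩ | h | h
    · rw [g₂.glued_shift _ hr, hs r hr, g₃.glued_shift _ hr, hs _ (a.mem hr)]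
    · rw [g₂.glued_cup a h, g₃.glued_cup a, hc₂ q hq h]
      rw [hc₂ q hq h]
      exact fun e => h (g₁.shift.injective e)
    · exact absurd hq h
  · rw [g₁.glued_cup _ h, g₃.glued_cup a, hc₁ p h]
    rwa [hc₁ p h]
  · rw [g₁.glued_fix _ h, g₃.glued_fix a h]

/-- The composition of flat tangles without cups. -/
def Flat.comp {S S' T : Finset (Fin n)} (g₁ : Flat S T) (g₂ : Flat S' S) (h₁ : g₁.cup = 1)
    (h₂ : g₂.cup = 1) : Flat S' T where
  shift := g₁.shift * g₂.shift
  cup := 1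
  invol _ := rfl
  mono p hp q hq h := g₁.mono _ (g₂.shift_mem hp) _ (g₂.shift_mem hq) (g₂.mono p hp q hq h)
  disj _ _ := rfl
  mem_iff p := by
    rw [g₁.mem_iff, g₂.mem_iff, h₁, h₂]
    simp only [Perm.one_apply, ne_eq, not_true_eq_false, or_false]
    rfl
  planar p q h1 h2 := absurd h1 h2.asymm

/-- The inverse of a flat tangle without cups. -/
def Flat.inv {S T : Finset (Fin n)} (g : Flat S T) (h : g.cup = 1) : Flat T S where
  shift := g.shift⁻¹
  cup := 1
  invol _ := rfl
  mono p hp q hq hpq := by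
    rw [g.mem_iff, h] at hp hq
    have hp' : g.shift.symm p ∈ S := hp.resolve_right fun h => h rfl
    have hq' : g.shift.symm q ∈ S := hq.resolve_right fun h => h rfl
    by_contra hlt
    rcases lt_or_eq_of_le (not_lt.1 hlt) with h1 | h1
    · have := g.mono _ hq' _ hp' h1
      rw [apply_symm_apply, apply_symm_apply] at this
      exact lt_asymm this hpq
    · exact hpq.ne (g.shift.symm.injective h1).symm
  disj _ _ := rfl
  mem_iff p := by
    have e : p ∈ S ↔ g.shift p ∈ T := by
      rw [g.mem_iff, h, symm_apply_apply]
      simp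
    rw [e]
    simp
    rfl
  planar p q h1 h2 := absurd h1 h2.asymm

/-- The functor of a flat tangle without caps. -/
abbrev cupFunctor {S T : Finset (Fin n)} (g : Flat S T) :
    GrMod (H S) (Hgr S) ⥤ GrMod (H T) (Hgr T) :=
  (bimodule (Flat.idTangle T) g).tensor (Hgr_isInternal S)

/-- The functor of a flat tangle without cups. -/
abbrev capFunctor {S T : Finset (Fin n)} (f : Flat S T) :
    GrMod (H T) (Hgr T) ⥤ GrMod (H S) (Hgr S) :=
  (bimodule f (Flat.idTangle T)).tensor (Hgr_isInternal T)

theorem cupFunctor_comp_iso {S S' T : Finset (Fin n)} (g₁ : Flat S T) (g₂ : Flat S' S)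
    (g₃ : Flat S' T) (hs : ∀ p ∈ S', g₁.shift (g₂.shift p) = g₃.shift p)
    (hc₁ : ∀ p, g₁.cup p ≠ p → g₃.cup p = g₁.cup p)
    (hc₂ : ∀ p ∈ S, g₂.cup p ≠ p → g₃.cup (g₁.shift p) = g₁.shift (g₂.cup p)) :
    Nonempty (cupFunctor g₂ ⋙ cupFunctor g₁ ≅ cupFunctor g₃) :=
  bimodule_comp_iso (Flat.idTangle T) g₁ g₂ g₃ (Flat.onMatch_comp g₁ g₂ g₃ hs hc₁ hc₂) hs

/-- The instance of `bimodule_comp_iso` with `g₁` the identity: a cup tangle below a cap tangle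
gives the bimodule of `f^* g`, where isotopies and circles become visible. -/
theorem cup_cap_iso {S₀ S T : Finset (Fin n)} (g : Flat S T) (f : Flat S₀ T) :
    Nonempty (cupFunctor g ⋙ capFunctor f ≅ (bimodule f g).tensor (Hgr_isInternal S)) :=
  bimodule_comp_iso f (Flat.idTangle T) g g (fun _ => rfl) fun _ _ => rfl

/-- Straightening a strand which goes through a cup and a cap. -/
theorem zigzag_iso {S T T' : Finset (Fin n)} {u v w : Fin n} (huv : u ≠ v) (huw : u ≠ w)
    (hvw : v ≠ w) (h : Flat T T') (g : Flat S T) (g' : Flat S T') (h1 : h.shift = 1)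
    (h2 : h.cup = swap u v) (h3 : g'.shift = 1) (h4 : g'.cup = swap v w) (h5 : g.cup = 1)
    (h6 : ∀ p ∈ S, g.shift p = if p = u then w else p) :
    Nonempty (cupFunctor g' ⋙ capFunctor h ≅ cupFunctor g) := by
  have huT : u ∉ T := fun hu => by
    have := h.disj u hu
    rw [h1, h2, Perm.one_apply, swap_apply_left] at this
    exact huv this.symm
  have hvT : v ∉ T := fun hv => by
    have := h.disj v hv
    rw [h1, h2, Perm.one_apply, swap_apply_right] at this
    exact huv this
  have hvS : v ∉ S := fun hv => by
    have := g'.disj v hv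
    rw [h3, h4, Perm.one_apply, swap_apply_left] at this
    exact hvw this.symm
  have hwT' : w ∈ T' := (g'.mem_iff w).2 (Or.inr (by rw [h4, swap_apply_right]; exact hvw))
  have hT' : ∀ p, p ∈ T' → p ∈ T ∨ p = u ∨ p = v := by
    intro p hp
    rcases (h.mem_iff p).1 hp with h | h
    · left; rwa [h1] at h
    · right
      rw [h2, swap_apply_ne_self_iff] at h
      exact h.2
  have hwT : w ∈ T := by
    rcases hT' w hwT' with h | h | h
    · exact h
    · exact absurd h.symm huw
    · exact absurd h.symm hvw
  -- On the upper line the strand runs from `u` along the cup of `h` to `v` and along the cup of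
  -- `g'` to `w`, so all three points lead to the bottom point `w` of `h`; every other strand is
  -- vertical.
  have H : Isotopy h g g' fun q => if q = u ∨ q = v then w else q :=
    { cup := h5
      mem := fun q hq => by
        split_ifs with hq'
        · exact hwT
        · exact (hT' q hq).resolve_right hq'
      left_cup := fun q _ => by
        rw [h2]
        rcases eq_or_ne q u with rfl | hqu
        · simp
        · rcases eq_or_ne q v with rfl | hqv
          · simp
          · rw [swap_apply_of_ne_of_ne hqu hqv]
      right_cup := fun q _ => by
        rw [h4]
        rcases eq_or_ne q v with rfl | hqu
        · simp [huw.symm, hvw.symm]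
        · rcases eq_or_ne q w with rfl | hqv
          · simp [huw.symm, hvw.symm]
          · rw [swap_apply_of_ne_of_ne hqu hqv]
      left_shift := fun p hp => by
        rw [h1, Perm.one_apply, if_neg]
        rintro (rfl | rfl)
        exacts [huT hp, hvT hp]
      right_shift := fun p hp => by
        have : p ≠ v := by rintro rfl; exact hvS hp
        rw [h3, Perm.one_apply, h6 p hp]
        simp [this]
      rel := fun q _ => by
        rw [h1, h2, h4, Perm.one_apply]
        have e1 : circ (swap u v) (swap v w) v w := by
          have := circ_right (swap u v) (swap v w) v
          rwa [swap_apply_left] at this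
        have e2 : circ (swap u v) (swap v w) u v := by
          have := circ_left (swap u v) (swap v w) u
          rwa [swap_apply_left] at this
        split_ifs with hq
        · rcases hq with rfl | rfl
          · exact (circ _ _).symm ((circ _ _).trans e2 e1)
          · exact (circ _ _).symm e1
        · exact (circ _ _).refl _ }
  obtain ⟨α⟩ := cup_cap_iso g' h
  obtain ⟨β⟩ := bimodule_iso_of_isotopy h (Flat.idTangle T) h g g' (fun _ => rfl) (fun _ _ => rfl) H
  exact ⟨α ≪≫ β.symm⟩

variable {u v w : Fin n} (huv : u ≠ v) (huw : u ≠ w) (hvw : v ≠ w)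

include huv huw hvw

/-- Moving the end points `v` and `w` to `u` and `v` and capping them there is capping them at `v`,
`w`. With `m = m₂ m₁`, the mirror image of the target cap is `c = m c'`, and `m` cancels against its
own mirror image. -/
theorem cap_move_move_iso (m₁ : Flat S₁ S₂) (m₂ : Flat S₂ S₃) (c : Flat S₄ S₃) (c' : Flat S₅ S₁)
    (e : S₅ = S₄) (h1 : m₁.shift = swap u v) (h2 : m₁.cup = 1) (h3 : m₂.shift = swap v w)
    (h4 : m₂.cup = 1) (h5 : c.shift = 1) (h6 : c.cup = swap u v) (h7 : c'.shift = 1)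
    (h8 : c'.cup = swap v w) :
    Nonempty (cupFunctor m₁ ⋙ cupFunctor m₂ ⋙ capFunctor c ≅ capFunctor c' ⋙ castFunctor e) := by
  subst e
  let m : Flat S₁ S₃ := m₂.comp m₁ h4 h2
  have hm : ∀ p, m.shift p = swap v w (swap u v p) := fun p => by
    show m₂.shift (m₁.shift p) = _
    rw [h1, h3]
  have hS : ∀ p ∈ S₅, p ≠ u ∧ p ≠ v ∧ p ≠ w := by
    intro p hp
    have e1 := c.disj p hp
    have e2 := c'.disj p hp
    rw [h5, h6, Perm.one_apply] at e1
    rw [h7, h8, Perm.one_apply] at e2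
    refine ⟨?_, ?_, ?_⟩ <;> rintro rfl
    · rw [swap_apply_left] at e1; exact huv e1.symm
    · rw [swap_apply_right] at e1; exact huv e1
    · rw [swap_apply_right] at e2; exact hvw e2
  have hs : ∀ p ∈ S₅, m.shift (c'.shift p) = c.shift p := by
    intro p hp
    obtain ⟨a1, a2, a3⟩ := hS p hp
    rw [hm, h7, h5, Perm.one_apply, swap_apply_of_ne_of_ne a1 a2, swap_apply_of_ne_of_ne a2 a3]
  -- `m^* m` is isotopic to the identity, because `m` has no cups and `m.shift` is a bijection.
  have H : Isotopy m (Flat.idTangle S₁) m m.shift.symm :=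
    { cup := rfl
      mem := fun q hq => ((m.mem_iff q).1 hq).resolve_right fun h => h rfl
      left_cup := fun _ _ => rfl
      right_cup := fun _ _ => rfl
      left_shift := fun p _ => symm_apply_apply _ _
      right_shift := fun p _ => symm_apply_apply _ _
      rel := fun q _ => by rw [apply_symm_apply] }
  obtain ⟨α⟩ := cupFunctor_comp_iso m₂ m₁ m (fun _ _ => rfl)
    (fun p h => absurd (by rw [h4]; rfl) h) fun p _ h => absurd (by rw [h2]; rfl) h
  obtain ⟨β⟩ := cup_cap_iso m c
  obtain ⟨γ⟩ := bimodule_iso_of_isotopy m c' c (Flat.idTangle S₁) m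
    (Flat.onMatch_comp m c' c hs (fun p h => absurd rfl h) fun p _ hp => by
      rw [h8, swap_apply_ne_self_iff] at hp
      rw [h8, h6, hm, hm]
      rcases hp.2 with rfl | rfl
      · simp [swap_apply_of_ne_of_ne huv huw, swap_apply_of_ne_of_ne huw.symm hvw.symm]
      · simp [swap_apply_of_ne_of_ne huv huw, swap_apply_of_ne_of_ne huw.symm hvw.symm]) hs H
  exact ⟨(Functor.associator _ _ _).symm ≪≫ Functor.isoWhiskerRight α _ ≪≫ β ≪≫ γ.symm ≪≫
    (Functor.rightUnitor _).symm⟩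

/-- The cup at `v`, `w` followed by the cap at `u`, `v` straightens to a strand from `u` to `w`.
Written as `m' m⁻¹`, it combines with the first move to `m'`. -/
theorem cap_cup_move_iso (m : Flat S₁ S₂) (c : Flat S₂ S₃) (d : Flat S₄ S₃) (m' : Flat S₁ S₅) (e : S₅ = S₄) (h1 : m.shift = swap u v) (h2 : m.cup = 1)
    (h3 : c.shift = 1) (h4 : c.cup = swap v w) (h5 : d.shift = 1) (h6 : d.cup = swap u v)
    (h7 : m'.shift = swap v w) (h8 : m'.cup = 1) :
    Nonempty (cupFunctor m ⋙ cupFunctor c ⋙ capFunctor d ≅ cupFunctor m' ⋙ castFunctor e) := by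
  subst e
  let g : Flat S₂ S₅ := m'.comp (m.inv h2) h8 rfl
  have hg : ∀ p, g.shift p = swap v w (swap u v p) := fun p => by
    show m'.shift (m.shift⁻¹ p) = _
    rw [h7, h1, swap_inv]
  have hS : ∀ p ∈ S₂, p ≠ v ∧ p ≠ w := by
    intro p hp
    have e1 := c.disj p hp
    rw [h3, h4, Perm.one_apply] at e1
    refine ⟨?_, ?_⟩ <;> rintro rfl
    · rw [swap_apply_left] at e1; exact hvw e1.symm
    · rw [swap_apply_right] at e1; exact hvw e1
  obtain ⟨α⟩ := zigzag_iso huv huw hvw d g c h5 h6 h3 h4 rfl fun p hp => by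
    obtain ⟨a1, a2⟩ := hS p hp
    rw [hg]
    split_ifs with h
    · rw [h, swap_apply_left, swap_apply_left]
    · rw [swap_apply_of_ne_of_ne h a1, swap_apply_of_ne_of_ne a1 a2]
  obtain ⟨β⟩ := cupFunctor_comp_iso g m m' (fun p _ => by rw [hg, h1, h7, swap_apply_self])
    (fun p h => absurd rfl h) fun p _ h => absurd (by rw [h2]; rfl) h
  exact ⟨Functor.isoWhiskerLeft _ α ≪≫ β ≪≫ (Functor.rightUnitor _).symm⟩

/-- The zigzag now comes first and runs from `w` to `u`. The straightened strand is `m⁻¹ m'`, and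
the move after it cancels `m⁻¹`. -/
theorem move_cap_cup_iso (c : Flat S₁ S₂) (d : Flat S₃ S₂) (m : Flat S₃ S₄) (m' : Flat S₅ S₄) (e : S₁ = S₅) (h1 : c.shift = 1) (h2 : c.cup = swap u v) (h3 : d.shift = 1)
    (h4 : d.cup = swap v w) (h5 : m.shift = swap u v) (h6 : m.cup = 1)
    (h7 : m'.shift = swap v w) (h8 : m'.cup = 1) :
    Nonempty (cupFunctor c ⋙ capFunctor d ⋙ cupFunctor m ≅ castFunctor e ⋙ cupFunctor m') := by
  subst e
  let g : Flat S₁ S₃ := (m.inv h6).comp m' rfl h8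
  have hg : ∀ p, g.shift p = swap u v (swap v w p) := fun p => by
    show m.shift⁻¹ (m'.shift p) = _
    rw [h7, h5, swap_inv]
  have hS : ∀ p ∈ S₁, p ≠ u ∧ p ≠ v := by
    intro p hp
    have e1 := c.disj p hp
    rw [h1, h2, Perm.one_apply] at e1
    refine ⟨?_, ?_⟩ <;> rintro rfl
    · rw [swap_apply_left] at e1; exact huv e1.symm
    · rw [swap_apply_right] at e1; exact huv e1
  obtain ⟨α⟩ := zigzag_iso hvw.symm huw.symm huv.symm d g c h3 (by rw [h4, swap_comm]) h1
    (by rw [h2, swap_comm]) rfl fun p hp => by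
    obtain ⟨a1, a2⟩ := hS p hp
    rw [hg]
    split_ifs with h
    · rw [h, swap_apply_right, swap_apply_right]
    · rw [swap_apply_of_ne_of_ne a2 h, swap_apply_of_ne_of_ne a1 a2]
  obtain ⟨β⟩ := cupFunctor_comp_iso m g m' (fun p _ => by rw [hg, h5, h7, swap_apply_self])
    (fun p h => absurd (by rw [h6]; rfl) h) fun p _ h => absurd rfl h
  exact ⟨(Functor.associator _ _ _).symm ≪≫ Functor.isoWhiskerRight α _ ≪≫ β ≪≫
    (Functor.leftUnitor _).symm⟩

/-- The two moves slide the ends of the cup from `u`, `v` to `v`, `w`. All tangles lack caps, so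
composition alone suffices and no isotopy is needed. -/
theorem move_move_cup_iso (c : Flat S₁ S₂) (m₁ : Flat S₂ S₃) (m₂ : Flat S₃ S₄) (c' : Flat S₅ S₄)
    (e : S₁ = S₅) (h1 : c.shift = 1) (h2 : c.cup = swap u v) (h3 : m₁.shift = swap v w)
    (h4 : m₁.cup = 1) (h5 : m₂.shift = swap u v) (h6 : m₂.cup = 1) (h7 : c'.shift = 1)
    (h8 : c'.cup = swap v w) :
    Nonempty (cupFunctor c ⋙ cupFunctor m₁ ⋙ cupFunctor m₂ ≅ castFunctor e ⋙ cupFunctor c') := by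
  subst e
  let m : Flat S₂ S₄ := m₂.comp m₁ h6 h4
  have hm : ∀ p, m.shift p = swap u v (swap v w p) := fun p => by
    show m₂.shift (m₁.shift p) = _
    rw [h3, h5]
  have hS : ∀ p ∈ S₁, p ≠ u ∧ p ≠ v ∧ p ≠ w := by
    intro p hp
    have e1 := c.disj p hp
    have e2 := c'.disj p hp
    rw [h1, h2, Perm.one_apply] at e1
    rw [h7, h8, Perm.one_apply] at e2
    refine ⟨?_, ?_, ?_⟩ <;> rintro rfl
    · rw [swap_apply_left] at e1; exact huv e1.symm
    · rw [swap_apply_right] at e1; exact huv e1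
    · rw [swap_apply_right] at e2; exact hvw e2
  obtain ⟨α⟩ := cupFunctor_comp_iso m₂ m₁ m (fun _ _ => rfl)
    (fun p h => absurd (by rw [h6]; rfl) h) fun p _ h => absurd (by rw [h4]; rfl) h
  obtain ⟨β⟩ := cupFunctor_comp_iso m c c' (fun p hp => by
      obtain ⟨a1, a2, a3⟩ := hS p hp
      rw [hm, h1, h7, Perm.one_apply, swap_apply_of_ne_of_ne a2 a3, swap_apply_of_ne_of_ne a1 a2])
    (fun p h => absurd rfl h) fun p _ hp => by
      rw [h2, swap_apply_ne_self_iff] at hp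
      rw [h8, h2, hm, hm]
      rcases hp.2 with rfl | rfl
      · simp [swap_apply_of_ne_of_ne huv huw, swap_apply_of_ne_of_ne huw.symm hvw.symm]
      · simp [swap_apply_of_ne_of_ne huv huw, swap_apply_of_ne_of_ne huw.symm hvw.symm]
  exact ⟨Functor.isoWhiskerLeft _ α ≪≫ β ≪≫ (Functor.leftUnitor _).symm⟩

-- A cup closed by a cap at the same two positions is a circle next to vertical strands, so
-- `circle_iso` applies. Of the elementary relations, this is the only one for which adjacency of
-- `u` and `v` is assumed explicitly, since `Flat.cupTangle` asks for it.
omit huw hvw in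
theorem cap_cup_iso (c : Flat S₁ S₂) (d : Flat S₃ S₂) (e : S₁ = S₃)
    (huv' : (u : ℕ) + 1 = v ∨ (v : ℕ) + 1 = u)
    (h1 : c.shift = 1) (h2 : c.cup = swap u v) (h3 : d.shift = 1) (h4 : d.cup = swap u v) :
    Nonempty (cupFunctor c ⋙ capFunctor d ≅ castFunctor e ⋙ shiftSum (H S₃) (Hgr S₃)) := by
  subst e
  have hS : ∀ p ∈ S₁, p ≠ u ∧ p ≠ v := by
    intro p hp
    have e1 := c.disj p hp
    rw [h1, h2, Perm.one_apply] at e1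
    refine ⟨?_, ?_⟩ <;> rintro rfl
    · rw [swap_apply_left] at e1; exact huv e1.symm
    · rw [swap_apply_right] at e1; exact huv e1
  have hT : ∀ p, p ∈ S₂ ↔ p ∈ S₁ ∨ p = u ∨ p = v := by
    intro p
    rw [c.mem_iff, h1, h2, swap_apply_ne_self_iff]
    exact or_congr Iff.rfl (and_iff_right huv)
  -- The remaining fields of a flat tangle are proofs, so `shift` and `cup` determine it.
  have hd : ∀ f : Flat S₁ S₂, f.shift = 1 → f.cup = swap u v → f = Flat.cupTangle u v huv'
      (fun h => (hS _ h).1 rfl) (fun h => (hS _ h).2 rfl) hT := by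
    rintro ⟨σ, τ, _, _, _, _, _⟩ rfl rfl
    rfl
  obtain rfl := (hd c h1 h2).trans (hd d h3 h4).symm
  rw [hd c h1 h2]
  obtain ⟨α⟩ := cup_cap_iso c c
  rw [hd c h1 h2] at α
  obtain ⟨β⟩ := circle_iso (huv := huv') (hu := fun h => (hS _ h).1 rfl)
    (hv := fun h => (hS _ h).2 rfl) hT
  exact ⟨α ≪≫ β ≪≫ (Functor.leftUnitor _).symm⟩

end Relations

/-! ### Functors with zero values -/

section ZeroFunctors

variable {𝓐 : Type*} [Category 𝓐] {R : Type} [Ring R] {𝓡 : ℤ → AddSubgroup R} {T : Type} [Ring T]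
  {𝓣 : ℤ → AddSubgroup T}

/-- A functor is zero if all its values are zero. -/
def Vanishes (A : 𝓐 ⥤ GrMod R 𝓡) : Prop := ∀ X, Subsingleton (A.obj X).carrier

theorem Vanishes.iso {A B : 𝓐 ⥤ GrMod R 𝓡} (hA : Vanishes A) (hB : Vanishes B) :
    Nonempty (A ≅ B) :=
  ⟨natIsoOfInverse (fun _ => 0) (fun _ _ => 0) (fun _ r _ => (smul_zero r).symm)
    (fun _ _ _ _ => zero_mem _) (fun X _ => (hA X).elim _ _) (fun X _ => (hB X).elim _ _)
    fun _ Y _ _ => (hB Y).elim _ _⟩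

theorem Vanishes.of_iso {A B : 𝓐 ⥤ GrMod R 𝓡} (α : A ≅ B) (hB : Vanishes B) : Vanishes A := by
  intro X
  refine ⟨fun x y => ?_⟩
  have h : ∀ x, (α.inv.app X).lin ((α.hom.app X).lin x) = x := fun x =>
    congrArg (fun f : A.obj X ⟶ A.obj X => f.lin x) (α.hom_inv_id_app X)
  rw [← h x, ← h y, (hB X).elim ((α.hom.app X).lin x)]

theorem Vanishes.tensor {A : 𝓐 ⥤ GrMod T 𝓣} (hA : Vanishes A) (hT : DirectSum.IsInternal 𝓣)
    (B : GrBimod R 𝓡 T 𝓣) : Vanishes (A ⋙ B.tensor hT) := by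
  intro X
  have := hA X
  have h : ∀ z : Tens B (A.obj X), z = 0 := by
    intro z
    induction z using Tens.induction B (A.obj X) with
    | h0 => rfl
    | ha x y hx hy => rw [hx, hy, add_zero]
    | hm b x => rw [Subsingleton.elim x 0, Tens.mk_zero]
  exact ⟨fun x y => (h x).trans (h y).symm⟩

theorem Vanishes.cast {n : ℕ} {S S' : Finset (Fin n)} {A : 𝓐 ⥤ GrMod (H S) (Hgr S)}
    (hA : Vanishes A) (h : S = S') : Vanishes (A ⋙ castFunctor h) := by
  subst h
  exact hA

theorem Vanishes.shiftSum {A : 𝓐 ⥤ GrMod R 𝓡} (hA : Vanishes A) :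
    Vanishes (A ⋙ shiftSum R 𝓡) := by
  intro X
  have := hA X
  exact inferInstanceAs (Subsingleton ((A.obj X).carrier × (A.obj X).carrier))

end ZeroFunctors

/-! ### Weights, and the components of the transfer functors -/

section Components

variable {n k : ℕ}

/-- The projection of `𝓒` to `𝓒(μ)`. -/
abbrev ev (μ : Weight n k) : C n k ⥤ CW μ := Pi.eval (fun l : Weight n k => CW l) μ

/-- `μ = l + j e_u - j e_v`. -/
structure Weight.Moves (l μ : Weight n k) (u v : Fin n) (j : ℕ) : Prop where
  fst : μ.val u = l.val u + j
  snd : l.val v = μ.val v + j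
  off : ∀ p, p ≠ u → p ≠ v → μ.val p = l.val p

theorem Weight.exists_moves (μ : Weight n k) {u v : Fin n} (huv : u ≠ v) {j : ℕ}
    (h : j ≤ μ.val u ∧ μ.val v + j ≤ 2) : ∃ l : Weight n k, l.Moves μ u v j :=
  ⟨μ.source u v huv j h, by simp [Weight.source]; omega, by simp [Weight.source, huv.symm],
    fun p h1 h2 => by simp [Weight.source, h1, h2]⟩

/-- The functors are defined through `Weight.source`, whereas the case analysis works with arbitrary
weights and linear equations between their entries. This lemma connects the two descriptions. -/
theorem Weight.Moves.eq_source {l μ : Weight n k} {u v : Fin n} {j : ℕ} (m : l.Moves μ u v j)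
    (huv : u ≠ v) (h : j ≤ μ.val u ∧ μ.val v + j ≤ 2) : l = μ.source u v huv j h := by
  have e : l.val = (μ.source u v huv j h).val := by
    funext p
    simp only [Weight.source]
    split_ifs with h1 h2
    · subst h1; have := m.fst; omega
    · subst h2; exact m.snd
    · exact (m.off p h1 h2).symm
  cases l
  cases e
  rfl

/-- Moving two units is possible only from (0,2) to (2,0), and neither pair contains a one. -/
theorem Weight.Moves.ones_eq {l μ : Weight n k} {u v : Fin n} (m : l.Moves μ u v 2) :
    l.ones = μ.ones := by
  have h1 := m.fst
  have h2 := m.snd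
  have := μ.le_two u
  have := l.le_two v
  ext p
  rw [Weight.mem_ones, Weight.mem_ones]
  by_cases hu : p = u
  · subst hu; omega
  · by_cases hv : p = v
    · subst hv; omega
    · rw [m.off p hu hv]

variable {u v : Fin n} (huv : (u : ℕ) + 1 = v ∨ (v : ℕ) + 1 = u)

/-- Each component of a transfer reads a single weight space. Once `l` is replaced by the source
weight, the two functors are equal by definition. -/
theorem transfer_eval {l μ : Weight n k} (m : l.Moves μ u v 1) :
    Nonempty (transfer k u v huv ⋙ ev μ ≅ ev l ⋙ moveFunctor u v huv l μ m.fst m.snd m.off) := by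
  have hne : u ≠ v := by rintro rfl; omega
  have h1 := m.fst
  have h2 := m.snd
  have := l.le_two v
  have h : 1 ≤ μ.val u ∧ μ.val v + 1 ≤ 2 := by omega
  obtain rfl := m.eq_source hne h
  exact ⟨eqToIso (dif_pos h)⟩

/-- The tangle is exposed only through `shift` and `cup`, which is all that the relations between
elementary tangles ask for. The same holds for `transfer_cap` and `transfer_move`. -/
theorem transfer_cup {l μ : Weight n k} (m : l.Moves μ u v 1) (h : l.val u = 0) (h' : l.val v = 2) :
    ∃ g : Flat l.ones μ.ones, g.shift = 1 ∧ g.cup = swap u v ∧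
      Nonempty (transfer k u v huv ⋙ ev μ ≅ ev l ⋙ cupFunctor g) := by
  obtain ⟨α⟩ := transfer_eval huv m
  rw [moveFunctor, dif_pos ⟨h, h'⟩] at α
  exact ⟨_, rfl, rfl, ⟨α⟩⟩

theorem transfer_cap {l μ : Weight n k} (m : l.Moves μ u v 1) (h : l.val u = 1) (h' : l.val v = 1) :
    ∃ f : Flat μ.ones l.ones, f.shift = 1 ∧ f.cup = swap u v ∧
      Nonempty (transfer k u v huv ⋙ ev μ ≅ ev l ⋙ capFunctor f) := by
  obtain ⟨α⟩ := transfer_eval huv m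
  rw [moveFunctor, dif_neg (by omega), dif_pos ⟨h, h'⟩] at α
  exact ⟨_, rfl, rfl, ⟨α⟩⟩

theorem transfer_move {l μ : Weight n k} (m : l.Moves μ u v 1)
    (h : (l.val u = 0 ∧ l.val v = 1) ∨ (l.val u = 1 ∧ l.val v = 2)) :
    ∃ g : Flat l.ones μ.ones, g.shift = swap u v ∧ g.cup = 1 ∧
      Nonempty (transfer k u v huv ⋙ ev μ ≅ ev l ⋙ cupFunctor g) := by
  obtain ⟨α⟩ := transfer_eval huv m
  rw [moveFunctor, dif_neg (by omega), dif_neg (by omega)] at α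
  exact ⟨_, rfl, rfl, ⟨α⟩⟩

/-- The weight that would be transferred to `μ` has an entry -1 or 3. An arbitrary functor `A` in
front makes the lemma applicable to the last factor of a composite, and `A = 𝟭` covers the first
factor. -/
theorem transfer_vanishes {μ : Weight n k} (h : μ.val u = 0 ∨ μ.val v = 2)
    (A : C n k ⥤ C n k) : Vanishes ((A ⋙ transfer k u v huv) ⋙ ev μ) := by
  have e : transfer k u v huv ⋙ ev μ = zeroFunctor μ := dif_neg (by omega)
  have h0 : Vanishes (transfer k u v huv ⋙ ev μ) := by
    rw [e]
    exact fun _ => inferInstanceAs (Subsingleton PUnit)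
  exact fun X => h0 (A.obj X)

/-- The component of a transfer at `μ` is a tensor product applied to the component at `l`, and
tensor products preserve zero. Iterating this lemma traces a composite back to a weight that is not
admissible. -/
theorem transfer_vanishes_comp {l μ : Weight n k} (m : l.Moves μ u v 1) {A : C n k ⥤ C n k}
    (hA : Vanishes (A ⋙ ev l)) : Vanishes ((A ⋙ transfer k u v huv) ⋙ ev μ) := by
  obtain ⟨α⟩ := transfer_eval huv m
  refine Vanishes.of_iso (B := (A ⋙ ev l) ⋙ moveFunctor u v huv l μ m.fst m.snd m.off)
    (Functor.isoWhiskerLeft A α) ?_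
  rw [moveFunctor]
  split_ifs
  all_goals exact hA.tensor _ _

theorem divided_eval (hne : u ≠ v) {l μ : Weight n k} (m : l.Moves μ u v 2) :
    Nonempty (divided k u v hne ⋙ ev μ ≅ ev l ⋙ castFunctor m.ones_eq) := by
  have h1 := m.fst
  have h2 := m.snd
  have := l.le_two v
  have h : 2 ≤ μ.val u ∧ μ.val v + 2 ≤ 2 := by omega
  obtain rfl := m.eq_source hne h
  exact ⟨eqToIso (dif_pos h)⟩

theorem divided_vanishes (hne : u ≠ v) {μ : Weight n k} (h : ¬ (μ.val u = 2 ∧ μ.val v = 0))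
    (A : C n k ⥤ C n k) : Vanishes ((A ⋙ divided k u v hne) ⋙ ev μ) := by
  have := μ.le_two u
  have e : divided k u v hne ⋙ ev μ = zeroFunctor μ := dif_neg (by omega)
  have h0 : Vanishes (divided k u v hne ⋙ ev μ) := by
    rw [e]
    exact fun _ => inferInstanceAs (Subsingleton PUnit)
  exact fun X => h0 (A.obj X)

theorem divided_vanishes_comp (hne : u ≠ v) {l μ : Weight n k} (m : l.Moves μ u v 2)
    {A : C n k ⥤ C n k} (hA : Vanishes (A ⋙ ev l)) :
    Vanishes ((A ⋙ divided k u v hne) ⋙ ev μ) := by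
  obtain ⟨α⟩ := divided_eval hne m
  exact Vanishes.of_iso (B := (A ⋙ ev l) ⋙ castFunctor m.ones_eq)
    (Functor.isoWhiskerLeft A α) (hA.cast _)

/-- The components of a composition. -/
def compEv {l' l μ : Weight n k} {A B : C n k ⥤ C n k} {P : CW l ⥤ CW μ} {Q : CW l' ⥤ CW l}
    (α : B ⋙ ev μ ≅ ev l ⋙ P) (β : A ⋙ ev l ≅ ev l' ⋙ Q) : (A ⋙ B) ⋙ ev μ ≅ ev l' ⋙ Q ⋙ P :=
  Functor.isoWhiskerLeft A α ≪≫ Functor.isoWhiskerRight β P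

theorem dsum_vanishes {A B : C n k ⥤ C n k} {μ : Weight n k} (hA : Vanishes (A ⋙ ev μ))
    (hB : Vanishes (B ⋙ ev μ)) : Vanishes (dsum A B ⋙ ev μ) := by
  intro X
  have h1 : Subsingleton ((A.obj X) μ).carrier := hA X
  have h2 : Subsingleton ((B.obj X) μ).carrier := hB X
  exact inferInstanceAs (Subsingleton (((A.obj X) μ).carrier × ((B.obj X) μ).carrier))

theorem dsum_iso_left {A B : C n k ⥤ C n k} {μ : Weight n k} (hB : Vanishes (B ⋙ ev μ)) :
    Nonempty (A ⋙ ev μ ≅ dsum A B ⋙ ev μ) := by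
  have h : ∀ X, Subsingleton ((B.obj X) μ).carrier := hB
  exact ⟨natIsoOfInverse (G := dsum A B ⋙ ev μ)
    (fun X => AddMonoidHom.inl ((A.obj X) μ).carrier ((B.obj X) μ).carrier)
    (fun X => Prod.fst) (fun X r x => Prod.ext rfl ((h X).elim _ _))
    (fun X d x hx => ⟨hx, zero_mem _⟩) (fun X x => rfl) (fun X x => Prod.ext rfl ((h X).elim _ _))
    fun X Y f x => Prod.ext rfl ((h Y).elim _ _)⟩

theorem dsum_iso_right {A B : C n k ⥤ C n k} {μ : Weight n k} (hA : Vanishes (A ⋙ ev μ)) :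
    Nonempty (B ⋙ ev μ ≅ dsum A B ⋙ ev μ) := by
  have h : ∀ X, Subsingleton ((A.obj X) μ).carrier := hA
  exact ⟨natIsoOfInverse (G := dsum A B ⋙ ev μ)
    (fun X => AddMonoidHom.inr ((A.obj X) μ).carrier ((B.obj X) μ).carrier)
    (fun X => Prod.snd) (fun X r x => Prod.ext ((h X).elim _ _) rfl)
    (fun X d x hx => ⟨zero_mem _, hx⟩) (fun X x => rfl) (fun X x => Prod.ext ((h X).elim _ _) rfl)
    fun X Y f x => Prod.ext ((h Y).elim _ _) rfl⟩

theorem dsum_shift_eval (A : C n k ⥤ C n k) (μ : Weight n k) :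
    Nonempty (dsum (A ⋙ shiftC n k 1) (A ⋙ shiftC n k (-1)) ⋙ ev μ ≅
      (A ⋙ ev μ) ⋙ shiftSum (H μ.ones) (Hgr μ.ones)) :=
  ⟨NatIso.ofComponents (fun _ => Iso.refl _) fun _ => rfl⟩

theorem nonempty_iso_of_components {A B : C n k ⥤ C n k}
    (h : ∀ μ, Nonempty (A ⋙ ev μ ≅ B ⋙ ev μ)) : Nonempty (A ≅ B) :=
  ⟨NatIso.pi' fun μ => (h μ).some⟩

/-- The square of a transfer functor. -/
theorem transfer_sq_iso (hne : u ≠ v) :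
    Nonempty (transfer k u v huv ⋙ transfer k u v huv ≅
      dsum (divided k u v hne ⋙ shiftC n k 1) (divided k u v hne ⋙ shiftC n k (-1))) := by
  refine nonempty_iso_of_components fun μ => ?_
  obtain ⟨ρ⟩ := dsum_shift_eval (divided k u v hne) μ
  have := μ.le_two u
  -- Two units must arrive at `u` and leave `v`, so the entries at `u`, `v` run through (0,2),
  -- (1,1), (2,0): a cup, then a cap at the same place.
  by_cases h : μ.val u = 2 ∧ μ.val v = 0
  · obtain ⟨l₁, m₁⟩ := μ.exists_moves hne (j := 1) (by omega)
    have f1 := m₁.fst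
    have s1 := m₁.snd
    obtain ⟨l₂, m₂⟩ := l₁.exists_moves hne (j := 1) (by omega)
    have f2 := m₂.fst
    have s2 := m₂.snd
    have m : l₂.Moves μ u v 2 := ⟨by omega, by omega, fun p h1 h2 => by
      rw [m₁.off p h1 h2, m₂.off p h1 h2]⟩
    obtain ⟨c, a1, a2, ⟨α⟩⟩ := transfer_cup huv m₂ (by omega) (by omega)
    obtain ⟨d, b1, b2, ⟨β⟩⟩ := transfer_cap huv m₁ (by omega) (by omega)
    obtain ⟨γ⟩ := divided_eval hne m
    obtain ⟨δ⟩ := cap_cup_iso hne c d m.ones_eq huv a1 a2 b1 b2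
    have γ' : (divided k u v hne ⋙ ev μ) ⋙ shiftSum (H μ.ones) (Hgr μ.ones) ≅
        ev l₂ ⋙ castFunctor m.ones_eq ⋙ shiftSum (H μ.ones) (Hgr μ.ones) :=
      Functor.isoWhiskerRight γ _
    exact ⟨compEv β α ≪≫ Functor.isoWhiskerLeft _ δ ≪≫ γ'.symm ≪≫ ρ.symm⟩
  · refine Vanishes.iso ?_ (Vanishes.of_iso ρ ?_)
    · by_cases h1 : μ.val u = 0 ∨ μ.val v = 2
      · exact transfer_vanishes huv h1 _
      · have := μ.le_two v
        obtain ⟨l₁, m₁⟩ := μ.exists_moves hne (j := 1) (by omega)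
        have f1 := m₁.fst
        have s1 := m₁.snd
        -- Going back one step is possible here, going back two is not: either `μ` has only one unit
        -- at `u`, or it already has one at `v`.
        exact transfer_vanishes_comp huv m₁ (transfer_vanishes huv (by omega) (𝟭 _))
    · exact Vanishes.shiftSum (divided_vanishes hne h (𝟭 _))

/-! ### The cubic relation when the third position is a neighbour of `v` -/

section Right

variable {w : Fin n} (hvw : (v : ℕ) + 1 = w ∨ (w : ℕ) + 1 = v) (h₁ : u ≠ v) (h₂ : u ≠ w)
  (h₃ : v ≠ w)

include h₂ h₃

/-- The divided power needs the target (2,0) at `u`, `v`. Before it the entries there are (0,2), so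
the transfer from `w` to `v` is blocked only when `w` still has value 2 afterwards. -/
theorem transfer_divided_vanishes {μ : Weight n k}
    (h : ¬ (μ.val u = 2 ∧ μ.val v = 0 ∧ μ.val w ≤ 1)) :
    Vanishes ((transfer k v w hvw ⋙ divided k u v h₁) ⋙ ev μ) := by
  by_cases h' : μ.val u = 2 ∧ μ.val v = 0
  · obtain ⟨l, m⟩ := μ.exists_moves h₁ (j := 2) (by omega)
    have o := m.off w h₂.symm h₃.symm
    have := μ.le_two w
    exact divided_vanishes_comp h₁ m (transfer_vanishes hvw (by omega) (𝟭 _))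
  · exact divided_vanishes h₁ h' _

/-- The last step adds one unit at `v` to a weight with entries (2,0) at `u`, `v`, so it ends with
(2,1) there, and with at most 1 at `w`. -/
theorem divided_transfer_vanishes {μ : Weight n k}
    (h : ¬ (μ.val u = 2 ∧ μ.val v = 1 ∧ μ.val w ≤ 1)) :
    Vanishes ((divided k u v h₁ ⋙ transfer k v w hvw) ⋙ ev μ) := by
  by_cases h' : μ.val v = 0 ∨ μ.val w = 2
  · exact transfer_vanishes hvw h' _
  · have := μ.le_two w
    obtain ⟨l, m⟩ := μ.exists_moves h₃ (j := 1) (by omega)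
    have f := m.fst
    have o := m.off u h₁ h₂
    exact transfer_vanishes_comp hvw m (divided_vanishes h₁ (by omega) (𝟭 _))

omit h₂ h₃ in
/-- The Serre relation for the transfers from `v` to `u` and from `w` to `v`. -/
theorem transfer_serre_right {x : Fin n} (e : v = x) (hvw : (x : ℕ) + 1 = w ∨ (w : ℕ) + 1 = x)
    (h₁ : u ≠ v) (h₂ : u ≠ w) (h₃ : v ≠ w) :
    Nonempty (transfer k u v huv ⋙ transfer k x w hvw ⋙ transfer k u v huv ≅
      dsum (transfer k x w hvw ⋙ divided k u v h₁) (divided k u v h₁ ⋙ transfer k x w hvw)) := by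
  -- The positions `v` and `x` are kept apart in the statement because in the application they are
  -- the second position of one index and the first of another, equal only propositionally.
  subst e
  refine nonempty_iso_of_components fun μ => ?_
  have hu := μ.le_two u
  have hv := μ.le_two v
  have hw := μ.le_two w
  -- In total `u` gains two units while `v` and `w` lose one each, so for a nonzero component these
  -- bounds are forced. The weights run through `l₁`, `l₂`, `l₃`, `μ`.
  by_cases h : μ.val u = 2 ∧ μ.val v ≤ 1 ∧ μ.val w ≤ 1
  · obtain ⟨l₃, m₃⟩ := μ.exists_moves h₁ (j := 1) (by omega)
    have f3 := m₃.fst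
    have s3 := m₃.snd
    have o3 := m₃.off w h₂.symm h₃.symm
    obtain ⟨l₂, m₂⟩ := l₃.exists_moves h₃ (j := 1) (by omega)
    have f2 := m₂.fst
    have s2 := m₂.snd
    have o2 := m₂.off u h₁ h₂
    obtain ⟨l₁, m₁⟩ := l₂.exists_moves h₁ (j := 1) (by omega)
    have f1 := m₁.fst
    have s1 := m₁.snd
    have o1 := m₁.off w h₂.symm h₃.symm
    -- The entry at `v` decides which summand survives: the one ending with the divided power if it
    -- is 0, the one beginning with it if it is 1.
    by_cases hv0 : μ.val v = 0
    · obtain ⟨δ⟩ := dsum_iso_left (A := transfer k v w hvw ⋙ divided k u v h₁)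
        (divided_transfer_vanishes hvw h₁ h₂ h₃ (μ := μ) (by omega))
      obtain ⟨l, m⟩ := μ.exists_moves h₁ (j := 2) (by omega)
      have f := m.fst
      have s := m.snd
      have o := m.off w h₂.symm h₃.symm
      -- Both sides start from the same weight `l₁`: undoing the divided power gives `l`, and
      -- undoing the remaining transfer from there leads to `l₁`.
      have m' : l₁.Moves l v w 1 := ⟨by omega, by omega, fun p p1 p2 => by
        by_cases p3 : p = u
        · subst p3; omega
        · rw [← m.off p p3 p1, m₃.off p p3 p1, m₂.off p p1 p2, m₁.off p p3 p1]⟩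
      obtain ⟨γ⟩ := divided_eval h₁ m
      obtain ⟨a, a1, a2, ⟨α⟩⟩ := transfer_move huv m₁ (by omega)
      obtain ⟨d, d1, d2, ⟨κ⟩⟩ := transfer_cap huv m₃ (by omega) (by omega)
      -- In the order `u`, `v`, `w`: for `μ_w = 0`, the paths are 011, 101, 110, 200 and 011, 020,
      -- 200 (two moves and a cap against a cap). For `μ_w = 1`, they are 012, 102, 111, 201 and
      -- 012, 021, 201 (move, cup, cap against a move).
      by_cases hw0 : μ.val w = 0
      · obtain ⟨b, b1, b2, ⟨β⟩⟩ := transfer_move hvw m₂ (by omega)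
        obtain ⟨c, c1, c2, ⟨η⟩⟩ := transfer_cap hvw m' (by omega) (by omega)
        obtain ⟨θ⟩ := cap_move_move_iso h₁ h₂ h₃ a b d c m.ones_eq a1 a2 b1 b2 d1 d2 c1 c2
        exact ⟨compEv (compEv κ β) α ≪≫ Functor.isoWhiskerLeft _ θ ≪≫ (compEv γ η).symm ≪≫ δ⟩
      · obtain ⟨b, b1, b2, ⟨β⟩⟩ := transfer_cup hvw m₂ (by omega) (by omega)
        obtain ⟨c, c1, c2, ⟨η⟩⟩ := transfer_move hvw m' (by omega)
        obtain ⟨θ⟩ := cap_cup_move_iso h₁ h₂ h₃ a b d c m.ones_eq a1 a2 b1 b2 d1 d2 c1 c2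
        exact ⟨compEv (compEv κ β) α ≪≫ Functor.isoWhiskerLeft _ θ ≪≫ (compEv γ η).symm ≪≫ δ⟩
    · obtain ⟨δ⟩ := dsum_iso_right (B := divided k u v h₁ ⋙ transfer k v w hvw)
        (transfer_divided_vanishes hvw h₁ h₂ h₃ (μ := μ) (by omega))
      obtain ⟨l, m'⟩ := μ.exists_moves h₃ (j := 1) (by omega)
      have f := m'.fst
      have s := m'.snd
      have o := m'.off u h₁ h₂
      have m : l₁.Moves l u v 2 := ⟨by omega, by omega, fun p p1 p2 => by
        by_cases p3 : p = w
        · subst p3; omega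
        · rw [← m'.off p p2 p3, m₃.off p p1 p2, m₂.off p p2 p3, m₁.off p p1 p2]⟩
      obtain ⟨γ⟩ := divided_eval h₁ m
      obtain ⟨a, a1, a2, ⟨α⟩⟩ := transfer_cup huv m₁ (by omega) (by omega)
      obtain ⟨d, d1, d2, ⟨κ⟩⟩ := transfer_move huv m₃ (by omega)
      -- For `μ_w = 0`, the paths are 021, 111, 120, 210 and 021, 201, 210 (cup, cap, move against a
      -- move). For `μ_w = 1`, they are 022, 112, 121, 211 and 022, 202, 211 (cup and two moves
      -- against a cup).
      by_cases hw0 : μ.val w = 0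
      · obtain ⟨b, b1, b2, ⟨β⟩⟩ := transfer_cap hvw m₂ (by omega) (by omega)
        obtain ⟨c, c1, c2, ⟨η⟩⟩ := transfer_move hvw m' (by omega)
        obtain ⟨θ⟩ := move_cap_cup_iso h₁ h₂ h₃ a b d c m.ones_eq a1 a2 b1 b2 d1 d2 c1 c2
        exact ⟨compEv (compEv κ β) α ≪≫ Functor.isoWhiskerLeft _ θ ≪≫ (compEv η γ).symm ≪≫ δ⟩
      · obtain ⟨b, b1, b2, ⟨β⟩⟩ := transfer_move hvw m₂ (by omega)
        obtain ⟨c, c1, c2, ⟨η⟩⟩ := transfer_cup hvw m' (by omega) (by omega)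
        obtain ⟨θ⟩ := move_move_cup_iso h₁ h₂ h₃ a b d c m.ones_eq a1 a2 b1 b2 d1 d2 c1 c2
        exact ⟨compEv (compEv κ β) α ≪≫ Functor.isoWhiskerLeft _ θ ≪≫ (compEv η γ).symm ≪≫ δ⟩
  · refine Vanishes.iso ?_ (dsum_vanishes (transfer_divided_vanishes hvw h₁ h₂ h₃ (by omega))
      (divided_transfer_vanishes hvw h₁ h₂ h₃ (by omega)))
    show Vanishes (((transfer k u v huv ⋙ transfer k v w hvw) ⋙ transfer k u v huv) ⋙ ev μ)
    -- Outside these bounds the path is followed backwards from `μ` until one of the three transfers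
    -- has no admissible source.
    by_cases h4 : μ.val u = 0 ∨ μ.val v = 2
    · exact transfer_vanishes huv h4 _
    obtain ⟨l₃, m₃⟩ := μ.exists_moves h₁ (j := 1) (by omega)
    have f3 := m₃.fst
    have s3 := m₃.snd
    have o3 := m₃.off w h₂.symm h₃.symm
    refine transfer_vanishes_comp huv m₃ ?_
    by_cases h5 : μ.val w = 2
    · exact transfer_vanishes hvw (by omega) _
    obtain ⟨l₂, m₂⟩ := l₃.exists_moves h₃ (j := 1) (by omega)
    have f2 := m₂.fst
    have o2 := m₂.off u h₁ h₂
    exact transfer_vanishes_comp hvw m₂ (transfer_vanishes huv (by omega) (𝟭 _))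

end Right

/-! ### The cubic relation when the third position is a neighbour of `u` -/

section Left

variable {w : Fin n} (hwu : (w : ℕ) + 1 = u ∨ (u : ℕ) + 1 = w) (h₁ : u ≠ v) (h₂ : u ≠ w)
  (h₃ : v ≠ w)

include h₂ h₃

/-- Before the divided power the entry at `u` is 0, so the transfer from `u` to `w` is blocked only
if it leaves nothing at `w`. -/
theorem transfer_divided_vanishes' {μ : Weight n k}
    (h : ¬ (μ.val u = 2 ∧ μ.val v = 0 ∧ 1 ≤ μ.val w)) :
    Vanishes ((transfer k w u hwu ⋙ divided k u v h₁) ⋙ ev μ) := by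
  by_cases h' : μ.val u = 2 ∧ μ.val v = 0
  · obtain ⟨l, m⟩ := μ.exists_moves h₁ (j := 2) (by omega)
    have o := m.off w h₂.symm h₃.symm
    exact divided_vanishes_comp h₁ m (transfer_vanishes hwu (by omega) (𝟭 _))
  · exact divided_vanishes h₁ h' _

/-- The last step takes one unit away from the entries (2,0) at `u`, `v` and adds it at `w`. -/
theorem divided_transfer_vanishes' {μ : Weight n k}
    (h : ¬ (μ.val u = 1 ∧ μ.val v = 0 ∧ 1 ≤ μ.val w)) :
    Vanishes ((divided k u v h₁ ⋙ transfer k w u hwu) ⋙ ev μ) := by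
  by_cases h' : μ.val w = 0 ∨ μ.val u = 2
  · exact transfer_vanishes hwu h' _
  · have := μ.le_two u
    obtain ⟨l, m⟩ := μ.exists_moves h₂.symm (j := 1) (by omega)
    have s := m.snd
    have o := m.off v h₃ h₁.symm
    exact transfer_vanishes_comp hwu m (divided_vanishes h₁ (by omega) (𝟭 _))

omit h₂ h₃ in
/-- The Serre relation for the transfers from `v` to `u` and from `u` to `w`. -/
theorem transfer_serre_left {x : Fin n} (e : u = x) (hwu : (w : ℕ) + 1 = x ∨ (x : ℕ) + 1 = w)
    (h₁ : u ≠ v) (h₂ : u ≠ w) (h₃ : v ≠ w) :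
    Nonempty (transfer k u v huv ⋙ transfer k w x hwu ⋙ transfer k u v huv ≅
      dsum (transfer k w x hwu ⋙ divided k u v h₁) (divided k u v h₁ ⋙ transfer k w x hwu)) := by
  subst e
  refine nonempty_iso_of_components fun μ => ?_
  have hu := μ.le_two u
  have hv := μ.le_two v
  have hw := μ.le_two w
  -- In total `v` loses two units while `u` and `w` gain one each. Replacing each entry by its
  -- difference from 2 and exchanging `u` with `v` turns these conditions into those of the other
  -- case.
  by_cases h : 1 ≤ μ.val u ∧ μ.val v = 0 ∧ 1 ≤ μ.val w
  · obtain ⟨l₃, m₃⟩ := μ.exists_moves h₁ (j := 1) (by omega)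
    have f3 := m₃.fst
    have s3 := m₃.snd
    have o3 := m₃.off w h₂.symm h₃.symm
    obtain ⟨l₂, m₂⟩ := l₃.exists_moves h₂.symm (j := 1) (by omega)
    have f2 := m₂.fst
    have s2 := m₂.snd
    have o2 := m₂.off v h₃ h₁.symm
    obtain ⟨l₁, m₁⟩ := l₂.exists_moves h₁ (j := 1) (by omega)
    have f1 := m₁.fst
    have s1 := m₁.snd
    have o1 := m₁.off w h₂.symm h₃.symm
    -- Now the entry at the middle position `u` decides which summand survives.
    rcases Nat.lt_or_ge (μ.val u) 2 with hu1 | hu2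
    · obtain ⟨δ⟩ := dsum_iso_right (B := divided k u v h₁ ⋙ transfer k w u hwu)
        (transfer_divided_vanishes' hwu h₁ h₂ h₃ (μ := μ) (by omega))
      obtain ⟨l, m'⟩ := μ.exists_moves h₂.symm (j := 1) (by omega)
      have f := m'.fst
      have s := m'.snd
      have o := m'.off v h₃ h₁.symm
      have m : l₁.Moves l u v 2 := ⟨by omega, by omega, fun p p1 p2 => by
        by_cases p3 : p = w
        · subst p3; omega
        · rw [← m'.off p p3 p1, m₃.off p p1 p2, m₂.off p p3 p1, m₁.off p p1 p2]⟩
      obtain ⟨γ⟩ := divided_eval h₁ m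
      obtain ⟨a, a1, a2, ⟨α⟩⟩ := transfer_cup huv m₁ (by omega) (by omega)
      obtain ⟨d, d1, d2, ⟨κ⟩⟩ := transfer_move huv m₃ (by omega)
      -- The middle position is `u` here, so the relations between elementary tangles are used with
      -- `u` and `v` exchanged, and the transpositions have to be written accordingly.
      rw [swap_comm] at a2 d1
      -- In the order `w`, `u`, `v`: for `μ_w = 2`, the paths are 102, 111, 201, 210 and 102, 120,
      -- 210. For `μ_w = 1`, they are 002, 011, 101, 110 and 002, 020, 110.
      by_cases hw2 : μ.val w = 2
      · obtain ⟨b, b1, b2, ⟨β⟩⟩ := transfer_cap hwu m₂ (by omega) (by omega)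
        obtain ⟨c, c1, c2, ⟨η⟩⟩ := transfer_move hwu m' (by omega)
        rw [swap_comm] at b2 c1
        obtain ⟨θ⟩ := move_cap_cup_iso h₁.symm h₃ h₂ a b d c m.ones_eq a1 a2 b1 b2 d1 d2 c1 c2
        exact ⟨compEv (compEv κ β) α ≪≫ Functor.isoWhiskerLeft _ θ ≪≫ (compEv η γ).symm ≪≫ δ⟩
      · obtain ⟨b, b1, b2, ⟨β⟩⟩ := transfer_move hwu m₂ (by omega)
        obtain ⟨c, c1, c2, ⟨η⟩⟩ := transfer_cup hwu m' (by omega) (by omega)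
        rw [swap_comm] at b1 c2
        obtain ⟨θ⟩ := move_move_cup_iso h₁.symm h₃ h₂ a b d c m.ones_eq a1 a2 b1 b2 d1 d2 c1 c2
        exact ⟨compEv (compEv κ β) α ≪≫ Functor.isoWhiskerLeft _ θ ≪≫ (compEv η γ).symm ≪≫ δ⟩
    · obtain ⟨δ⟩ := dsum_iso_left (A := transfer k w u hwu ⋙ divided k u v h₁)
        (divided_transfer_vanishes' hwu h₁ h₂ h₃ (μ := μ) (by omega))
      obtain ⟨l, m⟩ := μ.exists_moves h₁ (j := 2) (by omega)
      have f := m.fst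
      have s := m.snd
      have o := m.off w h₂.symm h₃.symm
      have m' : l₁.Moves l w u 1 := ⟨by omega, by omega, fun p p1 p2 => by
        by_cases p3 : p = v
        · subst p3; omega
        · rw [← m.off p p2 p3, m₃.off p p2 p3, m₂.off p p1 p2, m₁.off p p2 p3]⟩
      obtain ⟨γ⟩ := divided_eval h₁ m
      obtain ⟨a, a1, a2, ⟨α⟩⟩ := transfer_move huv m₁ (by omega)
      obtain ⟨d, d1, d2, ⟨κ⟩⟩ := transfer_cap huv m₃ (by omega) (by omega)
      rw [swap_comm] at a1 d2
      -- For `μ_w = 2`, the paths are 112, 121, 211, 220 and 112, 202, 220. For `μ_w = 1`, they are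
      -- 012, 021, 111, 120 and 012, 102, 120.
      by_cases hw2 : μ.val w = 2
      · obtain ⟨b, b1, b2, ⟨β⟩⟩ := transfer_move hwu m₂ (by omega)
        obtain ⟨c, c1, c2, ⟨η⟩⟩ := transfer_cap hwu m' (by omega) (by omega)
        rw [swap_comm] at b1 c2
        obtain ⟨θ⟩ := cap_move_move_iso h₁.symm h₃ h₂ a b d c m.ones_eq a1 a2 b1 b2 d1 d2 c1 c2
        exact ⟨compEv (compEv κ β) α ≪≫ Functor.isoWhiskerLeft _ θ ≪≫ (compEv γ η).symm ≪≫ δ⟩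
      · obtain ⟨b, b1, b2, ⟨β⟩⟩ := transfer_cup hwu m₂ (by omega) (by omega)
        obtain ⟨c, c1, c2, ⟨η⟩⟩ := transfer_move hwu m' (by omega)
        rw [swap_comm] at b2 c1
        obtain ⟨θ⟩ := cap_cup_move_iso h₁.symm h₃ h₂ a b d c m.ones_eq a1 a2 b1 b2 d1 d2 c1 c2
        exact ⟨compEv (compEv κ β) α ≪≫ Functor.isoWhiskerLeft _ θ ≪≫ (compEv γ η).symm ≪≫ δ⟩
  · refine Vanishes.iso ?_ (dsum_vanishes (transfer_divided_vanishes' hwu h₁ h₂ h₃ (by omega))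
      (divided_transfer_vanishes' hwu h₁ h₂ h₃ (by omega)))
    show Vanishes (((transfer k u v huv ⋙ transfer k w u hwu) ⋙ transfer k u v huv) ⋙ ev μ)
    by_cases h4 : μ.val u = 0 ∨ μ.val v = 2
    · exact transfer_vanishes huv h4 _
    obtain ⟨l₃, m₃⟩ := μ.exists_moves h₁ (j := 1) (by omega)
    have f3 := m₃.fst
    have s3 := m₃.snd
    have o3 := m₃.off w h₂.symm h₃.symm
    refine transfer_vanishes_comp huv m₃ ?_
    by_cases h5 : μ.val w = 0
    · exact transfer_vanishes hwu (by omega) _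
    obtain ⟨l₂, m₂⟩ := l₃.exists_moves h₂.symm (j := 1) (by omega)
    have s2 := m₂.snd
    have o2 := m₂.off v h₃ h₁.symm
    exact transfer_vanishes_comp hwu m₂ (transfer_vanishes huv (by omega) (𝟭 _))

end Left

end Components

end ArcAlg

end

theorem mainTheorem9 (n k : ℕ) (hk1 : 1 ≤ k) (hk2 : k + 1 ≤ n) :
    (∀ i : Fin (n - 1),
      Nonempty (ArcAlg.E k i ⋙ ArcAlg.E k i ≅
        ArcAlg.dsum (ArcAlg.E2 k i ⋙ ArcAlg.shiftC n k 1)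
          (ArcAlg.E2 k i ⋙ ArcAlg.shiftC n k (-1))) ∧
      Nonempty (ArcAlg.F k i ⋙ ArcAlg.F k i ≅
        ArcAlg.dsum (ArcAlg.F2 k i ⋙ ArcAlg.shiftC n k 1)
          (ArcAlg.F2 k i ⋙ ArcAlg.shiftC n k (-1)))) ∧
    (∀ i j : Fin (n - 1), ((j : ℕ) = i + 1 ∨ (i : ℕ) = j + 1) →
      Nonempty (ArcAlg.E k i ⋙ ArcAlg.E k j ⋙ ArcAlg.E k i ≅
        ArcAlg.dsum (ArcAlg.E k j ⋙ ArcAlg.E2 k i) (ArcAlg.E2 k i ⋙ ArcAlg.E k j)) ∧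
      Nonempty (ArcAlg.F k i ⋙ ArcAlg.F k j ⋙ ArcAlg.F k i ≅
        ArcAlg.dsum (ArcAlg.F k j ⋙ ArcAlg.F2 k i) (ArcAlg.F2 k i ⋙ ArcAlg.F k j))) := by
  refine ⟨fun i => ⟨ArcAlg.transfer_sq_iso _ _, ArcAlg.transfer_sq_iso _ _⟩, fun i j hij => ?_⟩
  have hi := ArcAlg.pos_ne_next i
  rcases hij with hij | hij
  -- Here `j = i + 1`. For E the second index feeds the position from which `E_i` takes, which is
  -- the relation on the right. For F it takes from the position that `F_i` feeds, which is the
  -- relation on the left.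
  · have e : ArcAlg.pos j = ArcAlg.next i := Fin.ext hij
    have h₁ : ArcAlg.pos i ≠ ArcAlg.next j := by
      simp only [ArcAlg.pos, ArcAlg.next, ne_eq, Fin.mk.injEq]
      omega
    have h₂ : ArcAlg.next i ≠ ArcAlg.next j := e ▸ ArcAlg.pos_ne_next j
    exact ⟨ArcAlg.transfer_serre_right _ e.symm _ hi h₁ h₂,
      ArcAlg.transfer_serre_left _ e.symm _ hi.symm h₂ h₁⟩
  -- For `j = i - 1` the roles of the two relations are exchanged.
  · have e : ArcAlg.next j = ArcAlg.pos i := Fin.ext hij.symm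
    have h₁ : ArcAlg.next i ≠ ArcAlg.pos j := by
      simp only [ArcAlg.pos, ArcAlg.next, ne_eq, Fin.mk.injEq]
      omega
    have h₂ : ArcAlg.pos i ≠ ArcAlg.pos j := e ▸ (ArcAlg.pos_ne_next j).symm
    exact ⟨ArcAlg.transfer_serre_left _ e.symm _ hi h₂ h₁,
      ArcAlg.transfer_serre_right _ e.symm _ hi.symm h₁ h₂⟩
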